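/- Let $K,L\ge 1$ be integers and $d=2K+L-1$. For each $N\ge 1$ let $A_1^{(N)},\dots,A_L^{(N)}$ be random $N\times N$ matrices, all defined on one probability space, such that for each fixed $N$ the $LN^2$ entries of $A_1^{(N)},\dots,A_L^{(N)}$ are independent standard complex normal variables ($\mathbb E a=\mathbb E a^2=0$, $\mathbb E|a|^2=1$); nothing is assumed on the joint law for different $N$. Let $H_N$ be the $K\times(K+L-1)$ block matrix with $N\times N$ blocks whose block $(i,j)$ is $A^{(N)}_{j-i+1}$ if $0\le j-i\le L-1$ and $0$ otherwise (the channel matrix of a MIMO system with $n_T=n_R=N$, frame length $K$ and intersymbol interference with $L$ taps), and let $n=Nd$. The Cauchy transform of a probability measure $\mu$ on $\mathbb R$ is $G_\mu(z)=\int\frac{d\mu(t)}{z-t}$, $z\in\mathbb C^+=\{\Im z>0\}$. Then there are deterministic probability measures $\mu$, $\nu_1,\dots,\nu_K$, $\rho_1,\dots,\rho_{K+L-1}$ on $\mathbb R$, with Cauchy transforms $f_j=G_{\nu_j}$ and $g_j=G_{\rho_j}$, such that the following holds. 1. Each $\nu_j$ has a density, and $\mu=\frac1K\sum_{j=1}^K\nu_j$,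 that is, $G_\mu=\frac1K\sum_{j=1}^K f_j$ on $\mathbb C^+$. With probability one, as $N\to\infty$, the spectral law (the normalized eigenvalue counting measure) of $H_NH_N^*/n$ converges weakly to $\mu$, and its Cauchy transform converges to $\frac1K\sum_{j=1}^K f_j(z)$ for every $z\in\mathbb C^+$. 2. $f_j=f_{K+1-j}$ for $1\le j\le K$, and $g_j=g_{K+L-j}$ for $1\le j\le K+L-1$. 3. The matrix $\mathcal G(z)=\mathrm{diag}(f_1(z),\dots,f_K(z),g_1(z),\dots,g_{K+L-1}(z))$ satisfies, for all $z\in\mathbb C^+$, $$z\,\mathcal G(z)=I_d+z\,\eta(\mathcal G(z))\,\mathcal G(z).$$ Here $\eta(D)_{ij}=\frac1d\sum_{k,l=1}^d\sigma(i,k;l,j)D_{kl}$ is the covariance mapping of the $d\times d$ block matrix $X=\begin{pmatrix}0&H_N\\H_N^*&0\end{pmatrix}$: $\sigma(i,j;k,l)=1$ if one of the blocks $(i,j)$, $(k,l)$ of $X$ is a tap and the other one is the adjoint of the same tap, and $\sigma(i,j;k,l)=0$ otherwise. Moreover, $\eta(\mathcal G)$ is diagonal with $$\eta(\mathcal G)_{j,j}=\begin{cases}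 \frac1d\sum_{k=0}^{L-1}g_{j+k}, & 1\le j\le K,\\ \frac1d\sum_{k=1}^{j-K}f_k, & K+1\le j\le K+\min\{K,L\},\\ \frac1d\sum_{k=j-K-L+1}^{j-K}f_k, & K+L<j\le 2K\text{ and }L<K,\\ \frac1d\sum_{k=1}^{K}f_k, & 2K<j\le K+L\text{ and }L\ge K,\\ \frac1d\sum_{k=j-K-L+1}^{K}f_k, & K+\max\{K,L\}<j\le 2K+L-1. \end{cases}$$ -/

import Mathlib

open MeasureTheory ProbabilityTheory Filter Topology
open scoped NNReal ENNReal Matrix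

noncomputable section

/-- The standard complex normal law: real and imaginary parts are independent, centred normal
variables of variance `1/2`, so that `E a = 0`, `E a² = 0` and `E |a|² = 1`. -/
def stdComplexGaussian : Measure ℂ :=
  ((gaussianReal 0 2⁻¹).prod (gaussianReal 0 2⁻¹)).map fun p => (⟨p.1, p.2⟩ : ℂ)

/-- The entries of the `L` random `N × N` matrices `A 0, …, A (L-1)` are independent standard
complex normal variables. -/
structure IsGaussianTaps {Ω : Type*} [MeasurableSpace Ω] (P : Measure Ω) {L N : ℕ}
    (A : Ω → Fin L → Matrix (Fin N) (Fin N) ℂ) : Prop where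
  law : ∀ (l : Fin L) (r p : Fin N), HasLaw (fun ω => A ω l r p) stdComplexGaussian P
  indep : iIndepFun (fun (x : Fin L × Fin N × Fin N) ω => A ω x.1 x.2.1 x.2.2) P

/-- The channel matrix for a frame of length `K` over a channel with `L` taps: a
`K × (K + L - 1)` matrix of `N × N` blocks, whose block `(i, j)` is the tap `A (j - i)` if
`0 ≤ j - i < L` and `0` otherwise. -/
def channelMatrix (K : ℕ) {L N : ℕ} (A : Fin L → Matrix (Fin N) (Fin N) ℂ) :
    Matrix (Fin K × Fin N) (Fin (K + L - 1) × Fin N) ℂ :=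
  Matrix.of fun x y =>
    if h : (x.1 : ℕ) ≤ (y.1 : ℕ) ∧ (y.1 : ℕ) - (x.1 : ℕ) < L then
      A ⟨(y.1 : ℕ) - (x.1 : ℕ), h.2⟩ x.2 y.2
    else 0

/-- The matrix `H Hᴴ / n` for the channel matrix `H`, where `n = N d`, `d = 2 K + L - 1`. -/
def channelWishart (K : ℕ) {L N : ℕ} (A : Fin L → Matrix (Fin N) (Fin N) ℂ) :
    Matrix (Fin K × Fin N) (Fin K × Fin N) ℂ :=
  (((N * (2 * K + L - 1) : ℕ) : ℝ)⁻¹) • (channelMatrix K A * (channelMatrix K A)ᴴ)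

theorem channelWishart_isHermitian (K : ℕ) {L N : ℕ} (A : Fin L → Matrix (Fin N) (Fin N) ℂ) :
    (channelWishart K A).IsHermitian := by
  unfold channelWishart
  rw [Matrix.IsHermitian, Matrix.conjTranspose_smul,
    Matrix.isHermitian_mul_conjTranspose_self (channelMatrix K A)]
  simp

/-- The Dirac mass at `x`, as a finite measure. -/
def diracFinite (x : ℝ) : FiniteMeasure ℝ :=
  ⟨Measure.dirac x, inferInstance⟩

/-- The spectral law (empirical law of the eigenvalues, with multiplicity) of a Hermitian matrix. -/
def spectralLaw {ι : Type*} [Fintype ι] [DecidableEq ι] {M : Matrix ι ι ℂ}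
    (hM : M.IsHermitian) : FiniteMeasure ℝ :=
  (Fintype.card ι : ℝ≥0)⁻¹ •
    ∑ i, diracFinite (hM.eigenvalues i)

/-- The Cauchy transform `G_μ(z) = ∫ 1 / (z - t) dμ(t)`. -/
def cauchyTransform (μ : Measure ℝ) (z : ℂ) : ℂ :=
  ∫ t : ℝ, 1 / (z - (t : ℂ)) ∂μ

/-- In the Hermitian `d × d` block matrix `X = [[0, H], [Hᴴ, 0]]`, with `d = 2 K + L - 1` and `H`
the channel matrix, the block `(i, j)` lies in the part `H` and is the tap number `t` (all indices
start at `0`). By the Hermitian symmetry, the block `(j, i)` is then the adjoint of that tap. -/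
def IsTapBlock (K L : ℕ) (i j : Fin (2 * K + L - 1)) (t : ℕ) : Prop :=
  (i : ℕ) < K ∧ t < L ∧ (j : ℕ) = K + i + t

open Classical in
/-- The covariance function of the blocks of `X = [[0, H], [Hᴴ, 0]]`: `σ(i, j; k, l) = 1` if one
of the blocks `(i, j)`, `(k, l)` is a tap and the other one is the adjoint of the same tap, and
`σ(i, j; k, l) = 0` otherwise. -/
def channelCov (K L : ℕ) (i j k l : Fin (2 * K + L - 1)) : ℂ :=
  if ∃ t, (IsTapBlock K L i j t ∧ IsTapBlock K L l k t) ∨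
      (IsTapBlock K L j i t ∧ IsTapBlock K L k l t) then 1 else 0

/-- The covariance mapping `η(D) i j = (1/d) ∑ k l, σ(i, k; l, j) D k l`. -/
def covarianceMap {d : ℕ} (σ : Fin d → Fin d → Fin d → Fin d → ℂ)
    (D : Matrix (Fin d) (Fin d) ℂ) : Matrix (Fin d) (Fin d) ℂ :=
  Matrix.of fun i j => (1 / (d : ℂ)) * ∑ k, ∑ l, σ i k l j * D k l

/-- The diagonal matrix `diag(f 1, …, f K, g 1, …, g (K + L - 1))`. -/
def diagMatrix (K L : ℕ) (f g : ℕ → ℂ) :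
    Matrix (Fin (2 * K + L - 1)) (Fin (2 * K + L - 1)) ℂ :=
  Matrix.diagonal fun i =>
    if (i : ℕ) + 1 ≤ K then f ((i : ℕ) + 1) else g ((i : ℕ) + 1 - K)

/-- The explicit diagonal entries `η(𝒢)_{j,j}`, `1 ≤ j ≤ 2 K + L - 1`. In the last case
`j > K + max K L`. -/
def etaEntry (K L : ℕ) (f g : ℕ → ℂ) (j : ℕ) : ℂ :=
  (1 / ((2 * K + L - 1 : ℕ) : ℂ)) *
    (if j ≤ K then ∑ k ∈ Finset.range L, g (j + k)
    else if j ≤ K + min K L then ∑ k ∈ Finset.Icc 1 (j - K), f k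
    else if j ≤ 2 * K ∧ L < K then ∑ k ∈ Finset.Icc (j - K - L + 1) (j - K), f k
    else if j ≤ K + L ∧ K ≤ L then ∑ k ∈ Finset.Icc 1 K, f k
    else ∑ k ∈ Finset.Icc (j - K - L + 1) K, f k)

end

/-! Linearise. Put `X = s [[0, H], [Hᴴ, 0]]` with `s² N = 1/d`. It is linear in the Gaussian
entries, and the upper left corner of its resolvent at `w` is `w` times the resolvent of `H Hᴴ / n`
at `w²` (`toBlocks₁₁_matrixResolvent_fromBlocks`). So it suffices to follow the `d²` normalized
block traces of `(w - X)⁻¹`.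

Gaussian integration by parts turns `(w - X) G = 1` into a loop equation (`blockResolvent_loop`)
involving expected products of two block traces. The Gaussian Poincaré inequality bounds their
variances by a constant over `N²` (`dispersion_blockResolvent_le`), so these expectations factorise
up to that order. Off-diagonal block traces have mean zero: since `H` is block Toeplitz, conjugation
by `diag(ζ^b)` only rotates each tap by a phase, which preserves the law. Hence the diagonal means
solve the quadratic vector equation `w m_b = 1 + m_b ∑ S_bc m_c` up to `O(N⁻²)`
(`exists_isQVEApprox`).

The equation is stable (`IsQVEApprox.norm_sub_le`): taking imaginary parts shows that the
linearisation is a strict contraction in a weighted supremum norm. Therefore the means form a Cauchy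
sequence and converge to the unique solution. The variances are summable in `N`, so the block traces
themselves converge almost surely, whatever the coupling of different `N`; a Lipschitz bound extends
this from countably many `w` to all of them at once.

Each limit `m_b` is the Cauchy transform of a probability measure, by tightness. Uniqueness gives
`m(-conj w) = -conj (m w)`, so the image of that measure under `t ↦ t²` has Cauchy transform
`m_b(w)/w` at `z = w²`. These images are the laws sought; the quadratic vector equation becomes the
matrix equation in `z`, and the reflection symmetries of `S` pass to the laws by uniqueness. Weak
convergence follows from convergence of Cauchy transforms, because the Cauchy kernels and `1` span a
point-separating star algebra up to closure.

For the densities, `IsQVESolution.norm_mul_norm_le` gives `|f_j(z)| ≤ (1 + d)/|z|`, which leaves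
only a possible atom at zero. A counting argument (`atom_eq_zero_of_matching`) excludes it, using
that row block `j` is matched with column block `K + j` by the first tap. -/

noncomputable section

/-! ### Stability and uniqueness for the quadratic vector equation. -/

section QuadraticVectorEquation

variable {B : Type*} [Fintype B]

/-- `m` solves the quadratic vector equation `w m = 1 + m (S m)` up to the error `e`, and has the
sign and the size of a vector of Cauchy transforms at `w`. -/
structure IsQVEApprox (S : B → B → ℝ) (w : ℂ) (m e : B → ℂ) : Prop where
  im_neg : ∀ b, (m b).im < 0
  norm_le : ∀ b, ‖m b‖ ≤ 1 / w.im
  eq : ∀ b, w * m b = 1 + m b * ∑ c, S b c * m c + e b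

/-- A lower bound for the entries of approximate solutions of the quadratic vector equation. -/
def qveLower (S : B → B → ℝ) (w : ℂ) : ℝ := 1 / (2 * (‖w‖ + (∑ b, ∑ c, S b c) / w.im))

variable {S : B → B → ℝ} {w : ℂ} {m m' e e' : B → ℂ}

theorem row_sum_le (hS : ∀ b c, 0 ≤ S b c) (b : B) : ∑ c, S b c ≤ ∑ b, ∑ c, S b c :=
  Finset.single_le_sum (f := fun b => ∑ c, S b c)
    (fun b _ => Finset.sum_nonneg fun c _ => hS b c) (Finset.mem_univ b)

theorem qveLower_pos (hS : ∀ b c, 0 ≤ S b c) (hw : 0 < w.im) : 0 < qveLower S w := by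
  have h1 : 0 < ‖w‖ := norm_pos_iff.2 (by rintro rfl; simp at hw)
  have h2 : 0 ≤ ∑ b, ∑ c, S b c :=
    Finset.sum_nonneg fun b _ => Finset.sum_nonneg fun c _ => hS b c
  unfold qveLower
  positivity

theorem IsQVEApprox.norm_sum_le (h : IsQVEApprox S w m e) (hS : ∀ b c, 0 ≤ S b c)
    (hw : 0 < w.im) (b : B) : ‖∑ c, (S b c : ℂ) * m c‖ ≤ (∑ b, ∑ c, S b c) / w.im := by
  calc ‖∑ c, (S b c : ℂ) * m c‖ ≤ ∑ c, S b c * (1 / w.im) := by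
        refine norm_sum_le_of_le _ fun c _ => ?_
        rw [norm_mul, Complex.norm_real, Real.norm_of_nonneg (hS b c)]
        exact mul_le_mul_of_nonneg_left (h.norm_le c) (hS b c)
    _ = (∑ c, S b c) / w.im := by rw [← Finset.sum_mul]; ring
    _ ≤ _ := by exact div_le_div_of_nonneg_right (row_sum_le hS b) hw.le

/-- The equation reads `1 + e = m (w - S m)`: the left side has modulus at least `1/2`, and the
bracket is bounded because `‖m‖ ≤ 1 / Im w`. -/
theorem IsQVEApprox.lower (h : IsQVEApprox S w m e) (hS : ∀ b c, 0 ≤ S b c)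
    (hw : 0 < w.im) {b : B} (he : ‖e b‖ ≤ 1 / 2) : qveLower S w ≤ ‖m b‖ := by
  have hl := qveLower_pos hS hw
  have h1 : 1 + e b = m b * (w - ∑ c, (S b c : ℂ) * m c) := by linear_combination -h.eq b
  have h2 : 1 / 2 ≤ ‖1 + e b‖ := by
    have := norm_sub_norm_le (1 : ℂ) (-e b)
    rw [norm_neg, sub_neg_eq_add, norm_one] at this
    linarith
  have h3 : ‖w - ∑ c, (S b c : ℂ) * m c‖ ≤ ‖w‖ + (∑ b, ∑ c, S b c) / w.im :=
    (norm_sub_le _ _).trans (by gcongr; exact h.norm_sum_le hS hw b)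
  rw [h1, norm_mul] at h2
  have h5 : 0 < ‖w‖ + (∑ b, ∑ c, S b c) / w.im := by
    unfold qveLower at hl
    have := one_div_pos.1 hl
    linarith
  unfold qveLower
  rw [div_le_iff₀ (by linarith)]
  nlinarith [mul_le_mul_of_nonneg_left h3 (norm_nonneg (m b))]

/-- The imaginary part of the quadratic vector equation. -/
theorem IsQVEApprox.im_eq (h : IsQVEApprox S w m e) (b : B) :
    w.im * ‖m b‖ ^ 2 + ‖m b‖ ^ 2 * ∑ c, S b c * -(m c).im =
      -(m b).im + (e b * (starRingEnd ℂ) (m b)).im := by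
  have h1 : (w - ∑ c, (S b c : ℂ) * m c) * (m b * (starRingEnd ℂ) (m b)) =
      (starRingEnd ℂ) (m b) + e b * (starRingEnd ℂ) (m b) := by
    linear_combination (starRingEnd ℂ) (m b) * h.eq b
  rw [Complex.mul_conj, Complex.normSq_eq_norm_sq] at h1
  have h2 := congrArg Complex.im h1
  rw [Complex.im_mul_ofReal, Complex.add_im, Complex.conj_im, Complex.sub_im, Complex.im_sum]
    at h2
  simp only [Complex.im_ofReal_mul] at h2
  rw [← h2]
  simp only [mul_neg, Finset.sum_neg_distrib]
  ring

theorem abs_im_mul_conj_le (x y : ℂ) : |(x * (starRingEnd ℂ) y).im| ≤ ‖x‖ * ‖y‖ := by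
  refine (Complex.abs_im_le_norm _).trans ?_
  rw [norm_mul, Complex.norm_conj]

/-- In the imaginary part of the equation, one half of the term `Im w ‖m‖²` absorbs the error and
the other half yields the gain `1 - qveLower S w * Im w / 2`. This gain is the contraction factor of
the stability estimate. -/
theorem IsQVEApprox.sum_im_le (h : IsQVEApprox S w m e) (hS : ∀ b c, 0 ≤ S b c)
    (hw : 0 < w.im) {b : B} (he : ‖e b‖ ≤ 1 / 2) (he' : ‖e b‖ ≤ qveLower S w * w.im / 2) :
    ‖m b‖ ^ 2 * ∑ c, S b c * -(m c).im ≤ (1 - qveLower S w * w.im / 2) * -(m b).im := by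
  have h1 := h.im_eq b
  have h2 := (abs_le.1 (abs_im_mul_conj_le (e b) (m b))).2
  have h3 := h.lower hS hw he
  have h4 : -(m b).im ≤ ‖m b‖ := (neg_le_abs _).trans (Complex.abs_im_le_norm _)
  have h5 := qveLower_pos hS hw
  have h6 : ‖e b‖ * ‖m b‖ ≤ ‖m b‖ * w.im / 2 * ‖m b‖ := by gcongr; exact he'.trans (by gcongr)
  have h7 : qveLower S w * w.im / 2 * -(m b).im ≤ ‖m b‖ * w.im / 2 * ‖m b‖ := by
    have := h.im_neg b
    gcongr
    linarith
  nlinarith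

/-- The same imaginary part with the nonnegative `S`-sum discarded. -/
theorem IsQVEApprox.im_lower (h : IsQVEApprox S w m e) (hS : ∀ b c, 0 ≤ S b c)
    (hw : 0 < w.im) {b : B} (he : ‖e b‖ ≤ 1 / 2) (he' : ‖e b‖ ≤ qveLower S w * w.im / 2) :
    qveLower S w ^ 2 * w.im / 2 ≤ -(m b).im := by
  have h1 := h.im_eq b
  have h2 := (abs_le.1 (abs_im_mul_conj_le (e b) (m b))).2
  have h3 := h.lower hS hw he
  have h5 := qveLower_pos hS hw
  have h6 : ‖e b‖ * ‖m b‖ ≤ ‖m b‖ * w.im / 2 * ‖m b‖ := by gcongr; exact he'.trans (by gcongr)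
  have h7 : 0 ≤ ‖m b‖ ^ 2 * ∑ c, S b c * -(m c).im := by
    refine mul_nonneg (by positivity) (Finset.sum_nonneg fun c _ => mul_nonneg (hS b c) ?_)
    linarith [h.im_neg c]
  have h8 : qveLower S w ^ 2 * w.im / 2 ≤ ‖m b‖ ^ 2 * w.im / 2 := by gcongr
  nlinarith

theorem IsQVEApprox.sub_eq (h : IsQVEApprox S w m e) (h' : IsQVEApprox S w m' e') (b : B) :
    m b - m' b = m b * m' b * ∑ c, (S b c : ℂ) * (m c - m' c) + (e b * m' b - e' b * m b) := by
  simp only [mul_sub, Finset.sum_sub_distrib]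
  linear_combination m' b * h.eq b - m b * h'.eq b

/-- The constant in the stability estimate for the quadratic vector equation. -/
def qveStability (S : B → B → ℝ) (w : ℂ) : ℝ :=
  8 / (qveLower S w ^ 3 * w.im ^ 4)

/-- Cauchy–Schwarz with weights `a`; it will combine the inequalities for two solutions into one for
the geometric mean of their imaginary parts. -/
theorem sum_mul_sqrt_le {a x y : B → ℝ} (ha : ∀ c, 0 ≤ a c) (hx : ∀ c, 0 ≤ x c)
    (hy : ∀ c, 0 ≤ y c) :
    ∑ c, a c * √(x c * y c) ≤ √((∑ c, a c * x c) * ∑ c, a c * y c) := by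
  refine Real.le_sqrt_of_sq_le ?_
  refine Finset.sum_sq_le_sum_mul_sum_of_sq_le_mul _ (fun c _ => ?_) (fun c _ => ?_)
    fun c _ => le_of_eq ?_
  · exact mul_nonneg (ha c) (hx c)
  · exact mul_nonneg (ha c) (hy c)
  · rw [mul_pow, Real.sq_sqrt (mul_nonneg (hx c) (hy c))]
    ring

/-- Stability of the quadratic vector equation. -/
theorem IsQVEApprox.norm_sub_le (h : IsQVEApprox S w m e) (h' : IsQVEApprox S w m' e')
    (hS : ∀ b c, 0 ≤ S b c) (hw : 0 < w.im) {ε : ℝ} (he : ∀ b, ‖e b‖ ≤ ε)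
    (he' : ∀ b, ‖e' b‖ ≤ ε) (hε : ε ≤ 1 / 2) (hε' : ε ≤ qveLower S w * w.im / 2) (b : B) :
    ‖m b - m' b‖ ≤ qveStability S w * ε := by
  have hl := qveLower_pos hS hw
  set l := qveLower S w with hldef
  set k := l * w.im / 2 with hk
  have hkpos : 0 < k := by positivity
  -- The weight of the supremum norm in which `u ↦ m m' S u` contracts: the geometric mean of the
  -- two negated imaginary parts.
  set θ : B → ℝ := fun b => √(-(m b).im * -(m' b).im) with hθ
  have hp : ∀ b, 0 ≤ -(m b).im := fun b => by linarith [h.im_neg b]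
  have hp' : ∀ b, 0 ≤ -(m' b).im := fun b => by linarith [h'.im_neg b]
  have hθlow : ∀ b, l ^ 2 * w.im / 2 ≤ θ b := fun b => by
    refine Real.le_sqrt_of_sq_le ?_
    rw [sq]
    exact mul_le_mul (h.im_lower hS hw ((he b).trans hε) ((he b).trans hε'))
      (h'.im_lower hS hw ((he' b).trans hε) ((he' b).trans hε')) (by positivity) (hp b)
  have hθpos : ∀ b, 0 < θ b := fun b => lt_of_lt_of_le (by positivity) (hθlow b)
  have hθup : ∀ b, θ b ≤ 1 / w.im := fun b => by
    refine (Real.sqrt_le_left (by positivity)).2 ?_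
    rw [sq]
    exact mul_le_mul (((neg_le_abs _).trans (Complex.abs_im_le_norm _)).trans (h.norm_le b))
      (((neg_le_abs _).trans (Complex.abs_im_le_norm _)).trans (h'.norm_le b)) (hp' b)
      (by positivity)
  have hk1 : ∀ b : B, 0 ≤ 1 - k := fun b => by
    have h1 := h.lower hS hw ((he b).trans hε)
    have h2 := h.norm_le b
    have h3 : l ≤ 1 / w.im := h1.trans h2
    rw [le_div_iff₀ hw] at h3
    rw [hk]
    linarith
  have hSθ : ∀ b, ‖m b‖ * ‖m' b‖ * ∑ c, S b c * θ c ≤ (1 - k) * θ b := fun b => by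
    have h1 := sum_mul_sqrt_le (hS b) hp hp'
    have h2 := h.sum_im_le hS hw ((he b).trans hε) ((he b).trans hε')
    have h3 := h'.sum_im_le hS hw ((he' b).trans hε) ((he' b).trans hε')
    rw [← hldef, ← hk] at h2 h3
    calc ‖m b‖ * ‖m' b‖ * ∑ c, S b c * θ c
        ≤ ‖m b‖ * ‖m' b‖ * √((∑ c, S b c * -(m c).im) * ∑ c, S b c * -(m' c).im) := by gcongr
      _ = √((‖m b‖ ^ 2 * ∑ c, S b c * -(m c).im) *
            (‖m' b‖ ^ 2 * ∑ c, S b c * -(m' c).im)) := by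
          rw [show (‖m b‖ ^ 2 * ∑ c, S b c * -(m c).im) *
            (‖m' b‖ ^ 2 * ∑ c, S b c * -(m' c).im) = (‖m b‖ * ‖m' b‖) ^ 2 *
            ((∑ c, S b c * -(m c).im) * ∑ c, S b c * -(m' c).im) by ring,
            Real.sqrt_mul (sq_nonneg _), Real.sqrt_sq (by positivity)]
      _ ≤ √(((1 - k) * -(m b).im) * ((1 - k) * -(m' b).im)) := by
          refine Real.sqrt_le_sqrt (mul_le_mul h2 h3 ?_ (mul_nonneg (hk1 b) (hp b)))
          exact mul_nonneg (by positivity)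
            (Finset.sum_nonneg fun c _ => mul_nonneg (hS b c) (hp' c))
      _ = (1 - k) * θ b := by
          rw [show ((1 - k) * -(m b).im) * ((1 - k) * -(m' b).im) =
            (1 - k) ^ 2 * (-(m b).im * -(m' b).im) by ring, Real.sqrt_mul (sq_nonneg _),
            Real.sqrt_sq (hk1 b)]
  -- At an index where the weighted difference is largest, the contraction bounds the maximum by `1
  -- - k` times itself plus the errors.
  obtain ⟨b₀, -, hb₀⟩ := Finset.exists_max_image Finset.univ (fun b => ‖m b - m' b‖ / θ b)
    ⟨b, Finset.mem_univ b⟩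
  set κ := ‖m b₀ - m' b₀‖ / θ b₀ with hκ
  have hκ' : ∀ c, ‖m c - m' c‖ ≤ κ * θ c := fun c =>
    (div_le_iff₀ (hθpos c)).1 (hb₀ c (Finset.mem_univ c))
  have hκ0 : 0 ≤ κ := by positivity
  have hmain : κ * θ b₀ ≤ (1 - k) * θ b₀ * κ + 2 * ε / w.im := by
    calc κ * θ b₀ = ‖m b₀ - m' b₀‖ := div_mul_cancel₀ _ (hθpos b₀).ne'
      _ ≤ ‖m b₀‖ * ‖m' b₀‖ * (∑ c, S b₀ c * θ c) * κ + 2 * ε / w.im := by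
        rw [h.sub_eq h' b₀]
        refine (norm_add_le _ _).trans (add_le_add ?_ ?_)
        · rw [norm_mul, norm_mul, mul_assoc _ (∑ c, S b₀ c * θ c)]
          gcongr
          rw [Finset.sum_mul]
          refine norm_sum_le_of_le _ fun c _ => ?_
          rw [norm_mul, Complex.norm_real, Real.norm_of_nonneg (hS b₀ c), mul_assoc]
          refine mul_le_mul_of_nonneg_left ?_ (hS b₀ c)
          linarith [hκ' c]
        · refine (_root_.norm_sub_le _ _).trans ?_
          rw [norm_mul, norm_mul]
          have hε0 : 0 ≤ ε := (norm_nonneg _).trans (he b₀)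
          have h1 : ‖e b₀‖ * ‖m' b₀‖ ≤ ε * (1 / w.im) :=
            mul_le_mul (he b₀) (h'.norm_le b₀) (norm_nonneg _) hε0
          have h2 : ‖e' b₀‖ * ‖m b₀‖ ≤ ε * (1 / w.im) :=
            mul_le_mul (he' b₀) (h.norm_le b₀) (norm_nonneg _) hε0
          calc _ ≤ ε * (1 / w.im) + ε * (1 / w.im) := add_le_add h1 h2
            _ = _ := by ring
      _ ≤ _ := by linarith [mul_le_mul_of_nonneg_right (hSθ b₀) hκ0]
  have hε0 : 0 ≤ ε := (norm_nonneg _).trans (he b₀)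
  have h1 : κ * (k * (l ^ 2 * w.im / 2)) ≤ 2 * ε / w.im := by
    have : κ * (k * (l ^ 2 * w.im / 2)) ≤ κ * (k * θ b₀) := by gcongr; exact hθlow b₀
    linarith
  have h2 : κ ≤ 8 * ε / (l ^ 3 * w.im ^ 3) := by
    rw [le_div_iff₀ (by positivity)]
    rw [le_div_iff₀ hw] at h1
    have h1' : κ * (k * (l ^ 2 * w.im / 2)) * w.im = κ * (l ^ 3 * w.im ^ 3) / 4 := by
      rw [hk]; ring
    linarith
  calc ‖m b - m' b‖ ≤ κ * θ b := hκ' b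
    _ ≤ 8 * ε / (l ^ 3 * w.im ^ 3) * (1 / w.im) := by gcongr; exact hθup b
    _ = qveStability S w * ε := by
      unfold qveStability
      rw [← hldef]
      field_simp

/-- An exact solution of the quadratic vector equation. -/
def IsQVESolution (S : B → B → ℝ) (w : ℂ) (m : B → ℂ) : Prop :=
  IsQVEApprox S w m 0

theorem IsQVESolution.unique (h : IsQVESolution S w m) (h' : IsQVESolution S w m')
    (hS : ∀ b c, 0 ≤ S b c) (hw : 0 < w.im) : m = m' := by
  funext b
  have hl := qveLower_pos hS hw
  have h1 := IsQVEApprox.norm_sub_le h h' hS hw (ε := 0) (by simp) (by simp) (by norm_num)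
    (by positivity) b
  rw [mul_zero] at h1
  exact sub_eq_zero.1 (norm_le_zero_iff.1 h1)

theorem IsQVESolution.eq (h : IsQVESolution S w m) (b : B) :
    w * m b = 1 + m b * ∑ c, S b c * m c := by
  simpa using IsQVEApprox.eq h b

theorem IsQVESolution.sum_im_le (h : IsQVESolution S w m) (hw : 0 < w.im) (b : B) :
    ‖m b‖ ^ 2 * ∑ c, S b c * -(m c).im ≤ -(m b).im := by
  have h1 := IsQVEApprox.im_eq h b
  simp only [Pi.zero_apply, zero_mul, Complex.zero_im, add_zero] at h1
  have : 0 ≤ w.im * ‖m b‖ ^ 2 := by positivity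
  linarith

/-- The entries of `|m| S |m|` are at most `1`. -/
theorem IsQVESolution.norm_mul_norm_le (h : IsQVESolution S w m) (hS : ∀ b c, 0 ≤ S b c)
    (hsymm : ∀ b c, S b c = S c b) (hw : 0 < w.im) (b c : B) : ‖m b‖ * S b c * ‖m c‖ ≤ 1 := by
  have key : ∀ b c, ‖m b‖ ^ 2 * (S b c * -(m c).im) ≤ -(m b).im := fun b c =>
    le_trans (mul_le_mul_of_nonneg_left (Finset.single_le_sum
      (f := fun c => S b c * -(m c).im) (fun c _ => mul_nonneg (hS b c)
        (by linarith [h.im_neg c])) (Finset.mem_univ c)) (by positivity)) (h.sum_im_le hw b)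
  have hb : 0 < -(m b).im := by linarith [h.im_neg b]
  have hc : 0 < -(m c).im := by linarith [h.im_neg c]
  -- Multiplying the bounds for `(b, c)` and `(c, b)` makes both imaginary parts cancel and leaves
  -- the square of the claim.
  have h1 := mul_le_mul (key b c) (key c b)
    (mul_nonneg (by positivity) (mul_nonneg (hS c b) hb.le)) hb.le
  rw [hsymm c b] at h1
  have h2 : (‖m b‖ * S b c * ‖m c‖) ^ 2 * (-(m b).im * -(m c).im) ≤
      1 * (-(m b).im * -(m c).im) := by
    rw [one_mul]
    refine le_trans (le_of_eq ?_) h1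
    ring
  have h3 := le_of_mul_le_mul_right h2 (mul_pos hb hc)
  exact (sq_le_one_iff₀ (mul_nonneg (mul_nonneg (norm_nonneg _) (hS b c)) (norm_nonneg _))).1 h3

/-- Unlike `‖m‖ ≤ 1 / Im w`, this bound does not deteriorate near the real axis; it is what produces
densities away from zero. -/
theorem IsQVESolution.norm_mul_le (h : IsQVESolution S w m) (hS : ∀ b c, 0 ≤ S b c)
    (hsymm : ∀ b c, S b c = S c b) (hw : 0 < w.im) (b : B) :
    ‖w‖ * ‖m b‖ ≤ 1 + Fintype.card B := by
  rw [← norm_mul, h.eq b, Finset.mul_sum]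
  refine (norm_add_le _ _).trans ?_
  rw [norm_one]
  gcongr
  refine (norm_sum_le_of_le _ fun c _ => ?_).trans (b := ∑ _c : B, (1 : ℝ)) (by simp)
  rw [norm_mul, norm_mul, Complex.norm_real, Real.norm_of_nonneg (hS b c), ← mul_assoc]
  exact h.norm_mul_norm_le hS hsymm hw b c

/-- Approximate solutions of the quadratic vector equation with errors tending to `0` converge to
an exact solution. -/
theorem exists_tendsto_isQVESolution {m e : ℕ → B → ℂ} (h : ∀ n, IsQVEApprox S w (m n) (e n))
    (hS : ∀ b c, 0 ≤ S b c) (hw : 0 < w.im) (he : ∀ b, Tendsto (fun n => e n b) atTop (𝓝 0)) :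
    ∃ m₀, IsQVESolution S w m₀ ∧ ∀ b, Tendsto (fun n => m n b) atTop (𝓝 (m₀ b)) := by
  have hl := qveLower_pos hS hw
  have he' : Tendsto (fun n => ∑ b, ‖e n b‖) atTop (𝓝 0) := by
    have := tendsto_finsetSum Finset.univ fun b (_ : b ∈ Finset.univ) => (he b).norm
    simpa using this
  have hle : ∀ n b, ‖e n b‖ ≤ ∑ b, ‖e n b‖ := fun n b =>
    Finset.single_le_sum (f := fun b => ‖e n b‖) (fun _ _ => norm_nonneg _) (Finset.mem_univ b)
  have hC : 0 < qveStability S w := by unfold qveStability; positivity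
  -- Any two terms approximately solve the same equation, so stability compares them with each other
  -- before any limit is known.
  have hcauchy : ∀ b, CauchySeq fun n => m n b := fun b => by
    refine Metric.cauchySeq_iff.2 fun δ hδ => ?_
    set ε := min (min (1 / 2) (qveLower S w * w.im / 2)) (δ / (2 * qveStability S w)) with hε
    have hε0 : 0 < ε := by positivity
    obtain ⟨n₀, hn₀⟩ := eventually_atTop.1 (he'.eventually (gt_mem_nhds hε0))
    refine ⟨n₀, fun n hn n' hn' => ?_⟩
    have h1 := (h n).norm_sub_le (h n') hS hw (ε := ε)
      (fun b => (hle n b).trans (hn₀ n hn).le) (fun b => (hle n' b).trans (hn₀ n' hn').le)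
      ((min_le_left _ _).trans (min_le_left _ _)) ((min_le_left _ _).trans (min_le_right _ _)) b
    rw [dist_eq_norm]
    refine h1.trans_lt ?_
    calc qveStability S w * ε ≤ qveStability S w * (δ / (2 * qveStability S w)) := by
          gcongr; exact min_le_right _ _
      _ = δ / 2 := by field_simp
      _ < δ := by linarith
  choose m₀ hm₀ using fun b => cauchySeq_tendsto_of_complete (hcauchy b)
  have heq : ∀ b, w * m₀ b = 1 + m₀ b * ∑ c, S b c * m₀ c := fun b => by
    have h1 : Tendsto (fun n => 1 + m n b * ∑ c, S b c * m n c + e n b) atTop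
        (𝓝 (1 + m₀ b * ∑ c, S b c * m₀ c + 0)) :=
      ((tendsto_const_nhds.add ((hm₀ b).mul (tendsto_finsetSum _ fun c _ =>
        (hm₀ c).const_mul _))).add (he b))
    rw [add_zero] at h1
    refine tendsto_nhds_unique ?_ h1
    exact ((hm₀ b).const_mul w).congr fun n => (h n).eq b
  have him : ∀ b, (m₀ b).im ≤ 0 := fun b =>
    le_of_tendsto' ((Complex.continuous_im.tendsto _).comp (hm₀ b)) fun n => ((h n).im_neg b).le
  refine ⟨m₀, ⟨fun b => ?_, fun b => ?_, fun b => by simpa using heq b⟩, hm₀⟩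
  -- If `m₀ b` were real, then `w = (m₀ b)⁻¹ + (S m₀) b` would have nonpositive imaginary part.
  · refine lt_of_le_of_ne (him b) fun h0 => ?_
    have h1 : m₀ b ≠ 0 := fun h2 => by simpa [h2] using heq b
    have h2 : w = (m₀ b)⁻¹ + ∑ c, S b c * m₀ c := by
      field_simp
      linear_combination heq b
    have h3 := congrArg Complex.im h2
    rw [Complex.add_im, Complex.inv_im, h0, Complex.im_sum] at h3
    simp only [Complex.im_ofReal_mul, neg_zero, zero_div, zero_add] at h3
    have : ∑ c, S b c * (m₀ c).im ≤ 0 :=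
      Finset.sum_nonpos fun c _ => mul_nonpos_of_nonneg_of_nonpos (hS b c) (him c)
    linarith
  · exact le_of_tendsto' (hm₀ b).norm fun n => (h n).norm_le b

/-- The reflection `w ↦ -conj w` acts on solutions of the quadratic vector equation. -/
theorem IsQVESolution.neg_conj (h : IsQVESolution S w m) :
    IsQVESolution S (-(starRingEnd ℂ) w) fun b => -(starRingEnd ℂ) (m b) := by
  refine ⟨fun b => by simpa using h.im_neg b, fun b => by simpa using h.norm_le b, fun b => ?_⟩
  have h1 := congrArg (starRingEnd ℂ) (h.eq b)
  simp only [map_mul, map_add, map_one, map_sum, Complex.conj_ofReal] at h1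
  simp only [mul_neg, Finset.sum_neg_distrib, neg_mul, neg_neg, Pi.zero_apply, add_zero]
  exact h1

theorem IsQVESolution.comp_equiv (h : IsQVESolution S w m) (τ : B ≃ B)
    (hτ : ∀ b c, S (τ b) (τ c) = S b c) : IsQVESolution S w (m ∘ τ) := by
  refine ⟨fun b => h.im_neg _, fun b => h.norm_le _, fun b => ?_⟩
  simp only [Function.comp_apply, Pi.zero_apply, add_zero]
  rw [h.eq (τ b), ← Equiv.sum_comp τ]
  simp only [hτ]

end QuadraticVectorEquation

end

noncomputable section

/-! ### Gaussian integration by parts on the line. -/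

section Stein

variable {v : ℝ≥0}

theorem hasDerivAt_gaussianPDFReal_zero (hv : v ≠ 0) (x : ℝ) :
    HasDerivAt (gaussianPDFReal 0 v) (-(x / v) * gaussianPDFReal 0 v x) x := by
  have hv' : (v : ℝ) ≠ 0 := by exact_mod_cast hv
  have h1 : HasDerivAt (fun x : ℝ => -(x - 0) ^ 2 / (2 * (v : ℝ))) (-(x / v)) x := by
    have := (((hasDerivAt_id x).sub_const 0).pow 2).neg.div_const (2 * (v : ℝ))
    convert! this using 1
    simp
    field_simp
  rw [gaussianPDFReal_def]
  convert! (h1.exp.const_mul ((√(2 * Real.pi * v))⁻¹)) using 1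
  ring

theorem integrable_gaussianReal_iff {E : Type*} [NormedAddCommGroup E] [NormedSpace ℝ E]
    (hv : v ≠ 0) {f : ℝ → E} :
    Integrable f (gaussianReal 0 v) ↔ Integrable fun x => gaussianPDFReal 0 v x • f x := by
  rw [gaussianReal_of_var_ne_zero _ hv, integrable_withDensity_iff_integrable_smul'
    (measurable_gaussianPDF 0 v) (ae_of_all _ fun x => gaussianPDF_lt_top)]
  simp only [toReal_gaussianPDF]

/-- Gaussian integration by parts. -/
theorem integral_gaussianReal_smul_eq {E : Type*} [NormedAddCommGroup E] [NormedSpace ℝ E]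
    (hv : v ≠ 0) {f f' : ℝ → E} (hf : ∀ x, HasDerivAt f (f' x) x)
    (h1 : Integrable f (gaussianReal 0 v)) (h2 : Integrable f' (gaussianReal 0 v))
    (h3 : Integrable (fun x => x • f x) (gaussianReal 0 v)) :
    ∫ x, x • f x ∂(gaussianReal 0 v) = (v : ℝ) • ∫ x, f' x ∂(gaussianReal 0 v) := by
  have hv' : (v : ℝ) ≠ 0 := by exact_mod_cast hv
  rw [integrable_gaussianReal_iff hv] at h1 h2 h3
  rw [integral_gaussianReal_eq_integral_smul hv, integral_gaussianReal_eq_integral_smul hv]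
  have h4 := integral_bilinear_hasDerivAt_right_eq_neg_left_of_integrable
    (L := ContinuousLinearMap.lsmul ℝ ℝ) (u := gaussianPDFReal 0 v)
    (u' := fun x => -(x / v) * gaussianPDFReal 0 v x) (v := f) (v' := f')
    (fun x _ => hasDerivAt_gaussianPDFReal_zero hv x) (fun x _ => hf x)
    (by simpa using h2) ?_ (by simpa using h1)
  · simp only [ContinuousLinearMap.lsmul_apply] at h4
    rw [h4, ← integral_neg, ← integral_smul]
    refine integral_congr_ae (ae_of_all _ fun x => ?_)
    simp only [smul_smul, ← neg_smul]
    congr 1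
    field_simp
  · simp only [ContinuousLinearMap.lsmul_apply]
    refine (h3.smul (-(v : ℝ)⁻¹)).congr (ae_of_all _ fun x => ?_)
    simp only [Pi.smul_apply, smul_smul]
    congr 1
    field_simp

theorem integrable_id_gaussianReal : Integrable (fun x : ℝ => x) (gaussianReal 0 v) :=
  memLp_one_iff_integrable.1 (memLp_id_gaussianReal 1)

end Stein

/-! ### Variance of complex functions and the Efron–Stein inequality. -/

section Dispersion

variable {X Y : Type*} [MeasurableSpace X] [MeasurableSpace Y]

/-- The variance of a complex valued function. -/
def dispersion (μ : Measure X) (f : X → ℂ) : ℝ := ∫ x, ‖f x - ∫ y, f y ∂μ‖ ^ 2 ∂μ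

variable {μ : Measure X} {ν : Measure Y} [IsProbabilityMeasure μ] [IsProbabilityMeasure ν]
  {f : X → ℂ} {C : ℝ}

theorem integrable_of_bounded {E : Type*} [NormedAddCommGroup E] [MeasurableSpace E] [BorelSpace E]
    [SecondCountableTopology E] {f : X → E} (hf : Measurable f) (hC : ∀ x, ‖f x‖ ≤ C) :
    Integrable f μ :=
  Integrable.of_bound hf.aestronglyMeasurable C (ae_of_all _ hC)

theorem integrable_norm_sq_of_bounded (hf : Measurable f) (hC : ∀ x, ‖f x‖ ≤ C) :
    Integrable (fun x => ‖f x‖ ^ 2) μ := by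
  refine integrable_of_bounded (C := C ^ 2) (by fun_prop) fun x => ?_
  rw [Real.norm_of_nonneg (by positivity)]
  gcongr
  exact hC x

theorem norm_integral_le_of_bounded (hC : ∀ x, ‖f x‖ ≤ C) : ‖∫ x, f x ∂μ‖ ≤ C := by
  simpa using norm_integral_le_of_norm_le_const (μ := μ) (ae_of_all _ hC)

theorem integral_norm_sub_sq (hf : Measurable f) (hC : ∀ x, ‖f x‖ ≤ C) (c : ℂ) :
    ∫ x, ‖f x - c‖ ^ 2 ∂μ = dispersion μ f + ‖∫ x, f x ∂μ - c‖ ^ 2 := by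
  have hint := integrable_of_bounded (μ := μ) hf hC
  have hexp : ∀ c : ℂ, ∫ x, ‖f x - c‖ ^ 2 ∂μ =
      ∫ x, ‖f x‖ ^ 2 ∂μ - 2 * ((∫ x, f x ∂μ) * (starRingEnd ℂ) c).re + ‖c‖ ^ 2 := fun c => by
    have h1 : ∀ x, ‖f x - c‖ ^ 2 = ‖f x‖ ^ 2 - 2 * (f x * (starRingEnd ℂ) c).re + ‖c‖ ^ 2 :=
      fun x => by
        rw [Complex.sq_norm, Complex.sq_norm, Complex.sq_norm, Complex.normSq_sub]
        ring
    simp_rw [h1]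
    have h2 : Integrable (fun x => 2 * (f x * (starRingEnd ℂ) c).re) μ :=
      ((hint.mul_const _).re).const_mul 2
    have h4 : Integrable (fun x => ‖f x‖ ^ 2 - 2 * (f x * (starRingEnd ℂ) c).re) μ :=
      (integrable_norm_sq_of_bounded hf hC).sub h2
    rw [integral_add h4 (integrable_const _),
      integral_sub (integrable_norm_sq_of_bounded hf hC) h2, integral_const_mul, integral_const]
    have h3 := integral_re (hint.mul_const ((starRingEnd ℂ) c))
    simp only [RCLike.re_to_complex] at h3
    rw [h3, integral_mul_const]
    simp
  unfold dispersion
  rw [hexp, hexp]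
  rw [Complex.sq_norm (∫ x, f x ∂μ - c), Complex.normSq_sub, Complex.mul_conj,
    Complex.sq_norm, Complex.sq_norm]
  simp
  ring

theorem dispersion_le (hf : Measurable f) (hC : ∀ x, ‖f x‖ ≤ C) (c : ℂ) :
    dispersion μ f ≤ ∫ x, ‖f x - c‖ ^ 2 ∂μ := by
  rw [integral_norm_sub_sq hf hC]
  have : 0 ≤ ‖∫ x, f x ∂μ - c‖ ^ 2 := by positivity
  linarith

theorem dispersion_eq (hf : Measurable f) (hC : ∀ x, ‖f x‖ ≤ C) :
    dispersion μ f = ∫ x, ‖f x‖ ^ 2 ∂μ - ‖∫ x, f x ∂μ‖ ^ 2 := by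
  have := integral_norm_sub_sq (μ := μ) hf hC 0
  simp only [sub_zero] at this
  linarith

theorem norm_integral_sq_le (hf : Measurable f) (hC : ∀ x, ‖f x‖ ≤ C) :
    ‖∫ x, f x ∂μ‖ ^ 2 ≤ ∫ x, ‖f x‖ ^ 2 ∂μ := by
  have h1 := dispersion_eq (μ := μ) hf hC
  have h2 : 0 ≤ dispersion μ f := integral_nonneg fun x => by positivity
  linarith

variable {F : X × Y → ℂ}

theorem measurable_integral_left (hF : Measurable F) : Measurable fun y => ∫ x, F (x, y) ∂μ :=
  (hF.stronglyMeasurable.integral_prod_left').measurable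

theorem measurable_integral_right (hF : Measurable F) : Measurable fun x => ∫ y, F (x, y) ∂ν :=
  (hF.stronglyMeasurable.integral_prod_right').measurable

theorem integral_dispersion_left (hF : Measurable F) (hC : ∀ p, ‖F p‖ ≤ C) :
    ∫ y, dispersion μ (fun x => F (x, y)) ∂ν =
      ∫ p, ‖F p‖ ^ 2 ∂(μ.prod ν) - ∫ y, ‖∫ x, F (x, y) ∂μ‖ ^ 2 ∂ν := by
  have h1 : ∀ y, dispersion μ (fun x => F (x, y)) =
      ∫ x, ‖F (x, y)‖ ^ 2 ∂μ - ‖∫ x, F (x, y) ∂μ‖ ^ 2 := fun y =>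
    dispersion_eq (hF.comp measurable_prodMk_right) fun x => hC _
  simp_rw [h1]
  have h2 := integrable_norm_sq_of_bounded (μ := μ.prod ν) hF hC
  rw [integral_sub h2.integral_prod_right (integrable_norm_sq_of_bounded
    (measurable_integral_left hF) fun y => norm_integral_le_of_bounded fun x => hC _),
    integral_prod_symm _ h2]

/-- The Efron-Stein inequality for two independent variables. -/
theorem dispersion_prod_le (hF : Measurable F) (hC : ∀ p, ‖F p‖ ≤ C) :
    dispersion (μ.prod ν) F ≤ ∫ y, dispersion μ (fun x => F (x, y)) ∂ν +
      ∫ x, dispersion ν (fun y => F (x, y)) ∂μ := by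
  set h : Y → ℂ := fun y => ∫ x, F (x, y) ∂μ with hh
  have hhm : Measurable h := measurable_integral_left hF
  have hhC : ∀ y, ‖h y‖ ≤ C := fun y => norm_integral_le_of_bounded fun x => hC _
  have hFint := integrable_of_bounded (μ := μ.prod ν) hF hC
  have hhint : ∫ y, h y ∂ν = ∫ p, F p ∂(μ.prod ν) := (integral_prod_symm _ hFint).symm
  -- The law of total variance; only the variance of the conditional mean `h` remains to be bounded.
  have h1 : dispersion (μ.prod ν) F =
      ∫ y, dispersion μ (fun x => F (x, y)) ∂ν + dispersion ν h := by
    rw [integral_dispersion_left hF hC, dispersion_eq hF hC, dispersion_eq hhm hhC, hhint]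
    ring
  rw [h1]
  gcongr
  set k : X → ℂ := fun x => ∫ y, F (x, y) ∂ν with hk
  have hkm : Measurable k := measurable_integral_right hF
  have hkC : ∀ x, ‖k x‖ ≤ C := fun x => norm_integral_le_of_bounded fun y => hC _
  have hDm : Measurable fun p : X × Y => F p - k p.1 := hF.sub (hkm.comp measurable_fst)
  have hDC : ∀ p : X × Y, ‖F p - k p.1‖ ≤ C + C := fun p =>
    (norm_sub_le _ _).trans (add_le_add (hC _) (hkC _))
  have hD2 := integrable_norm_sq_of_bounded (μ := μ.prod ν) hDm hDC
  -- The centred `h y` is the average over `x` of `F - k`, so Jensen's inequality brings in the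
  -- variance in `y` alone.
  have h2 : ∀ y, h y - ∫ y, h y ∂ν = ∫ x, (F (x, y) - k x) ∂μ := fun y => by
    have h3 : Integrable (fun x => F (x, y)) μ :=
      integrable_of_bounded (hF.comp measurable_prodMk_right) fun x => hC _
    rw [integral_sub h3 (integrable_of_bounded hkm hkC), hhint, integral_prod _ hFint]
  calc dispersion ν h = ∫ y, ‖∫ x, (F (x, y) - k x) ∂μ‖ ^ 2 ∂ν := by
        unfold dispersion
        simp_rw [h2]
    _ ≤ ∫ y, ∫ x, ‖F (x, y) - k x‖ ^ 2 ∂μ ∂ν := by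
        refine integral_mono ?_ hD2.integral_prod_right fun y => ?_
        · exact integrable_norm_sq_of_bounded (C := C + C) (measurable_integral_left hDm) fun y =>
            norm_integral_le_of_bounded fun x => hDC (x, y)
        · exact norm_integral_sq_le (C := C + C) (hDm.comp measurable_prodMk_right) fun x =>
            hDC (x, y)
    _ = ∫ x, dispersion ν (fun y => F (x, y)) ∂μ := by
        rw [← integral_prod_symm _ hD2, integral_prod _ hD2]
        rfl

/-- Centre both factors and apply `2ab ≤ a² + b²`. The product carries no conjugate, as in the loop
equation, where this bound lets expectations of products factorise. -/
theorem integral_covariance_le {f g : X → ℂ} (hf : Measurable f) (hfC : ∀ x, ‖f x‖ ≤ C)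
    (hg : Measurable g) (hgC : ∀ x, ‖g x‖ ≤ C) :
    ‖∫ x, f x * g x ∂μ - (∫ x, f x ∂μ) * ∫ x, g x ∂μ‖ ≤
      (dispersion μ f + dispersion μ g) / 2 := by
  set a := ∫ x, f x ∂μ
  set b := ∫ x, g x ∂μ
  have hfi := integrable_of_bounded (μ := μ) hf hfC
  have hgi := integrable_of_bounded (μ := μ) hg hgC
  have hfgi : Integrable (fun x => f x * g x) μ :=
    integrable_of_bounded (C := C * C) (hf.mul hg) fun x => by
      rw [norm_mul]
      exact mul_le_mul (hfC x) (hgC x) (norm_nonneg _) ((norm_nonneg _).trans (hfC x))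
  have h1 : ∫ x, f x * g x ∂μ - a * b = ∫ x, (f x - a) * (g x - b) ∂μ := by
    have : ∀ x, (f x - a) * (g x - b) = f x * g x - f x * b - a * g x + a * b := fun x => by ring
    simp_rw [this]
    have h2 : Integrable (fun x => f x * g x - f x * b) μ := hfgi.sub (hfi.mul_const b)
    have h3 : Integrable (fun x => f x * g x - f x * b - a * g x) μ := h2.sub (hgi.const_mul a)
    rw [integral_add h3 (integrable_const _), integral_sub h2 (hgi.const_mul a),
      integral_sub hfgi (hfi.mul_const b), integral_mul_const, integral_const_mul]
    simp
    ring
  have hbd : ∀ {h : X → ℂ} (c : ℂ), (∀ x, ‖h x‖ ≤ C) → ∀ x, ‖h x - c‖ ≤ C + ‖c‖ :=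
    fun c hh x => (norm_sub_le _ _).trans (by gcongr; exact hh x)
  have hf2 := integrable_norm_sq_of_bounded (μ := μ) (hf.sub_const a) (hbd a hfC)
  have hg2 := integrable_norm_sq_of_bounded (μ := μ) (hg.sub_const b) (hbd b hgC)
  rw [h1]
  calc ‖∫ x, (f x - a) * (g x - b) ∂μ‖ ≤ ∫ x, (‖f x - a‖ ^ 2 + ‖g x - b‖ ^ 2) / 2 ∂μ := by
        refine norm_integral_le_of_norm_le ((hf2.add hg2).div_const 2) (ae_of_all _ fun x => ?_)
        rw [norm_mul]
        nlinarith [sq_nonneg (‖f x - a‖ - ‖g x - b‖)]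
    _ = _ := by
        rw [integral_div, integral_add hf2 hg2]
        rfl

end Dispersion
end

noncomputable section

/-! ### The Gaussian Poincaré inequality on the line. -/

section Poincare

variable {v : ℝ≥0} {C C' : ℝ}

/-- Cauchy–Schwarz, read off from the nonnegativity of `∫ (‖g‖ - J/x)²`, where `J/x` is the mean of
`‖g‖` on `[0, x]`. -/
theorem norm_integral_sq_le_mul_integral {g : ℝ → ℂ} (hg : Continuous g) {x : ℝ} (hx : 0 ≤ x) :
    ‖∫ t in (0 : ℝ)..x, g t‖ ^ 2 ≤ x * ∫ t in (0 : ℝ)..x, ‖g t‖ ^ 2 := by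
  rcases hx.eq_or_lt with rfl | hx
  · simp
  set J := ∫ t in (0 : ℝ)..x, ‖g t‖ with hJ
  have h1 : ‖∫ t in (0 : ℝ)..x, g t‖ ≤ J := intervalIntegral.norm_integral_le_integral_norm hx.le
  have h2 : 0 ≤ ∫ t in (0 : ℝ)..x, (‖g t‖ - J / x) ^ 2 :=
    intervalIntegral.integral_nonneg hx.le fun t _ => sq_nonneg _
  have h3 : ∫ t in (0 : ℝ)..x, (‖g t‖ - J / x) ^ 2 =
      (∫ t in (0 : ℝ)..x, ‖g t‖ ^ 2) - 2 * (J / x) * J + x * (J / x) ^ 2 := by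
    have : ∀ t, (‖g t‖ - J / x) ^ 2 = ‖g t‖ ^ 2 - 2 * (J / x) * ‖g t‖ + (J / x) ^ 2 :=
      fun t => by ring
    simp_rw [this]
    have i1 : IntervalIntegrable (fun t => ‖g t‖ ^ 2) volume 0 x :=
      (by fun_prop : Continuous fun t => ‖g t‖ ^ 2).intervalIntegrable _ _
    have i2 : IntervalIntegrable (fun t => 2 * (J / x) * ‖g t‖) volume 0 x :=
      (by fun_prop : Continuous fun t => 2 * (J / x) * ‖g t‖).intervalIntegrable _ _
    rw [intervalIntegral.integral_add (i1.sub i2) (by simp),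
      intervalIntegral.integral_sub i1 i2, intervalIntegral.integral_const_mul, ← hJ]
    simp
  have h4 : J ^ 2 ≤ x * ∫ t in (0 : ℝ)..x, ‖g t‖ ^ 2 := by
    rw [h3] at h2
    have : x * ((∫ t in (0 : ℝ)..x, ‖g t‖ ^ 2) - 2 * (J / x) * J + x * (J / x) ^ 2) =
        x * (∫ t in (0 : ℝ)..x, ‖g t‖ ^ 2) - J ^ 2 := by
      field_simp
      ring
    have h5 := mul_nonneg hx.le h2
    linarith
  exact (pow_le_pow_left₀ (norm_nonneg _) h1 2).trans h4

/-- For negative `x` both factors on the right are nonpositive. The right side has the form `x ψ(x)`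
with `ψ' = ‖f'‖²`, ready for integration by parts. -/
theorem norm_sub_zero_sq_le {f f' : ℝ → ℂ} (hf : ∀ x, HasDerivAt f (f' x) x)
    (hf' : Continuous f') (x : ℝ) :
    ‖f x - f 0‖ ^ 2 ≤ x * ∫ t in (0 : ℝ)..x, ‖f' t‖ ^ 2 := by
  rcases le_total 0 x with hx | hx
  · rw [← intervalIntegral.integral_eq_sub_of_hasDerivAt (fun t _ => hf t)
      (hf'.intervalIntegrable _ _)]
    exact norm_integral_sq_le_mul_integral hf' hx
  · have h1 := norm_integral_sq_le_mul_integral (g := fun t => f' (-t)) (by fun_prop)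
      (neg_nonneg.2 hx)
    rw [intervalIntegral.integral_comp_neg (fun t => f' t),
      intervalIntegral.integral_comp_neg (fun t => ‖f' t‖ ^ 2), neg_neg, neg_zero,
      intervalIntegral.integral_eq_sub_of_hasDerivAt (fun t _ => hf t)
      (hf'.intervalIntegrable _ _), norm_sub_rev] at h1
    rw [intervalIntegral.integral_symm]
    linarith

/-- The Gaussian Poincaré inequality on the line. -/
theorem dispersion_gaussianReal_le (hv : v ≠ 0) {f f' : ℝ → ℂ}
    (hf : ∀ x, HasDerivAt f (f' x) x) (hf' : Continuous f') (hC : ∀ x, ‖f x‖ ≤ C)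
    (hC' : ∀ x, ‖f' x‖ ≤ C') :
    dispersion (gaussianReal 0 v) f ≤ v * ∫ x, ‖f' x‖ ^ 2 ∂(gaussianReal 0 v) := by
  have hfc : Continuous f := continuous_iff_continuousAt.2 fun x => (hf x).continuousAt
  set ψ : ℝ → ℝ := fun x => ∫ t in (0 : ℝ)..x, ‖f' t‖ ^ 2 with hψ
  have hg : Continuous fun t => ‖f' t‖ ^ 2 := by fun_prop
  have hψd : ∀ x, HasDerivAt ψ (‖f' x‖ ^ 2) x := fun x =>
    intervalIntegral.integral_hasDerivAt_right (hg.intervalIntegrable _ _)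
      hg.stronglyMeasurable.stronglyMeasurableAtFilter hg.continuousAt
  have hψc : Continuous ψ := continuous_iff_continuousAt.2 fun x => (hψd x).continuousAt
  have hψle : ∀ x, ‖ψ x‖ ≤ C' ^ 2 * ‖x‖ := fun x => by
    have := intervalIntegral.norm_integral_le_of_norm_le_const (a := 0) (b := x)
      (f := fun t => ‖f' t‖ ^ 2) (C := C' ^ 2) fun t _ => by
        rw [Real.norm_of_nonneg (by positivity)]
        gcongr
        exact hC' t
    simpa using this
  have hsq : Integrable (fun x : ℝ => x ^ 2) (gaussianReal 0 v) :=
    (memLp_id_gaussianReal 2).integrable_sq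
  have i1 : Integrable ψ (gaussianReal 0 v) :=
    ((integrable_id_gaussianReal.norm).const_mul (C' ^ 2)).mono' hψc.aestronglyMeasurable
      (ae_of_all _ hψle)
  have i2 : Integrable (fun x => x • ψ x) (gaussianReal 0 v) := by
    refine (hsq.const_mul (C' ^ 2)).mono' (by fun_prop) (ae_of_all _ fun x => ?_)
    rw [norm_smul, ← sq_abs x, ← Real.norm_eq_abs x]
    nlinarith [hψle x, norm_nonneg x]
  have i3 : Integrable (fun x => ‖f' x‖ ^ 2) (gaussianReal 0 v) :=
    integrable_norm_sq_of_bounded hf'.measurable hC'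
  -- Integration by parts, read backwards: `v E ψ'(x) = E x ψ(x)`. The variance is at most `E ‖f - f
  -- 0‖²`, and this is dominated pointwise by `x ψ(x)`.
  rw [← smul_eq_mul, ← integral_gaussianReal_smul_eq hv hψd i1 i3 i2]
  refine (dispersion_le hfc.measurable hC (f 0)).trans (integral_mono ?_ i2 fun x => ?_)
  · refine integrable_norm_sq_of_bounded (C := C + C) (hfc.measurable.sub_const _) fun x => ?_
    exact (norm_sub_le _ _).trans (add_le_add (hC _) (hC _))
  · exact norm_sub_zero_sq_le hf hf' x

end Poincare

/-! ### The standard complex normal law: rotations, integration by parts, Poincaré. -/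

section ComplexGaussian

theorem measurable_complex_mk : Measurable fun p : ℝ × ℝ => (⟨p.1, p.2⟩ : ℂ) :=
  Complex.measurableEquivRealProd.symm.measurable

instance : IsProbabilityMeasure stdComplexGaussian :=
  Measure.isProbabilityMeasure_map measurable_complex_mk.aemeasurable

theorem integral_stdComplexGaussian {E : Type*} [NormedAddCommGroup E] [NormedSpace ℝ E]
    (f : ℂ → E) :
    ∫ a, f a ∂stdComplexGaussian =
      ∫ p : ℝ × ℝ, f ⟨p.1, p.2⟩ ∂((gaussianReal 0 2⁻¹).prod (gaussianReal 0 2⁻¹)) :=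
  integral_map_equiv Complex.measurableEquivRealProd.symm f

theorem integrable_id_stdComplexGaussian : Integrable (fun a : ℂ => a) stdComplexGaussian := by
  rw [stdComplexGaussian, integrable_map_measure (by fun_prop) measurable_complex_mk.aemeasurable]
  have h1 : Integrable (fun p : ℝ × ℝ => (p.1 : ℂ))
      ((gaussianReal 0 2⁻¹).prod (gaussianReal 0 2⁻¹)) :=
    (integrable_id_gaussianReal.comp_fst _).ofReal
  have h2 : Integrable (fun p : ℝ × ℝ => (p.2 : ℂ))
      ((gaussianReal 0 2⁻¹).prod (gaussianReal 0 2⁻¹)) :=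
    (integrable_id_gaussianReal.comp_snd _).ofReal
  refine (h1.add (h2.mul_const Complex.I)).congr (ae_of_all _ fun p => ?_)
  simp [Complex.mk_eq_add_mul_I]

theorem map_circle_mul_stdComplexGaussian (u : Circle) :
    stdComplexGaussian.map (fun a => (u : ℂ) * a) = stdComplexGaussian := by
  obtain ⟨θ, rfl⟩ : ∃ θ : ℝ, Circle.exp θ = u := ⟨_, Circle.exp_arg u⟩
  -- Multiplication by `exp(iθ)` corresponds to the rotation of pairs by `-θ` in the convention of
  -- `ContinuousLinearMap.rotation`.
  have h1 := IsGaussian.map_rotation_eq_self (μ := gaussianReal 0 2⁻¹) (by simp) (-θ)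
  unfold stdComplexGaussian
  conv_rhs => rw [← h1]
  rw [Measure.map_map (by fun_prop) measurable_complex_mk,
    Measure.map_map measurable_complex_mk (by fun_prop)]
  congr 1
  funext p
  simp only [Function.comp_apply, ContinuousLinearMap.rotation_apply, Circle.coe_exp,
    Complex.exp_mul_I]
  apply Complex.ext <;> simp [Complex.cos_ofReal_re, Complex.sin_ofReal_re] <;> ring

variable {f fx fy : ℂ → ℂ} {C : ℝ}

/-- `fx` and `fy` are the partial derivatives of `f : ℂ → ℂ` along the real and the imaginary
direction; all of these functions are continuous and bounded. -/
structure HasBoundedPartials (f fx fy : ℂ → ℂ) (C : ℝ) : Prop where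
  deriv_re : ∀ a, HasDerivAt (fun t : ℝ => f (a + t)) (fx a) 0
  deriv_im : ∀ a, HasDerivAt (fun t : ℝ => f (a + t * Complex.I)) (fy a) 0
  cont : Continuous f
  cont_re : Continuous fx
  cont_im : Continuous fy
  le : ∀ a, ‖f a‖ ≤ C
  le_re : ∀ a, ‖fx a‖ ≤ C
  le_im : ∀ a, ‖fy a‖ ≤ C

theorem continuous_complex_mk : Continuous fun p : ℝ × ℝ => (⟨p.1, p.2⟩ : ℂ) :=
  Complex.equivRealProdCLM.symm.continuous

theorem HasBoundedPartials.hasDerivAt_re (h : HasBoundedPartials f fx fy C) (x y : ℝ) :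
    HasDerivAt (fun x : ℝ => f ⟨x, y⟩) (fx ⟨x, y⟩) x := by
  have h1 := h.deriv_re ⟨x, y⟩
  have h2 : HasDerivAt (fun t : ℝ => t - x) 1 x := (hasDerivAt_id x).sub_const x
  have h3 := HasDerivAt.scomp x (h := fun t : ℝ => t - x) (by rw [sub_self]; exact h1) h2
  rw [one_smul] at h3
  refine h3.congr_of_eventuallyEq (Eventually.of_forall fun t => ?_)
  simp only [Function.comp_apply]
  congr 1
  apply Complex.ext <;> simp

theorem HasBoundedPartials.hasDerivAt_im (h : HasBoundedPartials f fx fy C) (x y : ℝ) :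
    HasDerivAt (fun y : ℝ => f ⟨x, y⟩) (fy ⟨x, y⟩) y := by
  have h1 := h.deriv_im ⟨x, y⟩
  have h2 : HasDerivAt (fun t : ℝ => t - y) 1 y := (hasDerivAt_id y).sub_const y
  have h3 := HasDerivAt.scomp y (h := fun t : ℝ => t - y) (by rw [sub_self]; exact h1) h2
  rw [one_smul] at h3
  refine h3.congr_of_eventuallyEq (Eventually.of_forall fun t => ?_)
  simp only [Function.comp_apply]
  congr 1
  apply Complex.ext <;> simp

theorem HasBoundedPartials.integral_re_mul (h : HasBoundedPartials f fx fy C) :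
    ∫ a, (a.re : ℂ) * f a ∂stdComplexGaussian = 2⁻¹ * ∫ a, fx a ∂stdComplexGaussian := by
  have hm := continuous_complex_mk
  have hmx : ∀ y : ℝ, Continuous fun x : ℝ => (⟨x, y⟩ : ℂ) := fun y =>
    hm.comp (by fun_prop : Continuous fun x : ℝ => (x, y))
  have i1 : Integrable (fun p : ℝ × ℝ => (p.1 : ℂ) * f ⟨p.1, p.2⟩)
      ((gaussianReal 0 2⁻¹).prod (gaussianReal 0 2⁻¹)) :=
    ((integrable_id_gaussianReal.comp_fst _).ofReal).mul_bdd
      (h.cont.comp hm).aestronglyMeasurable (ae_of_all _ fun p => h.le _)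
  have i2 : Integrable (fun p : ℝ × ℝ => fx ⟨p.1, p.2⟩)
      ((gaussianReal 0 2⁻¹).prod (gaussianReal 0 2⁻¹)) :=
    integrable_of_bounded (h.cont_re.comp hm).measurable fun p => h.le_re _
  rw [integral_stdComplexGaussian, integral_stdComplexGaussian, integral_prod_symm _ i1,
    integral_prod_symm _ i2, ← integral_const_mul]
  congr 1
  funext y
  have := integral_gaussianReal_smul_eq (v := 2⁻¹) (by simp) (h.hasDerivAt_re · y)
    (integrable_of_bounded (h.cont.comp (hmx y)).measurable fun x => h.le _)
    (integrable_of_bounded (h.cont_re.comp (hmx y)).measurable fun x => h.le_re _)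
    (integrable_id_gaussianReal.smul_bdd C (h.cont.comp (hmx y)).aestronglyMeasurable
      (ae_of_all _ fun x => h.le _))
  simpa using this

theorem HasBoundedPartials.integral_im_mul (h : HasBoundedPartials f fx fy C) :
    ∫ a, (a.im : ℂ) * f a ∂stdComplexGaussian = 2⁻¹ * ∫ a, fy a ∂stdComplexGaussian := by
  have hm := continuous_complex_mk
  have hmy : ∀ x : ℝ, Continuous fun y : ℝ => (⟨x, y⟩ : ℂ) := fun x =>
    hm.comp (by fun_prop : Continuous fun y : ℝ => (x, y))
  have i1 : Integrable (fun p : ℝ × ℝ => (p.2 : ℂ) * f ⟨p.1, p.2⟩)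
      ((gaussianReal 0 2⁻¹).prod (gaussianReal 0 2⁻¹)) :=
    ((integrable_id_gaussianReal.comp_snd _).ofReal).mul_bdd
      (h.cont.comp hm).aestronglyMeasurable (ae_of_all _ fun p => h.le _)
  have i2 : Integrable (fun p : ℝ × ℝ => fy ⟨p.1, p.2⟩)
      ((gaussianReal 0 2⁻¹).prod (gaussianReal 0 2⁻¹)) :=
    integrable_of_bounded (h.cont_im.comp hm).measurable fun p => h.le_im _
  rw [integral_stdComplexGaussian, integral_stdComplexGaussian, integral_prod _ i1,
    integral_prod _ i2, ← integral_const_mul]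
  congr 1
  funext x
  have := integral_gaussianReal_smul_eq (v := 2⁻¹) (by simp) (h.hasDerivAt_im x ·)
    (integrable_of_bounded (h.cont.comp (hmy x)).measurable fun x => h.le _)
    (integrable_of_bounded (h.cont_im.comp (hmy x)).measurable fun x => h.le_im _)
    (integrable_id_gaussianReal.smul_bdd C (h.cont.comp (hmy x)).aestronglyMeasurable
      (ae_of_all _ fun x => h.le _))
  simpa using this

theorem integrable_re_mul_of_bounded (hf : Measurable f) (hC : ∀ a, ‖f a‖ ≤ C) :
    Integrable (fun a => (a.re : ℂ) * f a) stdComplexGaussian :=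
  integrable_id_stdComplexGaussian.re.ofReal.mul_bdd hf.aestronglyMeasurable (ae_of_all _ hC)

theorem integrable_im_mul_of_bounded (hf : Measurable f) (hC : ∀ a, ‖f a‖ ≤ C) :
    Integrable (fun a => (a.im : ℂ) * f a) stdComplexGaussian :=
  integrable_id_stdComplexGaussian.im.ofReal.mul_bdd hf.aestronglyMeasurable (ae_of_all _ hC)

/-- Complex Gaussian integration by parts. -/
theorem HasBoundedPartials.integral_mul (h : HasBoundedPartials f fx fy C) :
    ∫ a, a * f a ∂stdComplexGaussian =
      2⁻¹ * ∫ a, (fx a + Complex.I * fy a) ∂stdComplexGaussian := by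
  have h1 : ∀ a : ℂ, a * f a = (a.re : ℂ) * f a + Complex.I * ((a.im : ℂ) * f a) := fun a => by
    nth_rewrite 1 [← Complex.re_add_im a]
    ring
  simp_rw [h1]
  rw [integral_add (integrable_re_mul_of_bounded h.cont.measurable h.le)
    ((integrable_im_mul_of_bounded h.cont.measurable h.le).const_mul _), integral_const_mul,
    h.integral_re_mul, h.integral_im_mul,
    integral_add (integrable_of_bounded h.cont_re.measurable h.le_re)
    ((integrable_of_bounded h.cont_im.measurable h.le_im).const_mul _), integral_const_mul]
  ring

theorem HasBoundedPartials.integral_conj_mul (h : HasBoundedPartials f fx fy C) :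
    ∫ a, (starRingEnd ℂ) a * f a ∂stdComplexGaussian =
      2⁻¹ * ∫ a, (fx a - Complex.I * fy a) ∂stdComplexGaussian := by
  have h1 : ∀ a : ℂ, (starRingEnd ℂ) a * f a =
      (a.re : ℂ) * f a - Complex.I * ((a.im : ℂ) * f a) := fun a => by
    have : (starRingEnd ℂ) a = a.re - a.im * Complex.I := by apply Complex.ext <;> simp
    rw [this]
    ring
  simp_rw [h1]
  rw [integral_sub (integrable_re_mul_of_bounded h.cont.measurable h.le)
    ((integrable_im_mul_of_bounded h.cont.measurable h.le).const_mul _), integral_const_mul,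
    h.integral_re_mul, h.integral_im_mul,
    integral_sub (integrable_of_bounded h.cont_re.measurable h.le_re)
    ((integrable_of_bounded h.cont_im.measurable h.le_im).const_mul _), integral_const_mul]
  ring

/-- The Poincaré inequality for the standard complex normal law. -/
theorem HasBoundedPartials.dispersion_le (h : HasBoundedPartials f fx fy C) :
    dispersion stdComplexGaussian f ≤
      ∫ a, (‖fx a‖ ^ 2 + ‖fy a‖ ^ 2) / 2 ∂stdComplexGaussian := by
  have hm := continuous_complex_mk
  have hmx : ∀ y : ℝ, Continuous fun x : ℝ => (⟨x, y⟩ : ℂ) := fun y =>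
    hm.comp (by fun_prop : Continuous fun x : ℝ => (x, y))
  have hmy : ∀ x : ℝ, Continuous fun y : ℝ => (⟨x, y⟩ : ℂ) := fun x =>
    hm.comp (by fun_prop : Continuous fun y : ℝ => (x, y))
  have h0 : dispersion stdComplexGaussian f =
      dispersion ((gaussianReal 0 2⁻¹).prod (gaussianReal 0 2⁻¹))
        fun p : ℝ × ℝ => f ⟨p.1, p.2⟩ := by
    unfold dispersion
    rw [integral_stdComplexGaussian, integral_stdComplexGaussian]
  have ix : Integrable (fun p : ℝ × ℝ => ‖fx ⟨p.1, p.2⟩‖ ^ 2)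
      ((gaussianReal 0 2⁻¹).prod (gaussianReal 0 2⁻¹)) :=
    integrable_norm_sq_of_bounded (h.cont_re.comp hm).measurable fun p => h.le_re _
  have iy : Integrable (fun p : ℝ × ℝ => ‖fy ⟨p.1, p.2⟩‖ ^ 2)
      ((gaussianReal 0 2⁻¹).prod (gaussianReal 0 2⁻¹)) :=
    integrable_norm_sq_of_bounded (h.cont_im.comp hm).measurable fun p => h.le_im _
  rw [h0, integral_stdComplexGaussian, integral_div, integral_add ix iy, integral_prod_symm _ ix,
    integral_prod _ iy, add_div, ← integral_div, ← integral_div]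
  refine (dispersion_prod_le (h.cont.comp hm).measurable fun p => h.le _).trans
    (add_le_add ?_ ?_)
  · refine integral_mono_of_nonneg (ae_of_all _ fun y => integral_nonneg fun x => sq_nonneg _)
      (ix.integral_prod_right.div_const 2) (ae_of_all _ fun y => ?_)
    have := dispersion_gaussianReal_le (v := 2⁻¹) (by simp) (h.hasDerivAt_re · y)
      (h.cont_re.comp (hmx y)) (fun x => h.le _) fun x => h.le_re _
    simp only [NNReal.coe_inv, NNReal.coe_ofNat] at this
    simp only [Function.comp_apply]
    linarith
  · refine integral_mono_of_nonneg (ae_of_all _ fun y => integral_nonneg fun x => sq_nonneg _)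
      (iy.integral_prod_left.div_const 2) (ae_of_all _ fun x => ?_)
    have := dispersion_gaussianReal_le (v := 2⁻¹) (by simp) (h.hasDerivAt_im x ·)
      (h.cont_im.comp (hmy x)) (fun x => h.le _) fun x => h.le_im _
    simp only [NNReal.coe_inv, NNReal.coe_ofNat] at this
    simp only [Function.comp_apply]
    linarith

end ComplexGaussian

/-! ### Product measures: resampling a coordinate and tensorising the Poincaré inequality. -/

section Product

variable {X : Type*} [MeasurableSpace X] {γ : Measure X} [IsProbabilityMeasure γ] {n : ℕ}

/-- Replacing one coordinate by an independent copy preserves the law; this is how one-variable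
integration by parts is applied inside a product. -/
theorem measurePreserving_update (i : Fin n) :
    MeasurePreserving (fun p : (Fin n → X) × X => Function.update p.1 i p.2)
      ((Measure.pi fun _ => γ).prod γ) (Measure.pi fun _ => γ) := by
  refine ⟨measurable_update', (Measure.pi_eq fun s hs => ?_).symm⟩
  have h1 : (fun p : (Fin n → X) × X => Function.update p.1 i p.2) ⁻¹' Set.univ.pi s =
      (Set.univ.pi (Function.update s i Set.univ)) ×ˢ s i := by
    ext p
    simp only [Set.mem_preimage, Set.mem_univ_pi, Set.mem_prod]
    constructor
    · refine fun h => ⟨fun j => ?_, by simpa using h i⟩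
      by_cases hj : j = i
      · subst hj; simp
      · simpa [hj] using h j
    · rintro ⟨h1, h2⟩ j
      by_cases hj : j = i
      · subst hj; simpa using h2
      · simpa [hj] using h1 j
  rw [Measure.map_apply measurable_update' (MeasurableSet.univ_pi hs), h1, Measure.prod_prod,
    Measure.pi_pi, ← Finset.mul_prod_erase _ (fun j => γ (s j)) (Finset.mem_univ i),
    ← Finset.mul_prod_erase _ _ (Finset.mem_univ i)]
  simp only [Function.update_self, measure_univ, one_mul]
  rw [mul_comm]
  congr 1
  refine Finset.prod_congr rfl fun j hj => ?_
  rw [Function.update_of_ne (Finset.ne_of_mem_erase hj)]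

theorem integral_pi_eq_integral_update {E : Type*} [NormedAddCommGroup E] [NormedSpace ℝ E]
    (i : Fin n) {F : (Fin n → X) → E} (hF : Integrable F (Measure.pi fun _ => γ)) :
    ∫ x, F x ∂(Measure.pi fun _ => γ) =
      ∫ x, ∫ a, F (Function.update x i a) ∂γ ∂(Measure.pi fun _ => γ) := by
  have h := measurePreserving_update (γ := γ) i
  have h1 := integral_map h.aemeasurable (f := F) (by rw [h.map_eq]; exact hF.1)
  rw [h.map_eq] at h1
  rw [h1]
  exact integral_prod _ (h.integrable_comp_of_integrable hF)

/-- A Poincaré inequality in each variable implies one for the product measure. -/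
theorem dispersion_pi_le {F : (Fin n → X) → ℂ} {D : Fin n → (Fin n → X) → ℝ} {C C' : ℝ}
    (hF : Measurable F) (hC : ∀ x, ‖F x‖ ≤ C) (hD : ∀ i, Measurable (D i))
    (hC' : ∀ i x, ‖D i x‖ ≤ C')
    (h : ∀ i x, dispersion γ (fun a => F (Function.update x i a)) ≤
      ∫ a, D i (Function.update x i a) ∂γ) :
    dispersion (Measure.pi fun _ => γ) F ≤ ∑ i, ∫ x, D i x ∂(Measure.pi fun _ => γ) := by
  induction n with
  | zero =>
    have h0 : ∀ x, F x = F default := fun x => congrArg F (Subsingleton.elim _ _)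
    unfold dispersion
    simp_rw [h0]
    simp
  | succ n ih =>
    have hmp := (measurePreserving_piFinSuccAbove (fun _ : Fin (n + 1) => γ) 0).symm
    set e := (MeasurableEquiv.piFinSuccAbove (fun _ : Fin (n + 1) => X) 0).symm with he
    have hcons : ∀ p : X × (Fin n → X), e p = Fin.cons p.1 p.2 := fun p => by
      simp only [he, MeasurableEquiv.piFinSuccAbove]
      exact Fin.insertNth_zero' _ _
    have hint : ∀ {E : Type} [NormedAddCommGroup E] [NormedSpace ℝ E] (G : (Fin (n + 1) → X) → E),
        ∫ x, G x ∂(Measure.pi fun _ => γ) =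
          ∫ p, G (Fin.cons p.1 p.2) ∂(γ.prod (Measure.pi fun _ => γ)) := fun G => by
      rw [← hmp.integral_comp']
      simp_rw [hcons]
    have hmeas : Measurable fun p : X × (Fin n → X) => (Fin.cons p.1 p.2 : Fin (n + 1) → X) := by
      have := e.measurable
      rwa [show ⇑e = _ from funext hcons] at this
    have h0 : dispersion (Measure.pi fun _ => γ) F = dispersion (γ.prod (Measure.pi fun _ => γ))
        fun p : X × (Fin n → X) => F (Fin.cons p.1 p.2) := by
      unfold dispersion
      rw [hint, hint]
    have hDi : ∀ i, Integrable (fun p : X × (Fin n → X) => D i (Fin.cons p.1 p.2))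
        (γ.prod (Measure.pi fun _ => γ)) := fun i =>
      integrable_of_bounded ((hD i).comp hmeas) fun p => hC' i _
    rw [h0, Fin.sum_univ_succ]
    -- The hypothesis treats coordinate `0`; the induction treats the others with coordinate `0`
    -- frozen.
    refine (dispersion_prod_le (hF.comp hmeas) fun p => hC _).trans (add_le_add ?_ ?_)
    · rw [hint, integral_prod_symm _ (hDi 0)]
      refine integral_mono_of_nonneg (ae_of_all _ fun y => integral_nonneg fun x => sq_nonneg _)
        (hDi 0).integral_prod_right (ae_of_all _ fun y => ?_)
      obtain ⟨x₀⟩ : Nonempty X := nonempty_of_isProbabilityMeasure γ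
      simpa [Fin.update_cons_zero] using h 0 (Fin.cons x₀ y)
    · simp_rw [hint (D _)]
      have h1 : ∀ i : Fin n, ∫ p, D i.succ (Fin.cons p.1 p.2) ∂(γ.prod (Measure.pi fun _ => γ)) =
          ∫ x, ∫ y, D i.succ (Fin.cons x y) ∂(Measure.pi fun _ => γ) ∂γ := fun i =>
        integral_prod _ (hDi i.succ)
      simp_rw [h1]
      rw [← integral_finsetSum _ fun i _ => (hDi i.succ).integral_prod_left]
      refine integral_mono_of_nonneg (ae_of_all _ fun y => integral_nonneg fun x => sq_nonneg _)
        (integrable_finsetSum _ fun i _ => (hDi i.succ).integral_prod_left)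
        (ae_of_all _ fun x => ?_)
      have hmx : Measurable fun y : Fin n → X => (Fin.cons x y : Fin (n + 1) → X) :=
        hmeas.comp measurable_prodMk_left
      refine ih (F := fun y => F (Fin.cons x y)) (D := fun i y => D i.succ (Fin.cons x y))
        (hF.comp hmx) (fun y => hC _) (fun i => (hD i.succ).comp hmx) (fun i y => hC' _ _)
        fun i y => ?_
      simpa [Fin.cons_update] using h i.succ (Fin.cons x y)

end Product

end

noncomputable section

/-! ### Resolvents of Hermitian matrices. -/

section Resolvent

open scoped Matrix.Norms.L2Operator

variable {ι : Type*} [Fintype ι] [DecidableEq ι] {X Y : Matrix ι ι ℂ} {w : ℂ}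

theorem sum_norm_sq_row_le (M : Matrix ι ι ℂ) (x : ι) : ∑ y, ‖M x y‖ ^ 2 ≤ ‖M‖ ^ 2 := by
  have h := Matrix.l2_opNorm_mulVec Mᴴ (EuclideanSpace.single x (1 : ℂ))
  rw [Matrix.l2_opNorm_conjTranspose] at h
  have h2 := pow_le_pow_left₀ (norm_nonneg _) h 2
  rw [EuclideanSpace.norm_sq_eq] at h2
  simpa using h2

theorem norm_entry_le_opNorm (M : Matrix ι ι ℂ) (x y : ι) : ‖M x y‖ ≤ ‖M‖ := by
  refine le_of_sq_le_sq ((Finset.single_le_sum (f := fun y => ‖M x y‖ ^ 2)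
    (fun y _ => sq_nonneg _) (Finset.mem_univ y)).trans (sum_norm_sq_row_le M x)) (norm_nonneg _)

theorem sum_norm_sq_le (M : Matrix ι ι ℂ) :
    ∑ x, ∑ y, ‖M x y‖ ^ 2 ≤ Fintype.card ι * ‖M‖ ^ 2 := by
  refine (Finset.sum_le_sum fun x _ => sum_norm_sq_row_le M x).trans (le_of_eq ?_)
  simp

theorem norm_trace_le (M : Matrix ι ι ℂ) : ‖M.trace‖ ≤ Fintype.card ι * ‖M‖ := by
  refine (norm_sum_le_of_le _ fun x _ => norm_entry_le_opNorm M x x).trans (le_of_eq ?_)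
  simp

/-- The resolvent `(w - X)⁻¹` of a matrix. -/
def matrixResolvent (w : ℂ) (X : Matrix ι ι ℂ) : Matrix ι ι ℂ := (w • 1 - X)⁻¹

theorem isUnit_smul_one_sub (hX : X.IsHermitian) (hw : 0 < w.im) :
    IsUnit (w • (1 : Matrix ι ι ℂ) - X) := by
  have h1 : w ∉ spectrum ℂ X := fun h => by
    have := IsSelfAdjoint.im_eq_zero_of_mem_spectrum (a := X) hX h
    linarith
  rw [spectrum.notMem_iff, Algebra.algebraMap_eq_smul_one] at h1
  exact h1

theorem isUnit_det_smul_one_sub (hX : X.IsHermitian) (hw : 0 < w.im) :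
    IsUnit (w • (1 : Matrix ι ι ℂ) - X).det :=
  (Matrix.isUnit_iff_isUnit_det _).1 (isUnit_smul_one_sub hX hw)

theorem matrixResolvent_mul (hX : X.IsHermitian) (hw : 0 < w.im) :
    matrixResolvent w X * (w • 1 - X) = 1 :=
  Matrix.nonsing_inv_mul _ (isUnit_det_smul_one_sub hX hw)

theorem mul_matrixResolvent (hX : X.IsHermitian) (hw : 0 < w.im) :
    (w • 1 - X) * matrixResolvent w X = 1 :=
  Matrix.mul_nonsing_inv _ (isUnit_det_smul_one_sub hX hw)

/-- One identity for both uses: `w = w'` gives the derivative in the matrix, and `X = Y` the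
Lipschitz bound in the spectral parameter. -/
theorem matrixResolvent_sub (hX : X.IsHermitian) (hY : Y.IsHermitian) {w' : ℂ} (hw : 0 < w.im)
    (hw' : 0 < w'.im) : matrixResolvent w Y - matrixResolvent w' X =
      matrixResolvent w Y * ((w' - w) • 1 + (Y - X)) * matrixResolvent w' X := by
  have h1 : (w' - w) • (1 : Matrix ι ι ℂ) + (Y - X) = (w' • 1 - X) - (w • 1 - Y) := by
    rw [sub_smul]; abel
  rw [h1, mul_sub, sub_mul, mul_assoc, mul_matrixResolvent hX hw', matrixResolvent_mul hY hw,
    mul_one, one_mul]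

theorem matrixResolvent_sub_conjTranspose (hX : X.IsHermitian) (hw : 0 < w.im) :
    matrixResolvent w X - (matrixResolvent w X)ᴴ =
      (-(2 * w.im : ℝ) * Complex.I) • (matrixResolvent w X * (matrixResolvent w X)ᴴ) := by
  set G := matrixResolvent w X with hG
  have h1 : (w • 1 - X) * G = 1 := mul_matrixResolvent hX hw
  have h2 : G * (w • 1 - X) = 1 := matrixResolvent_mul hX hw
  have h3 : ((starRingEnd ℂ) w • 1 - X) * Gᴴ = 1 := by
    have := congrArg Matrix.conjTranspose h2
    simpa [Matrix.conjTranspose_mul, hX.eq] using this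
  have h4 : G - Gᴴ = G * (((starRingEnd ℂ) w • 1 - X) - (w • 1 - X)) * Gᴴ := by
    rw [mul_sub, sub_mul, mul_assoc, h3, h2, mul_one, one_mul]
  rw [h4, sub_sub_sub_cancel_right, ← sub_smul, Matrix.mul_smul, mul_one, Matrix.smul_mul]
  congr 1
  apply Complex.ext <;> simp
  ring

/-- Taking norms in `G - Gᴴ = -2i (Im w) G Gᴴ` gives `2 (Im w) ‖G‖² ≤ 2 ‖G‖` by the C*-identity. -/
theorem norm_matrixResolvent_le (hX : X.IsHermitian) (hw : 0 < w.im) :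
    ‖matrixResolvent w X‖ ≤ 1 / w.im := by
  have h1 := congrArg norm (matrixResolvent_sub_conjTranspose hX hw)
  set G := matrixResolvent w X with hG
  have h2 : ‖G - Gᴴ‖ ≤ 2 * ‖G‖ := by
    refine (norm_sub_le _ _).trans ?_
    rw [Matrix.l2_opNorm_conjTranspose]
    linarith
  have h3 : ‖G * Gᴴ‖ = ‖G‖ * ‖G‖ := by
    have := Matrix.l2_opNorm_conjTranspose_mul_self Gᴴ
    rwa [Matrix.conjTranspose_conjTranspose, Matrix.l2_opNorm_conjTranspose] at this
  rw [norm_smul, h3] at h1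
  have h4 : ‖-((2 * w.im : ℝ) : ℂ) * Complex.I‖ = 2 * w.im := by
    rw [norm_mul, norm_neg, Complex.norm_I, mul_one, Complex.norm_real,
      Real.norm_of_nonneg (by positivity)]
  rw [h4] at h1
  rcases (norm_nonneg G).eq_or_lt with h0 | h0
  · rw [← h0]; positivity
  · rw [le_div_iff₀ hw]
    nlinarith

/-- The diagonal of the same identity: the imaginary part is `-Im w` times the squared norm of a row
of `G`, and an invertible matrix has no zero row. -/
theorem matrixResolvent_apply_self_im (hX : X.IsHermitian) (hw : 0 < w.im) (x : ι) :
    (matrixResolvent w X x x).im < 0 := by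
  have h1 := congrFun (congrFun (matrixResolvent_sub_conjTranspose hX hw) x) x
  have h0 := congrFun (congrFun (matrixResolvent_mul hX hw) x) x
  set G := matrixResolvent w X with hG
  have h2 : (G * Gᴴ) x x = ((∑ y, ‖G x y‖ ^ 2 : ℝ) : ℂ) := by
    simp [Matrix.mul_apply, Complex.mul_conj, Complex.normSq_eq_norm_sq]
  simp only [Matrix.sub_apply, Matrix.smul_apply, Matrix.conjTranspose_apply, smul_eq_mul] at h1
  rw [h2] at h1
  have h4 : (G x x).im = -w.im * ∑ y, ‖G x y‖ ^ 2 := by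
    generalize ∑ y, ‖G x y‖ ^ 2 = s at h1
    have h3 := congrArg Complex.im h1
    simp at h3
    linarith
  have h5 : 0 < ∑ y, ‖G x y‖ ^ 2 := by
    refine lt_of_le_of_ne (Finset.sum_nonneg fun y _ => sq_nonneg _) fun h => ?_
    have h6 := (Finset.sum_eq_zero_iff_of_nonneg fun y _ => sq_nonneg (‖G x y‖)).1 h.symm
    have h7 : ∀ y, G x y = 0 := fun y => by simpa using h6 y (Finset.mem_univ y)
    simp [Matrix.mul_apply, h7] at h0
  rw [h4]
  nlinarith

theorem continuous_matrixResolvent {T : Type*} [TopologicalSpace T] {X : T → Matrix ι ι ℂ}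
    (hX : ∀ t, (X t).IsHermitian) (hc : ∀ x y, Continuous fun t => X t x y) (hw : 0 < w.im)
    (x y : ι) : Continuous fun t => matrixResolvent w (X t) x y := by
  have hA : Continuous fun t => w • (1 : Matrix ι ι ℂ) - X t := by
    refine continuous_pi fun x => continuous_pi fun y => ?_
    simp only [Matrix.sub_apply]
    exact continuous_const.sub (hc x y)
  have h1 : ∀ t, matrixResolvent w (X t) x y =
      (w • (1 : Matrix ι ι ℂ) - X t).det⁻¹ * (w • (1 : Matrix ι ι ℂ) - X t).adjugate x y :=
    fun t => by
      rw [matrixResolvent, Matrix.inv_def, Ring.inverse_eq_inv', Matrix.smul_apply, smul_eq_mul]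
  simp_rw [h1]
  refine (hA.matrix_det.inv₀ fun t => (isUnit_det_smul_one_sub (hX t) hw).ne_zero).mul ?_
  exact (continuous_apply y).comp ((continuous_apply x).comp hA.matrix_adjugate)

/-- Carathéodory's form of the derivative: continuity of the slope replaces any estimate of a
remainder. -/
theorem hasDerivAt_of_eq_add_mul {f g : ℝ → ℂ} (h : ∀ t, f t = f 0 + t * g t)
    (hg : ContinuousAt g 0) : HasDerivAt f (g 0) 0 := by
  rw [hasDerivAt_iff_tendsto_slope]
  refine (hg.tendsto.mono_left nhdsWithin_le_nhds).congr' ?_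
  filter_upwards [self_mem_nhdsWithin] with t ht
  have ht' : (t : ℂ) ≠ 0 := by exact_mod_cast ht
  rw [slope_def_module, h t, sub_zero, add_sub_cancel_left, Complex.real_smul, ← mul_assoc]
  push_cast
  rw [inv_mul_cancel₀ ht', one_mul]

omit [DecidableEq ι] in
theorem trace_mul_continuous {T : Type*} [TopologicalSpace T] {F : T → Matrix ι ι ℂ}
    (hF : ∀ x y, Continuous fun t => F t x y) (Q : Matrix ι ι ℂ) :
    Continuous fun t => (Q * F t).trace := by
  simp only [Matrix.trace, Matrix.diag_apply, Matrix.mul_apply]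
  exact continuous_finsetSum _ fun x _ => continuous_finsetSum _ fun y _ =>
    continuous_const.mul (hF y x)

/-- The derivative of the resolvent along a line of Hermitian matrices. -/
theorem hasDerivAt_trace_matrixResolvent {M : Matrix ι ι ℂ} (hX : X.IsHermitian)
    (hM : M.IsHermitian) (hw : 0 < w.im) (Q : Matrix ι ι ℂ) :
    HasDerivAt (fun t : ℝ => (Q * matrixResolvent w (X + (t : ℂ) • M)).trace)
      (Q * (matrixResolvent w X * M * matrixResolvent w X)).trace 0 := by
  have hXt : ∀ t : ℝ, (X + (t : ℂ) • M).IsHermitian := fun t => by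
    refine hX.add ?_
    rw [Matrix.IsHermitian, Matrix.conjTranspose_smul, hM.eq]
    simp
  have hcX : ∀ x y, Continuous fun t : ℝ => (X + (t : ℂ) • M) x y := fun x y => by
    simp only [Matrix.add_apply, Matrix.smul_apply, smul_eq_mul]
    fun_prop
  set g : ℝ → ℂ := fun t =>
    (Q * (matrixResolvent w (X + (t : ℂ) • M) * (M * matrixResolvent w X))).trace with hg
  have hgc : Continuous g := by
    have : g = fun t : ℝ => ((M * matrixResolvent w X * Q) *
        matrixResolvent w (X + (t : ℂ) • M)).trace := funext fun t => by
      change (Q * (matrixResolvent w (X + (t : ℂ) • M) * (M * matrixResolvent w X))).trace = _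
      rw [Matrix.trace_mul_comm, Matrix.mul_assoc (matrixResolvent w (X + (t : ℂ) • M)),
        Matrix.trace_mul_comm]
    rw [this]
    exact trace_mul_continuous (continuous_matrixResolvent hXt hcX hw) _
  have h1 := hasDerivAt_of_eq_add_mul
    (f := fun t : ℝ => (Q * matrixResolvent w (X + (t : ℂ) • M)).trace) (g := g)
    ?_ hgc.continuousAt
  · simp only [hg, Complex.ofReal_zero, zero_smul, add_zero] at h1
    rwa [Matrix.mul_assoc (matrixResolvent w X)]
  · intro t
    have h2 := matrixResolvent_sub hX (hXt t) hw hw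
    rw [sub_self, zero_smul, zero_add, add_sub_cancel_left, Matrix.mul_smul, Matrix.smul_mul,
      sub_eq_iff_eq_add'] at h2
    change (Q * matrixResolvent w (X + (t : ℂ) • M)).trace =
      (Q * matrixResolvent w (X + ((0 : ℝ) : ℂ) • M)).trace + t * (Q * (matrixResolvent w
        (X + (t : ℂ) • M) * (M * matrixResolvent w X))).trace
    rw [Complex.ofReal_zero, zero_smul, add_zero]
    nth_rewrite 1 [h2]
    rw [Matrix.mul_add, Matrix.trace_add, Matrix.mul_smul, Matrix.trace_smul, smul_eq_mul,
      Matrix.mul_assoc (matrixResolvent w (X + (t : ℂ) • M))]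

end Resolvent
end

noncomputable section

/-! ### Loop equation and variance bound for a Gaussian Hermitian matrix. -/

section HermitianSum

variable {ι : Type*} [Fintype ι] [DecidableEq ι] {w : ℂ} {n : ℕ}

open scoped Matrix.Norms.L2Operator in
-- Only uniformity in `X` matters here: the constant serves integrability and the boundedness of
-- partial derivatives, so it may depend on the dimension.
theorem exists_norm_trace_le (hw : 0 < w.im) (Q M : Matrix ι ι ℂ) :
    ∃ C, ∀ X : Matrix ι ι ℂ, X.IsHermitian → ‖(Q * matrixResolvent w X).trace‖ ≤ C ∧
      ‖(Q * (matrixResolvent w X * M * matrixResolvent w X)).trace‖ ≤ C := by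
  refine ⟨Fintype.card ι * (‖Q‖ * (1 / w.im)) +
    Fintype.card ι * (‖Q‖ * (1 / w.im * ‖M‖ * (1 / w.im))), fun X hX => ?_⟩
  have hG := norm_matrixResolvent_le hX hw
  have h1 : ‖(Q * matrixResolvent w X).trace‖ ≤ Fintype.card ι * (‖Q‖ * (1 / w.im)) := by
    refine (norm_trace_le _).trans ?_
    gcongr
    exact (norm_mul_le _ _).trans (by gcongr)
  have h2 : ‖(Q * (matrixResolvent w X * M * matrixResolvent w X)).trace‖ ≤
      Fintype.card ι * (‖Q‖ * (1 / w.im * ‖M‖ * (1 / w.im))) := by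
    refine (norm_trace_le _).trans ?_
    gcongr
    refine (norm_mul_le _ _).trans ?_
    gcongr
    refine (norm_mul_le _ _).trans ?_
    gcongr
    exact (norm_mul_le _ _).trans (by gcongr)
  constructor
  · exact h1.trans (le_add_of_nonneg_right (by positivity))
  · exact h2.trans (le_add_of_nonneg_left (by positivity))

open scoped Matrix.Norms.L2Operator in
-- The squared Hilbert–Schmidt norm is at most the dimension times the squared operator norm. The
-- hypothesis on `Q` says that its operator norm is at most `1`, phrased through vectors.
theorem sum_norm_sq_resolvent_mul_le {X : Matrix ι ι ℂ} (hX : X.IsHermitian) (hw : 0 < w.im)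
    {Q : Matrix ι ι ℂ} (hQ : ∀ v : EuclideanSpace ℂ ι, ‖(WithLp.toLp 2 (Q *ᵥ v) : EuclideanSpace ℂ ι)‖ ≤ ‖v‖) :
    ∑ x, ∑ y, ‖(matrixResolvent w X * Q * matrixResolvent w X) x y‖ ^ 2 ≤
      Fintype.card ι / w.im ^ 4 := by
  refine (sum_norm_sq_le _).trans ?_
  have hG := norm_matrixResolvent_le hX hw
  have hQ' : ‖Q‖ ≤ 1 := by
    rw [Matrix.l2_opNorm_def]
    refine ContinuousLinearMap.opNorm_le_bound _ zero_le_one fun v => ?_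
    rw [one_mul]
    exact hQ v
  have h1 : ‖matrixResolvent w X * Q * matrixResolvent w X‖ ≤ 1 / w.im * 1 * (1 / w.im) := by
    refine (norm_mul_le _ _).trans ?_
    gcongr
    exact (norm_mul_le _ _).trans (by gcongr)
  calc _ ≤ Fintype.card ι * (1 / w.im * 1 * (1 / w.im)) ^ 2 := by gcongr
    _ = _ := by field_simp

/-- The Hermitian matrix `∑ i, (a i • E i + conj (a i) • (E i)ᴴ)`. -/
def hermitianSum (E : Fin n → Matrix ι ι ℂ) (a : Fin n → ℂ) : Matrix ι ι ℂ :=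
  ∑ i, (a i • E i + (starRingEnd ℂ) (a i) • (E i)ᴴ)

variable {E : Fin n → Matrix ι ι ℂ}

omit [Fintype ι] [DecidableEq ι] in
theorem hermitianSum_isHermitian (E : Fin n → Matrix ι ι ℂ) (a : Fin n → ℂ) :
    (hermitianSum E a).IsHermitian := by
  unfold hermitianSum
  rw [Matrix.IsHermitian, Matrix.conjTranspose_sum]
  refine Finset.sum_congr rfl fun i _ => ?_
  rw [Matrix.conjTranspose_add, Matrix.conjTranspose_smul, Matrix.conjTranspose_smul,
    Matrix.conjTranspose_conjTranspose, add_comm]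
  simp

omit [Fintype ι] [DecidableEq ι] in
theorem hermitianSum_update_add (a : Fin n → ℂ) (i : Fin n) (b t : ℂ) :
    hermitianSum E (Function.update a i (b + t)) =
      hermitianSum E (Function.update a i b) + (t • E i + (starRingEnd ℂ) t • (E i)ᴴ) := by
  unfold hermitianSum
  rw [← Finset.add_sum_erase _ _ (Finset.mem_univ i), ← Finset.add_sum_erase _ _ (Finset.mem_univ i)]
  have h1 : ∀ c : ℂ, ∑ j ∈ Finset.univ.erase i, (Function.update a i c j • E j +
      (starRingEnd ℂ) (Function.update a i c j) • (E j)ᴴ) =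
      ∑ j ∈ Finset.univ.erase i, (a j • E j + (starRingEnd ℂ) (a j) • (E j)ᴴ) := fun c =>
    Finset.sum_congr rfl fun j hj => by rw [Function.update_of_ne (Finset.ne_of_mem_erase hj)]
  rw [h1, h1]
  simp only [Function.update_self, map_add, add_smul]
  abel

omit [Fintype ι] [DecidableEq ι] in
theorem continuous_hermitianSum_apply (x y : ι) : Continuous fun a => hermitianSum E a x y := by
  unfold hermitianSum
  simp only [Matrix.sum_apply, Matrix.add_apply, Matrix.smul_apply, smul_eq_mul]
  exact continuous_finsetSum _ fun i _ => ((continuous_apply i).mul continuous_const).add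
    ((Complex.continuous_conj.comp (continuous_apply i)).mul continuous_const)

theorem continuous_resolvent_hermitianSum (hw : 0 < w.im) :
    Continuous fun a => matrixResolvent w (hermitianSum E a) :=
  continuous_matrix fun x y => continuous_matrixResolvent (hermitianSum_isHermitian E)
    continuous_hermitianSum_apply hw x y

theorem exists_hasBoundedPartials (hw : 0 < w.im) (E : Fin n → Matrix ι ι ℂ) (Q : Matrix ι ι ℂ)
    (i : Fin n) : ∃ C, ∀ a : Fin n → ℂ, HasBoundedPartials
      (fun b => (Q * matrixResolvent w (hermitianSum E (Function.update a i b))).trace)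
      (fun b => (Q * (matrixResolvent w (hermitianSum E (Function.update a i b)) *
        (E i + (E i)ᴴ) * matrixResolvent w (hermitianSum E (Function.update a i b)))).trace)
      (fun b => (Q * (matrixResolvent w (hermitianSum E (Function.update a i b)) *
        (Complex.I • E i - Complex.I • (E i)ᴴ) *
        matrixResolvent w (hermitianSum E (Function.update a i b)))).trace) C := by
  obtain ⟨C₁, hC₁⟩ := exists_norm_trace_le hw Q (E i + (E i)ᴴ)
  obtain ⟨C₂, hC₂⟩ := exists_norm_trace_le hw Q (Complex.I • E i - Complex.I • (E i)ᴴ)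
  have hherm : ∀ a, (hermitianSum E a).IsHermitian := hermitianSum_isHermitian E
  refine ⟨max C₁ C₂, fun a => ?_⟩
  have hupd : Continuous fun b => Function.update a i b := continuous_const.update i continuous_id
  have hc : Continuous fun b => matrixResolvent w (hermitianSum E (Function.update a i b)) :=
    (continuous_resolvent_hermitianSum hw).comp hupd
  refine ⟨fun b => ?_, fun b => ?_, ?_, ?_, ?_, fun b => ?_, fun b => ?_, fun b => ?_⟩
  · have h1 := hasDerivAt_trace_matrixResolvent (hherm (Function.update a i b))
      (M := E i + (E i)ᴴ) (Matrix.isHermitian_add_transpose_self _) hw Q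
    refine h1.congr_of_eventuallyEq (Eventually.of_forall fun t => ?_)
    simp only [hermitianSum_update_add, Complex.conj_ofReal, smul_add]
  · have h1 := hasDerivAt_trace_matrixResolvent (hherm (Function.update a i b))
      (M := Complex.I • E i - Complex.I • (E i)ᴴ) (by
        rw [Matrix.IsHermitian]
        simp [sub_eq_add_neg, add_comm]) hw Q
    refine h1.congr_of_eventuallyEq (Eventually.of_forall fun t => ?_)
    simp only [hermitianSum_update_add, map_mul, Complex.conj_ofReal, Complex.conj_I, mul_neg,
      neg_smul, sub_eq_add_neg, smul_add, smul_neg, smul_smul]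
  · exact (continuous_const.matrix_mul hc).matrix_trace
  · exact (continuous_const.matrix_mul ((hc.matrix_mul continuous_const).matrix_mul hc)).matrix_trace
  · exact (continuous_const.matrix_mul ((hc.matrix_mul continuous_const).matrix_mul hc)).matrix_trace
  · exact (hC₁ _ (hherm _)).1.trans (le_max_left _ _)
  · exact (hC₁ _ (hherm _)).2.trans (le_max_left _ _)
  · exact (hC₂ _ (hherm _)).2.trans (le_max_right _ _)

/-- The joint law of `n` independent standard complex normal variables. -/
def gaussianFamily (n : ℕ) : Measure (Fin n → ℂ) := Measure.pi fun _ => stdComplexGaussian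

instance : IsProbabilityMeasure (gaussianFamily n) :=
  inferInstanceAs (IsProbabilityMeasure (Measure.pi fun _ => stdComplexGaussian))

theorem integrable_trace_resolvent (hw : 0 < w.im) (Q : Matrix ι ι ℂ) :
    Integrable (fun a => (Q * matrixResolvent w (hermitianSum E a)).trace) (gaussianFamily n) := by
  obtain ⟨C, hC⟩ := exists_norm_trace_le hw Q 0
  exact integrable_of_bounded (C := C)
    (continuous_const.matrix_mul (continuous_resolvent_hermitianSum hw)).matrix_trace.measurable
    fun a => (hC _ (hermitianSum_isHermitian E a)).1

theorem integrable_trace_resolvent_mul (hw : 0 < w.im) (Q M : Matrix ι ι ℂ) :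
    Integrable (fun a => (Q * (matrixResolvent w (hermitianSum E a) * M *
      matrixResolvent w (hermitianSum E a))).trace) (gaussianFamily n) := by
  obtain ⟨C, hC⟩ := exists_norm_trace_le hw Q M
  have hc : Continuous fun a => matrixResolvent w (hermitianSum E a) :=
    continuous_resolvent_hermitianSum hw
  exact integrable_of_bounded (C := C) (continuous_const.matrix_mul
    ((hc.matrix_mul continuous_const).matrix_mul hc)).matrix_trace.measurable
    fun a => (hC _ (hermitianSum_isHermitian E a)).2

theorem integrable_apply_mul_trace (hw : 0 < w.im) (Q : Matrix ι ι ℂ) (i : Fin n) :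
    Integrable (fun a => a i * (Q * matrixResolvent w (hermitianSum E a)).trace)
      (gaussianFamily n) := by
  obtain ⟨C, hC⟩ := exists_norm_trace_le hw Q 0
  have h1 : Integrable (fun a : Fin n → ℂ => a i) (gaussianFamily n) :=
    (measurePreserving_eval (fun _ => stdComplexGaussian) i).integrable_comp_of_integrable
      integrable_id_stdComplexGaussian
  exact h1.mul_bdd (c := C) (integrable_trace_resolvent hw Q).1
    (ae_of_all _ fun a => (hC _ (hermitianSum_isHermitian E a)).1)

theorem integrable_conj_apply_mul_trace (hw : 0 < w.im) (Q : Matrix ι ι ℂ) (i : Fin n) :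
    Integrable (fun a => (starRingEnd ℂ) (a i) *
      (Q * matrixResolvent w (hermitianSum E a)).trace) (gaussianFamily n) := by
  refine (integrable_apply_mul_trace (E := E) hw Q i).mono ?_ (ae_of_all _ fun a => ?_)
  · exact ((Complex.continuous_conj.comp (continuous_apply i)).mul (continuous_const.matrix_mul
      (continuous_resolvent_hermitianSum hw)).matrix_trace).aestronglyMeasurable
  · simp

/-- Integration by parts for the resolvent of a Gaussian Hermitian matrix. -/
theorem integral_apply_mul_trace (hw : 0 < w.im) (Q : Matrix ι ι ℂ) (i : Fin n) :
    ∫ a, a i * (Q * matrixResolvent w (hermitianSum E a)).trace ∂(gaussianFamily n) =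
      ∫ a, (Q * (matrixResolvent w (hermitianSum E a) * (E i)ᴴ *
        matrixResolvent w (hermitianSum E a))).trace ∂(gaussianFamily n) := by
  obtain ⟨C, hC⟩ := exists_hasBoundedPartials hw E Q i
  rw [gaussianFamily, integral_pi_eq_integral_update i (integrable_apply_mul_trace hw Q i),
    integral_pi_eq_integral_update i (integrable_trace_resolvent_mul hw Q (E i)ᴴ)]
  congr 1
  funext a
  simp only [Function.update_self]
  -- The partial derivatives are along `M = E i + (E i)ᴴ` and `M' = I • E i - I • (E i)ᴴ`, and `(M +
  -- I • M') / 2 = (E i)ᴴ`.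
  rw [(hC a).integral_mul, ← integral_const_mul]
  congr 1
  funext b
  simp only [Matrix.mul_add, Matrix.add_mul, Matrix.mul_sub, Matrix.sub_mul, Matrix.mul_smul,
    Matrix.smul_mul, Matrix.trace_add, Matrix.trace_sub, Matrix.trace_smul, smul_eq_mul]
  ring_nf
  rw [Complex.I_sq]
  ring

theorem integral_conj_apply_mul_trace (hw : 0 < w.im) (Q : Matrix ι ι ℂ) (i : Fin n) :
    ∫ a, (starRingEnd ℂ) (a i) * (Q * matrixResolvent w (hermitianSum E a)).trace
        ∂(gaussianFamily n) =
      ∫ a, (Q * (matrixResolvent w (hermitianSum E a) * E i *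
        matrixResolvent w (hermitianSum E a))).trace ∂(gaussianFamily n) := by
  obtain ⟨C, hC⟩ := exists_hasBoundedPartials hw E Q i
  rw [gaussianFamily, integral_pi_eq_integral_update i (integrable_conj_apply_mul_trace hw Q i),
    integral_pi_eq_integral_update i (integrable_trace_resolvent_mul hw Q (E i))]
  congr 1
  funext a
  simp only [Function.update_self]
  rw [(hC a).integral_conj_mul, ← integral_const_mul]
  congr 1
  funext b
  simp only [Matrix.mul_add, Matrix.add_mul, Matrix.mul_sub, Matrix.sub_mul, Matrix.mul_smul,
    Matrix.smul_mul, Matrix.trace_add, Matrix.trace_sub, Matrix.trace_smul, smul_eq_mul]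
  ring_nf
  rw [Complex.I_sq]
  ring

/-- The loop equation for the resolvent of a Gaussian Hermitian matrix. -/
theorem loop_equation (hw : 0 < w.im) (Q : Matrix ι ι ℂ) :
    w * ∫ a, (Q * matrixResolvent w (hermitianSum E a)).trace ∂(gaussianFamily n) =
      Q.trace + ∫ a, (Q * ((∑ i, (E i * matrixResolvent w (hermitianSum E a) * (E i)ᴴ +
        (E i)ᴴ * matrixResolvent w (hermitianSum E a) * E i)) *
        matrixResolvent w (hermitianSum E a))).trace ∂(gaussianFamily n) := by
  have h1 : ∀ a, w * (Q * matrixResolvent w (hermitianSum E a)).trace =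
      Q.trace + ∑ i, (a i * (Q * E i * matrixResolvent w (hermitianSum E a)).trace +
        (starRingEnd ℂ) (a i) * (Q * (E i)ᴴ * matrixResolvent w (hermitianSum E a)).trace) :=
    fun a => by
      -- Write `w G = 1 + X G` and expand `X`, which is linear in the `a i` and their conjugates;
      -- each term can then be integrated by parts.
      have h2 := mul_matrixResolvent (hermitianSum_isHermitian E a) hw
      rw [Matrix.sub_mul, Matrix.smul_mul, Matrix.one_mul, sub_eq_iff_eq_add] at h2
      rw [← smul_eq_mul, ← Matrix.trace_smul, ← Matrix.mul_smul, h2, Matrix.mul_add,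
        Matrix.trace_add, Matrix.mul_one]
      congr 1
      nth_rewrite 1 [hermitianSum]
      rw [Matrix.sum_mul, Matrix.mul_sum, Matrix.trace_sum]
      refine Finset.sum_congr rfl fun i _ => ?_
      rw [Matrix.add_mul, Matrix.smul_mul, Matrix.smul_mul, Matrix.mul_add, Matrix.mul_smul,
        Matrix.mul_smul, Matrix.trace_add, Matrix.trace_smul, Matrix.trace_smul, smul_eq_mul,
        smul_eq_mul, Matrix.mul_assoc, Matrix.mul_assoc]
  have h3 : ∀ a, (Q * ((∑ i, (E i * matrixResolvent w (hermitianSum E a) * (E i)ᴴ +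
        (E i)ᴴ * matrixResolvent w (hermitianSum E a) * E i)) *
        matrixResolvent w (hermitianSum E a))).trace =
      ∑ i, ((Q * E i * (matrixResolvent w (hermitianSum E a) * (E i)ᴴ *
        matrixResolvent w (hermitianSum E a))).trace + (Q * (E i)ᴴ *
        (matrixResolvent w (hermitianSum E a) * E i *
        matrixResolvent w (hermitianSum E a))).trace) := fun a => by
      rw [Matrix.sum_mul, Matrix.mul_sum, Matrix.trace_sum]
      refine Finset.sum_congr rfl fun i _ => ?_
      rw [Matrix.add_mul, Matrix.mul_add, Matrix.trace_add]
      simp only [Matrix.mul_assoc]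
  rw [← integral_const_mul]
  simp_rw [h1, h3]
  have i1 := fun i => integrable_apply_mul_trace (E := E) hw (Q * E i) i
  have i2 := fun i => integrable_conj_apply_mul_trace (E := E) hw (Q * (E i)ᴴ) i
  have i3 := fun i => integrable_trace_resolvent_mul (E := E) hw (Q * E i) (E i)ᴴ
  have i4 := fun i => integrable_trace_resolvent_mul (E := E) hw (Q * (E i)ᴴ) (E i)
  rw [integral_add (integrable_const _) (integrable_finsetSum _ fun i _ => by
      exact (i1 i).add (i2 i)), integral_finsetSum _ fun i _ => by exact (i1 i).add (i2 i),
    integral_finsetSum _ fun i _ => by exact (i3 i).add (i4 i)]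
  simp only [integral_const, probReal_univ, one_smul]
  congr 1
  refine Finset.sum_congr rfl fun i _ => ?_
  rw [integral_add (i1 i) (i2 i), integral_add (i3 i) (i4 i), integral_apply_mul_trace hw,
    integral_conj_apply_mul_trace hw]

/-- A variance bound for the resolvent of a Gaussian Hermitian matrix. -/
theorem dispersion_trace_resolvent_le (hw : 0 < w.im) {Q : Matrix ι ι ℂ}
    (hQ : ∀ v : EuclideanSpace ℂ ι, ‖(WithLp.toLp 2 (Q *ᵥ v) : EuclideanSpace ℂ ι)‖ ≤ ‖v‖)
    {c : ℝ} (hc : 0 ≤ c) (hE : ∀ M : Matrix ι ι ℂ,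
      ∑ i, (‖(M * E i).trace‖ ^ 2 + ‖(M * (E i)ᴴ).trace‖ ^ 2) ≤ c * ∑ x, ∑ y, ‖M x y‖ ^ 2) :
    dispersion (gaussianFamily n) (fun a => (Q * matrixResolvent w (hermitianSum E a)).trace) ≤
      c * (Fintype.card ι / w.im ^ 4) := by
  set G : (Fin n → ℂ) → Matrix ι ι ℂ := fun a => matrixResolvent w (hermitianSum E a) with hG
  set D : Fin n → (Fin n → ℂ) → ℝ := fun i a =>
    ‖(G a * Q * G a * E i).trace‖ ^ 2 + ‖(G a * Q * G a * (E i)ᴴ).trace‖ ^ 2 with hD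
  have hGc : Continuous G := continuous_resolvent_hermitianSum hw
  have hDc : ∀ i, Continuous (D i) := fun i => by
    have h1 : Continuous fun a => G a * Q * G a := (hGc.matrix_mul continuous_const).matrix_mul hGc
    exact ((h1.matrix_mul continuous_const).matrix_trace.norm.pow 2).add
      ((h1.matrix_mul continuous_const).matrix_trace.norm.pow 2)
  have hDsum : ∀ a, ∑ i, D i a ≤ c * (Fintype.card ι / w.im ^ 4) := fun a =>
    (hE _).trans (mul_le_mul_of_nonneg_left
      (sum_norm_sq_resolvent_mul_le (hermitianSum_isHermitian E a) hw hQ) hc)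
  have hD0 : ∀ i a, 0 ≤ D i a := fun i a => by positivity
  have hDle : ∀ i a, ‖D i a‖ ≤ c * (Fintype.card ι / w.im ^ 4) := fun i a => by
    rw [Real.norm_of_nonneg (hD0 i a)]
    exact (Finset.single_le_sum (f := fun i => D i a) (fun i _ => hD0 i a)
      (Finset.mem_univ i)).trans (hDsum a)
  obtain ⟨C, hC⟩ := exists_norm_trace_le hw Q 0
  -- Cyclicity of the trace puts each derivative in the form of a pairing of `G Q G` with a
  -- coefficient matrix, to which `hE` applies.
  have hcyc : ∀ a (M : Matrix ι ι ℂ), (Q * (G a * M * G a)).trace = (G a * Q * G a * M).trace :=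
    fun a M => by
      rw [Matrix.trace_mul_comm, Matrix.mul_assoc, Matrix.mul_assoc, Matrix.trace_mul_comm,
        Matrix.mul_assoc, Matrix.trace_mul_comm]
  refine (dispersion_pi_le (D := D) (C := C) (C' := c * (Fintype.card ι / w.im ^ 4))
    (continuous_const.matrix_mul hGc).matrix_trace.measurable
    (fun a => (hC _ (hermitianSum_isHermitian E a)).1) (fun i => (hDc i).measurable) hDle
    fun i a => ?_).trans ?_
  · obtain ⟨C', hC'⟩ := exists_hasBoundedPartials hw E Q i
    refine (hC' a).dispersion_le.trans (le_of_eq ?_)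
    congr 1
    funext b
    change (‖(Q * (G _ * _ * G _)).trace‖ ^ 2 + ‖(Q * (G _ * _ * G _)).trace‖ ^ 2) / 2 = _
    rw [hcyc, hcyc]
    simp only [hD, Matrix.mul_add, Matrix.mul_sub, Matrix.mul_smul, Matrix.trace_add,
      Matrix.trace_sub, Matrix.trace_smul, smul_eq_mul]
    generalize (G (Function.update a i b) * Q * G (Function.update a i b) * E i).trace = p
    generalize (G (Function.update a i b) * Q * G (Function.update a i b) * (E i)ᴴ).trace = q
    rw [← mul_sub, norm_mul, Complex.norm_I, one_mul]
    -- The two partial derivatives are `p + q` and `I (p - q)`; half the sum of their squared moduli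
    -- is `‖p‖² + ‖q‖²`.
    have := parallelogram_law_with_norm ℝ p q
    nlinarith
  · rw [← integral_finsetSum _ fun i _ => integrable_of_bounded (hDc i).measurable (hDle i)]
    refine (integral_mono (g := fun _ => c * (Fintype.card ι / w.im ^ 4)) ?_
      (integrable_const _) hDsum).trans (le_of_eq (by simp))
    exact integrable_finsetSum _ fun i _ => integrable_of_bounded (hDc i).measurable (hDle i)

end HermitianSum
end

noncomputable section

/-! ### Block matrices built from taps, and their covariance. -/

section BlockModel

variable {B : Type*} [Fintype B] {L N : ℕ}

/-- The coefficient matrix of the entry `(r, p)` of the tap `l`, which occurs in the blocks given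
by `T l`. -/
def blockTap (T : Fin L → B → B → ℝ) (s : ℝ) (i : Fin L × Fin N × Fin N) :
    Matrix (B × Fin N) (B × Fin N) ℂ :=
  Matrix.of fun x y => if x.2 = i.2.1 ∧ y.2 = i.2.2 then ((s * T i.1 x.1 y.1 : ℝ) : ℂ) else 0

/-- The block matrix of normalized traces of the blocks. -/
def blockAvg (M : Matrix (B × Fin N) (B × Fin N) ℂ) : Matrix B B ℂ :=
  Matrix.of fun b c => (1 / (N : ℂ)) * ∑ r, M (b, r) (c, r)

/-- The covariance coefficients of the block model. -/
def blockCov (T : Fin L → B → B → ℝ) (κ : ℝ) (b c e f : B) : ℝ :=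
  κ * ∑ l, (T l b e * T l c f + T l e b * T l f c)

variable {T : Fin L → B → B → ℝ} {s κ : ℝ} {w : ℂ} {n : ℕ}

theorem blockTap_mul_apply (i : Fin L × Fin N × Fin N) (M : Matrix (B × Fin N) (B × Fin N) ℂ)
    (x y : B × Fin N) : (blockTap T s i * M) x y =
      if x.2 = i.2.1 then ∑ e, ((s * T i.1 x.1 e : ℝ) : ℂ) * M (e, i.2.2) y else 0 := by
  simp only [Matrix.mul_apply, blockTap, Matrix.of_apply, Fintype.sum_prod_type]
  by_cases hx : x.2 = i.2.1 <;> simp [hx]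

omit [Fintype B] in
theorem conjTranspose_blockTap (i : Fin L × Fin N × Fin N) :
    (blockTap T s i)ᴴ = blockTap (fun l b c => T l c b) s (i.1, i.2.2, i.2.1) := by
  ext x y
  simp only [Matrix.conjTranspose_apply, blockTap, Matrix.of_apply]
  by_cases hx : y.2 = i.2.1 ∧ x.2 = i.2.2
  · simp [hx]
  · rw [if_neg hx, if_neg (fun h => hx h.symm), star_zero]

theorem mul_conjTranspose_blockTap_apply (i : Fin L × Fin N × Fin N)
    (M : Matrix (B × Fin N) (B × Fin N) ℂ) (x y : B × Fin N) : (M * (blockTap T s i)ᴴ) x y =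
      if y.2 = i.2.1 then ∑ f, ((s * T i.1 y.1 f : ℝ) : ℂ) * M x (f, i.2.2) else 0 := by
  simp only [Matrix.mul_apply, Matrix.conjTranspose_apply, blockTap, Matrix.of_apply,
    Fintype.sum_prod_type]
  by_cases hy : y.2 = i.2.1
  · simp only [hy, true_and, if_true, apply_ite star, star_zero, mul_ite, mul_zero,
      Finset.sum_ite_eq', Finset.mem_univ]
    refine Finset.sum_congr rfl fun e _ => ?_
    rw [mul_comm]
    simp
  · simp [hy]

/-- For the tap entry `(r, p)` both outer inner-indices must equal `r`; summing over `p` then takes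
the traces of the blocks of `M`. Thus the covariance sees `M` only through its block traces. -/
theorem sum_blockTap_mul (M : Matrix (B × Fin N) (B × Fin N) ℂ) (x y : B × Fin N) :
    (∑ i : Fin L × Fin N × Fin N, blockTap T s i * M * (blockTap T s i)ᴴ) x y =
      if x.2 = y.2 then ∑ e, ∑ f, ((s ^ 2 * ∑ l, T l x.1 e * T l y.1 f : ℝ) : ℂ) *
        ∑ p, M (e, p) (f, p) else 0 := by
  simp only [Matrix.sum_apply, mul_conjTranspose_blockTap_apply, blockTap_mul_apply,
    Fintype.sum_prod_type]
  by_cases hxy : x.2 = y.2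
  · simp only [hxy, if_true]
    simp only [Finset.sum_ite_irrel, Finset.sum_const_zero, Finset.sum_ite_eq, Finset.mem_univ,
      if_true, mul_ite, mul_zero]
    have h1 : ∀ l : Fin L, (∑ p : Fin N, ∑ f, ((s * T l y.1 f : ℝ) : ℂ) *
        ∑ e, ((s * T l x.1 e : ℝ) : ℂ) * M (e, p) (f, p)) =
        ∑ e, ∑ f, ((s ^ 2 * (T l x.1 e * T l y.1 f) : ℝ) : ℂ) * ∑ p, M (e, p) (f, p) := fun l => by
      simp only [Finset.mul_sum]
      rw [Finset.sum_comm]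
      conv_rhs => rw [Finset.sum_comm]
      refine Finset.sum_congr rfl fun f _ => ?_
      rw [Finset.sum_comm]
      refine Finset.sum_congr rfl fun e _ => Finset.sum_congr rfl fun p _ => ?_
      push_cast
      ring
    rw [Finset.sum_congr rfl fun l _ => h1 l, Finset.sum_comm]
    refine Finset.sum_congr rfl fun e _ => ?_
    rw [Finset.sum_comm]
    refine Finset.sum_congr rfl fun f _ => ?_
    rw [← Finset.sum_mul]
    congr 1
    push_cast
    rw [Finset.mul_sum]
  · rw [if_neg hxy]
    refine Finset.sum_eq_zero fun l _ => Finset.sum_eq_zero fun r _ =>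
      Finset.sum_eq_zero fun p _ => ?_
    by_cases hy : y.2 = r
    · have hx : x.2 ≠ r := fun h => hxy (h.trans hy.symm)
      simp [hx]
    · simp [hy]

theorem sum_conjTranspose_blockTap_mul (M : Matrix (B × Fin N) (B × Fin N) ℂ)
    (x y : B × Fin N) :
    (∑ i : Fin L × Fin N × Fin N, (blockTap T s i)ᴴ * M * blockTap T s i) x y =
      if x.2 = y.2 then ∑ e, ∑ f, ((s ^ 2 * ∑ l, T l e x.1 * T l f y.1 : ℝ) : ℂ) *
        ∑ p, M (e, p) (f, p) else 0 := by
  have h1 : ∑ i : Fin L × Fin N × Fin N, (blockTap T s i)ᴴ * M * blockTap T s i =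
      ∑ i : Fin L × Fin N × Fin N, blockTap (fun l b c => T l c b) s i * M *
        (blockTap (fun l b c => T l c b) s i)ᴴ := by
    refine Fintype.sum_equiv ((Equiv.refl _).prodCongr (Equiv.prodComm _ _)) _ _ fun i => ?_
    rw [conjTranspose_blockTap (T := fun l b c => T l c b), conjTranspose_blockTap]
    rfl
  rw [h1, sum_blockTap_mul]

theorem trace_mul_blockTap (M : Matrix (B × Fin N) (B × Fin N) ℂ) (i : Fin L × Fin N × Fin N) :
    (M * blockTap T s i).trace =
      ∑ b, ∑ c, ((s * T i.1 b c : ℝ) : ℂ) * M (c, i.2.2) (b, i.2.1) := by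
  rw [Matrix.trace_mul_comm]
  simp only [Matrix.trace, Matrix.diag_apply, blockTap_mul_apply, Fintype.sum_prod_type]
  refine Finset.sum_congr rfl fun b _ => ?_
  simp

/-- For one tap entry the trace involves only the entries of `M` at one pair of inner indices. After
Cauchy–Schwarz over pairs of blocks, the sum over inner indices meets each entry of `M` once, so the
factor is free of any further power of `N`. -/
theorem sum_norm_trace_mul_blockTap_le (M : Matrix (B × Fin N) (B × Fin N) ℂ) :
    ∑ i : Fin L × Fin N × Fin N, ‖(M * blockTap T s i).trace‖ ^ 2 ≤
      (s ^ 2 * ∑ l, ∑ b, ∑ c, T l b c ^ 2) * ∑ x, ∑ y, ‖M x y‖ ^ 2 := by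
  have h1 : ∀ i : Fin L × Fin N × Fin N, ‖(M * blockTap T s i).trace‖ ^ 2 ≤
      (s ^ 2 * ∑ b, ∑ c, T i.1 b c ^ 2) * ∑ b, ∑ c, ‖M (c, i.2.2) (b, i.2.1)‖ ^ 2 := fun i => by
    rw [trace_mul_blockTap, ← Finset.sum_product', ← Finset.sum_product', ← Finset.sum_product']
    have h2 : ‖∑ x ∈ (Finset.univ : Finset B) ×ˢ (Finset.univ : Finset B),
        ((s * T i.1 x.1 x.2 : ℝ) : ℂ) * M (x.2, i.2.2) (x.1, i.2.1)‖ ≤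
        ∑ x ∈ (Finset.univ : Finset B) ×ˢ (Finset.univ : Finset B),
          |s * T i.1 x.1 x.2| * ‖M (x.2, i.2.2) (x.1, i.2.1)‖ := by
      refine norm_sum_le_of_le _ fun x _ => ?_
      rw [norm_mul, Complex.norm_real, Real.norm_eq_abs]
    refine (pow_le_pow_left₀ (norm_nonneg _) h2 2).trans ?_
    refine (Finset.sum_mul_sq_le_sq_mul_sq _ _ _).trans (le_of_eq ?_)
    simp only [sq_abs, mul_pow]
    rw [← Finset.mul_sum]
  refine (Finset.sum_le_sum fun i _ => h1 i).trans (le_of_eq ?_)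
  simp only [Fintype.sum_prod_type, ← Finset.mul_sum]
  have h3 : ∑ r : Fin N, ∑ p : Fin N, ∑ b, ∑ c, ‖M (c, p) (b, r)‖ ^ 2 =
      ∑ c, ∑ p, ∑ b, ∑ r, ‖M (c, p) (b, r)‖ ^ 2 := by
    rw [Finset.sum_comm, Finset.sum_comm (s := Finset.univ (α := B)) (t := Finset.univ (α := Fin N))]
    refine Finset.sum_congr rfl fun p _ => ?_
    rw [Finset.sum_comm (s := Finset.univ (α := Fin N)) (t := Finset.univ (α := B))]
    rw [Finset.sum_comm (s := Finset.univ (α := B)) (t := Finset.univ (α := B))]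
    refine Finset.sum_congr rfl fun b _ => ?_
    rw [Finset.sum_comm]
  rw [h3, ← Finset.sum_mul, ← Finset.mul_sum]

theorem sum_norm_trace_blockTap_le (M : Matrix (B × Fin N) (B × Fin N) ℂ) :
    ∑ i : Fin L × Fin N × Fin N, (‖(M * blockTap T s i).trace‖ ^ 2 +
      ‖(M * (blockTap T s i)ᴴ).trace‖ ^ 2) ≤
      (2 * s ^ 2 * ∑ l, ∑ b, ∑ c, T l b c ^ 2) * ∑ x, ∑ y, ‖M x y‖ ^ 2 := by
  have h1 := sum_norm_trace_mul_blockTap_le (T := T) (s := s) M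
  have h2 := sum_norm_trace_mul_blockTap_le (T := T) (s := s) Mᴴ
  have h3 : ∀ i : Fin L × Fin N × Fin N,
      ‖(M * (blockTap T s i)ᴴ).trace‖ = ‖(Mᴴ * blockTap T s i).trace‖ := fun i => by
    rw [← norm_star, ← Matrix.trace_conjTranspose, Matrix.conjTranspose_mul,
      Matrix.conjTranspose_conjTranspose, Matrix.trace_mul_comm]
  have h4 : ∑ x, ∑ y, ‖Mᴴ x y‖ ^ 2 = ∑ x, ∑ y, ‖M x y‖ ^ 2 := by
    rw [Finset.sum_comm]
    simp
  rw [Finset.sum_add_distrib]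
  simp only [h3]
  rw [h4] at h2
  linarith

variable [DecidableEq B]

/-- The matrix whose trace pairing gives the trace of the block `(b, c)`. -/
def blockUnit (N : ℕ) (b c : B) : Matrix (B × Fin N) (B × Fin N) ℂ :=
  Matrix.of fun x y => if x.1 = c ∧ y.1 = b ∧ x.2 = y.2 then 1 else 0

theorem blockUnit_mulVec (b c : B) (v : B × Fin N → ℂ) (x : B × Fin N) :
    (blockUnit N b c *ᵥ v) x = if x.1 = c then v (b, x.2) else 0 := by
  simp only [Matrix.mulVec, dotProduct, blockUnit, Matrix.of_apply, Fintype.sum_prod_type]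
  by_cases h : x.1 = c
  · simp only [h, true_and, ite_and, ite_mul, one_mul, zero_mul, if_true]
    rw [Finset.sum_comm]
    simp
  · simp [h]

theorem trace_blockUnit_mul (b c : B) (M : Matrix (B × Fin N) (B × Fin N) ℂ) :
    (blockUnit N b c * M).trace = ∑ r, M (b, r) (c, r) := by
  have h1 : ∀ x, (blockUnit N b c * M) x x = if x.1 = c then M (b, x.2) x else 0 := fun x =>
    blockUnit_mulVec b c (fun y => M y x) x
  simp only [Matrix.trace, Matrix.diag_apply, h1, Fintype.sum_prod_type]
  rw [Finset.sum_comm]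
  simp

/-- `blockUnit` moves the component in block `b` to block `c` and kills the rest. -/
theorem norm_blockUnit_mulVec_le (b c : B) (v : EuclideanSpace ℂ (B × Fin N)) :
    ‖(WithLp.toLp 2 (blockUnit N b c *ᵥ v) : EuclideanSpace ℂ (B × Fin N))‖ ≤ ‖v‖ := by
  refine le_of_sq_le_sq ?_ (norm_nonneg _)
  rw [EuclideanSpace.norm_sq_eq, EuclideanSpace.norm_sq_eq, Fintype.sum_prod_type,
    Fintype.sum_prod_type, Finset.sum_comm, Finset.sum_comm (γ := B)]
  refine Finset.sum_le_sum fun r _ => ?_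
  simp only [blockUnit_mulVec]
  rw [Finset.sum_eq_single c (fun x _ hx => by simp [hx]) (by simp)]
  rw [if_pos rfl]
  exact Finset.single_le_sum (f := fun x => ‖v (x, r)‖ ^ 2) (fun x _ => sq_nonneg _)
    (Finset.mem_univ b)

end BlockModel
end

noncomputable section

/-! ### Expected block traces of the resolvent. -/

section BlockResolvent

variable {X : Type*} [MeasurableSpace X] {μ : Measure X} in
theorem dispersion_const_mul (c : ℂ) (f : X → ℂ) :
    dispersion μ (fun x => c * f x) = ‖c‖ ^ 2 * dispersion μ f := by
  unfold dispersion
  simp only [integral_const_mul, ← mul_sub, norm_mul, mul_pow]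

variable {B : Type*} [Fintype B] [DecidableEq B] {L N : ℕ}

/-- The number of complex Gaussian variables in `L` taps of size `N × N`. -/
abbrev tapCard (L N : ℕ) : ℕ := Fintype.card (Fin L × Fin N × Fin N)

/-- An enumeration of the entries of the taps. -/
def tapEquiv (L N : ℕ) : Fin (tapCard L N) ≃ Fin L × Fin N × Fin N :=
  (Fintype.equivFin (Fin L × Fin N × Fin N)).symm

/-- The Hermitian block matrix whose taps have the entries `a`. -/
def blockMatrix (T : Fin L → B → B → ℝ) (s : ℝ) (a : Fin (tapCard L N) → ℂ) :
    Matrix (B × Fin N) (B × Fin N) ℂ :=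
  hermitianSum (fun i => blockTap T s (tapEquiv L N i)) a

/-- The matrix of normalized block traces of the resolvent. -/
def blockResolvent (T : Fin L → B → B → ℝ) (s : ℝ) (w : ℂ) (a : Fin (tapCard L N) → ℂ) :
    Matrix B B ℂ :=
  blockAvg (matrixResolvent w (blockMatrix T s a))

variable {T : Fin L → B → B → ℝ} {s κ : ℝ} {w : ℂ}

omit [Fintype B] [DecidableEq B] in
theorem blockMatrix_isHermitian (T : Fin L → B → B → ℝ) (s : ℝ) (a : Fin (tapCard L N) → ℂ) :
    (blockMatrix T s a).IsHermitian :=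
  hermitianSum_isHermitian _ _

theorem blockResolvent_apply (a : Fin (tapCard L N) → ℂ) (b c : B) :
    blockResolvent T s w a b c = (1 / (N : ℂ)) *
      (blockUnit N b c * matrixResolvent w (hermitianSum
        (fun i => blockTap T s (tapEquiv L N i)) a)).trace := by
  rw [trace_blockUnit_mul]
  rfl

theorem continuous_blockResolvent (hw : 0 < w.im) (b c : B) :
    Continuous fun a : Fin (tapCard L N) → ℂ => blockResolvent T s w a b c := by
  simp_rw [blockResolvent_apply]
  exact continuous_const.mul
    (continuous_const.matrix_mul (continuous_resolvent_hermitianSum hw)).matrix_trace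

open scoped Matrix.Norms.L2Operator in
theorem norm_blockAvg_le (hN : 1 ≤ N) {M : Matrix (B × Fin N) (B × Fin N) ℂ} {C : ℝ}
    (hM : ‖M‖ ≤ C) (b c : B) : ‖blockAvg M b c‖ ≤ C := by
  have hN' : (0 : ℝ) < N := by exact_mod_cast hN
  simp only [blockAvg, Matrix.of_apply]
  rw [norm_mul]
  have h1 : ‖∑ r : Fin N, M (b, r) (c, r)‖ ≤ N * C :=
    (norm_sum_le_of_le _ fun r _ => (norm_entry_le_opNorm M _ _).trans hM).trans (by simp)
  calc _ ≤ 1 / N * (N * C) := by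
        gcongr
        simp
    _ = C := by field_simp

theorem norm_blockResolvent_le (hN : 1 ≤ N) (hw : 0 < w.im) (a : Fin (tapCard L N) → ℂ)
    (b c : B) : ‖blockResolvent T s w a b c‖ ≤ 1 / w.im :=
  norm_blockAvg_le hN (norm_matrixResolvent_le (blockMatrix_isHermitian T s a) hw) b c

theorem blockResolvent_im_neg (hN : 1 ≤ N) (hw : 0 < w.im) (a : Fin (tapCard L N) → ℂ)
    (b : B) : (blockResolvent T s w a b b).im < 0 := by
  have hN' : (0 : ℝ) < N := by exact_mod_cast hN
  simp only [blockResolvent, blockAvg, Matrix.of_apply]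
  have h1 : (1 / (N : ℂ)) = ((1 / (N : ℝ) : ℝ) : ℂ) := by push_cast; rfl
  rw [h1, Complex.im_ofReal_mul, Complex.im_sum]
  refine mul_neg_of_pos_of_neg (by positivity) (Finset.sum_neg (fun r _ =>
    matrixResolvent_apply_self_im (blockMatrix_isHermitian T s a) hw _) ?_)
  exact ⟨⟨0, hN⟩, Finset.mem_univ _⟩

theorem measurable_blockResolvent (hw : 0 < w.im) (b c : B) :
    Measurable fun a : Fin (tapCard L N) → ℂ => blockResolvent T s w a b c :=
  (continuous_blockResolvent hw b c).measurable

theorem integrable_blockResolvent (hN : 1 ≤ N) (hw : 0 < w.im) (b c : B) :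
    Integrable (fun a => blockResolvent T s w a b c) (gaussianFamily (tapCard L N)) :=
  integrable_of_bounded (measurable_blockResolvent hw b c) fun a =>
    norm_blockResolvent_le hN hw a b c

/-- The constant in the variance bound for block resolvents. -/
def blockVariance (T : Fin L → B → B → ℝ) (κ : ℝ) (w : ℂ) : ℝ :=
  2 * κ * (∑ l, ∑ b, ∑ c, T l b c ^ 2) * Fintype.card B / w.im ^ 4

/-- The normalisation of the trace contributes `N⁻²`; the factor `s²` is balanced by the dimension
`|B| N` through `s² N = κ`. -/
theorem dispersion_blockResolvent_le (hN : 1 ≤ N) (hw : 0 < w.im) (hs : s ^ 2 * N = κ)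
    (b c : B) : dispersion (gaussianFamily (tapCard L N)) (fun a => blockResolvent T s w a b c) ≤
      blockVariance T κ w / N ^ 2 := by
  have hN' : (0 : ℝ) < N := by exact_mod_cast hN
  have h1 := dispersion_trace_resolvent_le (E := fun i => blockTap T s (tapEquiv L N i)) hw
    (norm_blockUnit_mulVec_le b c) (c := 2 * s ^ 2 * ∑ l, ∑ b, ∑ c, T l b c ^ 2)
    (by positivity) fun M => by
      rw [Equiv.sum_comp (tapEquiv L N) fun i => ‖(M * blockTap T s i).trace‖ ^ 2 +
        ‖(M * (blockTap T s i)ᴴ).trace‖ ^ 2]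
      exact sum_norm_trace_blockTap_le M
  simp_rw [blockResolvent_apply]
  rw [dispersion_const_mul]
  refine (mul_le_mul_of_nonneg_left h1 (sq_nonneg _)).trans (le_of_eq ?_)
  · simp only [one_div, norm_inv, Complex.norm_natCast, Fintype.card_prod, Fintype.card_fin,
      Nat.cast_mul, blockVariance, ← hs]
    field_simp

omit [DecidableEq B] in
theorem sum_blockTap_resolvent (hs : s ^ 2 * N = κ) (hN : 1 ≤ N)
    (M : Matrix (B × Fin N) (B × Fin N) ℂ) (x y : B × Fin N) :
    (∑ i, (blockTap T s (tapEquiv L N i) * M * (blockTap T s (tapEquiv L N i))ᴴ +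
      (blockTap T s (tapEquiv L N i))ᴴ * M * blockTap T s (tapEquiv L N i))) x y =
      if x.2 = y.2 then ∑ e, ∑ f, (blockCov T κ x.1 y.1 e f : ℂ) * blockAvg M e f else 0 := by
  have hN' : (N : ℂ) ≠ 0 := by exact_mod_cast (by omega : N ≠ 0)
  rw [Equiv.sum_comp (tapEquiv L N) fun i => blockTap T s i * M * (blockTap T s i)ᴴ +
    (blockTap T s i)ᴴ * M * blockTap T s i, Finset.sum_add_distrib, Matrix.add_apply,
    sum_blockTap_mul, sum_conjTranspose_blockTap_mul]
  by_cases h : x.2 = y.2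
  · simp only [h, if_true, ← Finset.sum_add_distrib, ← add_mul]
    refine Finset.sum_congr rfl fun e _ => Finset.sum_congr rfl fun f _ => ?_
    simp only [blockAvg, Matrix.of_apply, blockCov, ← hs]
    push_cast
    rw [Finset.sum_add_distrib]
    field_simp
  · simp [h]

/-- The loop equation for block resolvents. -/
theorem blockResolvent_loop (hN : 1 ≤ N) (hw : 0 < w.im) (hs : s ^ 2 * N = κ) (b c : B) :
    w * ∫ a, blockResolvent T s w a b c ∂(gaussianFamily (tapCard L N)) =
      (if b = c then 1 else 0) + ∫ a, (∑ k, (∑ e, ∑ f, (blockCov T κ b k e f : ℂ) *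
        blockResolvent T s w a e f) * blockResolvent T s w a k c)
        ∂(gaussianFamily (tapCard L N)) := by
  have hN' : (N : ℂ) ≠ 0 := by exact_mod_cast (by omega : N ≠ 0)
  have h1 := loop_equation (E := fun i => blockTap T s (tapEquiv L N i)) hw (blockUnit N b c)
  have h2 : (blockUnit N b c).trace = if b = c then (N : ℂ) else 0 := by
    have := trace_blockUnit_mul b c (1 : Matrix (B × Fin N) (B × Fin N) ℂ)
    rw [Matrix.mul_one] at this
    rw [this]
    by_cases h : b = c <;> simp [h, Matrix.one_apply]
  simp_rw [blockResolvent_apply (b := b) (c := c)]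
  rw [integral_const_mul, mul_left_comm, h1, h2, mul_add, ← integral_const_mul]
  congr 1
  · by_cases h : b = c <;> simp [h, hN']
  · congr 1
    funext a
    rw [trace_blockUnit_mul]
    simp only [Matrix.mul_apply, sum_blockTap_resolvent hs hN, Fintype.sum_prod_type]
    rw [Finset.sum_comm, Finset.mul_sum]
    refine Finset.sum_congr rfl fun k _ => ?_
    simp only [ite_mul, zero_mul, Finset.sum_ite_eq, Finset.mem_univ, if_true]
    rw [← Finset.mul_sum, mul_left_comm]
    rfl

omit [DecidableEq B] in
-- Term by term, the expectation of a product of two entries differs from the product of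
-- expectations by a covariance, hence by at most `V`.
theorem integral_fourfold_sub_le {X : Type*} [MeasurableSpace X] {μ : Measure X}
    [IsProbabilityMeasure μ] {g : X → Matrix B B ℂ} {C V : ℝ} (hg : ∀ b c, Measurable fun x => g x b c)
    (hC : ∀ x b c, ‖g x b c‖ ≤ C) (hV : ∀ b c, dispersion μ (fun x => g x b c) ≤ V)
    (t : B → B → B → B → ℂ) (b : B) :
    ‖∫ x, (∑ k, (∑ e, ∑ f, t b k e f * g x e f) * g x k b) ∂μ -
      ∑ k, (∑ e, ∑ f, t b k e f * ∫ x, g x e f ∂μ) * ∫ x, g x k b ∂μ‖ ≤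
      (∑ k, ∑ e, ∑ f, ‖t b k e f‖) * V := by
  have hi : ∀ k e f, Integrable (fun x => t b k e f * (g x e f * g x k b)) μ := fun k e f => by
    refine Integrable.const_mul (integrable_of_bounded (C := C * C) ((hg e f).mul (hg k b))
      fun x => ?_) _
    change ‖g x e f * g x k b‖ ≤ C * C
    rw [norm_mul]
    exact mul_le_mul (hC _ _ _) (hC _ _ _) (norm_nonneg _) ((norm_nonneg _).trans (hC x e f))
  simp only [Finset.sum_mul, mul_assoc]
  rw [integral_finsetSum _ fun k _ => integrable_finsetSum _ fun e _ =>
    integrable_finsetSum _ fun f _ => hi k e f, ← Finset.sum_sub_distrib]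
  refine norm_sum_le_of_le _ fun k _ => ?_
  rw [integral_finsetSum _ fun e _ => integrable_finsetSum _ fun f _ => hi k e f,
    ← Finset.sum_sub_distrib]
  refine norm_sum_le_of_le _ fun e _ => ?_
  rw [integral_finsetSum _ fun f _ => hi k e f, ← Finset.sum_sub_distrib]
  refine norm_sum_le_of_le _ fun f _ => ?_
  rw [integral_const_mul, ← mul_sub, norm_mul]
  refine mul_le_mul_of_nonneg_left ?_ (norm_nonneg _)
  refine (integral_covariance_le (hg e f) (hC · e f) (hg k b) (hC · k b)).trans ?_
  linarith [hV e f, hV k b]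

theorem matrixResolvent_conj {ι : Type*} [Fintype ι] [DecidableEq ι] {X U : Matrix ι ι ℂ}
    (hX : X.IsHermitian) (hw : 0 < w.im) (hU : U * Uᴴ = 1) :
    matrixResolvent w (U * X * Uᴴ) = U * matrixResolvent w X * Uᴴ := by
  have hU' : Uᴴ * U = 1 := mul_eq_one_comm.1 hU
  refine Matrix.inv_eq_right_inv ?_
  have h1 : w • (1 : Matrix ι ι ℂ) - U * X * Uᴴ = U * (w • 1 - X) * Uᴴ := by
    rw [Matrix.mul_sub, Matrix.sub_mul, Matrix.mul_smul, Matrix.mul_one, Matrix.smul_mul, hU]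
  calc (w • (1 : Matrix ι ι ℂ) - U * X * Uᴴ) * (U * matrixResolvent w X * Uᴴ)
      = U * ((w • 1 - X) * (Uᴴ * U) * matrixResolvent w X) * Uᴴ := by
        rw [h1]
        simp only [Matrix.mul_assoc]
    _ = 1 := by rw [hU', Matrix.mul_one, mul_matrixResolvent hX hw, Matrix.mul_one, hU]

variable {u : B → Circle} {θ : Fin L → Circle}

/-- Conjugation multiplies block `(b, c)` by `u b * conj (u c)`. By `hu` this is the single phase `θ
l` wherever tap `l` occurs, so it amounts to rotating the Gaussian entries. -/
theorem blockMatrix_rotate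
    (hu : ∀ l b c, (u b : ℂ) * T l b c * (starRingEnd ℂ) (u c : ℂ) = θ l * T l b c)
    (a : Fin (tapCard L N) → ℂ) :
    blockMatrix T s (fun i => (θ (tapEquiv L N i).1 : ℂ) * a i) =
      Matrix.diagonal (fun x : B × Fin N => (u x.1 : ℂ)) * blockMatrix T s a *
        (Matrix.diagonal (fun x : B × Fin N => (u x.1 : ℂ)))ᴴ := by
  ext x y
  rw [Matrix.diagonal_conjTranspose, Matrix.mul_diagonal, Matrix.diagonal_mul]
  simp only [blockMatrix, hermitianSum, Matrix.sum_apply, Finset.mul_sum, Finset.sum_mul,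
    Matrix.add_apply, Matrix.smul_apply, smul_eq_mul, Pi.star_apply]
  refine Finset.sum_congr rfl fun i _ => ?_
  have h1 := hu (tapEquiv L N i).1 x.1 y.1
  have h2 := congrArg (starRingEnd ℂ) (hu (tapEquiv L N i).1 y.1 x.1)
  simp only [map_mul, Complex.conj_ofReal, Complex.conj_conj] at h2
  simp only [Matrix.conjTranspose_apply, blockTap, Matrix.of_apply, map_mul, apply_ite star,
    star_zero, RCLike.star_def, Complex.conj_ofReal, Complex.ofReal_mul]
  split_ifs
  · linear_combination -a i * s * h1 - (starRingEnd ℂ) (a i) * s * h2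
  · linear_combination -a i * s * h1
  · linear_combination - (starRingEnd ℂ) (a i) * s * h2
  · ring

theorem blockResolvent_rotate (hw : 0 < w.im)
    (hu : ∀ l b c, (u b : ℂ) * T l b c * (starRingEnd ℂ) (u c : ℂ) = θ l * T l b c)
    (a : Fin (tapCard L N) → ℂ) (b c : B) :
    blockResolvent T s w (fun i => (θ (tapEquiv L N i).1 : ℂ) * a i) b c =
      u b * (starRingEnd ℂ) (u c : ℂ) * blockResolvent T s w a b c := by
  have hU : Matrix.diagonal (fun x : B × Fin N => (u x.1 : ℂ)) *
      (Matrix.diagonal (fun x : B × Fin N => (u x.1 : ℂ)))ᴴ = 1 := by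
    rw [Matrix.diagonal_conjTranspose, Matrix.diagonal_mul_diagonal, ← Matrix.diagonal_one]
    congr 1
    funext x
    simp [Complex.mul_conj]
  rw [blockResolvent, blockMatrix_rotate hu,
    matrixResolvent_conj (blockMatrix_isHermitian T s a) hw hU]
  simp only [blockResolvent, blockAvg, Matrix.of_apply, Matrix.diagonal_conjTranspose,
    Matrix.mul_diagonal, Matrix.diagonal_mul, Finset.mul_sum, Pi.star_apply, RCLike.star_def]
  refine Finset.sum_congr rfl fun r _ => ?_
  ring

theorem integral_rotate (θ : Fin L → Circle) {F : (Fin (tapCard L N) → ℂ) → ℂ}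
    (hF : Measurable F) :
    ∫ a, F (fun i => (θ (tapEquiv L N i).1 : ℂ) * a i) ∂(gaussianFamily (tapCard L N)) =
      ∫ a, F a ∂(gaussianFamily (tapCard L N)) := by
  have h1 : MeasurePreserving (fun (a : Fin (tapCard L N) → ℂ) i =>
      (θ (tapEquiv L N i).1 : ℂ) * a i) (gaussianFamily (tapCard L N))
      (gaussianFamily (tapCard L N)) :=
    measurePreserving_pi _ _ fun i => ⟨by fun_prop, map_circle_mul_stdComplexGaussian _⟩
  have h2 := integral_map h1.aemeasurable (f := F) hF.aestronglyMeasurable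
  rw [h1.map_eq] at h2
  exact h2.symm

/-- By rotation invariance, the off-diagonal block traces have mean zero. -/
theorem integral_blockResolvent_eq_zero (hw : 0 < w.im)
    (hu : ∀ l b c, (u b : ℂ) * T l b c * (starRingEnd ℂ) (u c : ℂ) = θ l * T l b c)
    {b c : B} (hbc : u b ≠ u c) :
    ∫ a, blockResolvent T s w a b c ∂(gaussianFamily (tapCard L N)) = 0 := by
  have h1 := integral_rotate θ (measurable_blockResolvent (T := T) (s := s) (N := N) hw b c)
  simp only [blockResolvent_rotate hw hu] at h1
  rw [integral_const_mul] at h1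
  have h2 : (u b : ℂ) * (starRingEnd ℂ) (u c : ℂ) ≠ 1 := fun h => hbc (by
    have h3 : (starRingEnd ℂ) (u c : ℂ) * u c = 1 := by
      rw [mul_comm, Complex.mul_conj]
      simp
    apply Circle.ext
    linear_combination (u c : ℂ) * h - (u b : ℂ) * h3)
  by_contra h0
  exact h2 (mul_right_cancel₀ h0 (by rw [h1, one_mul]))

/-- The matrix of the quadratic vector equation of the block model. -/
def blockS (T : Fin L → B → B → ℝ) (κ : ℝ) (b c : B) : ℝ := blockCov T κ b b c c

/-- The sum of the absolute values of all covariance coefficients. -/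
def blockCovNorm (T : Fin L → B → B → ℝ) (κ : ℝ) : ℝ :=
  ∑ b, ∑ k, ∑ e, ∑ f, ‖(blockCov T κ b k e f : ℂ)‖

/-- The expected block traces of the resolvent approximately solve the quadratic vector
equation. -/
theorem exists_isQVEApprox (hN : 1 ≤ N) (hw : 0 < w.im) (hs : s ^ 2 * N = κ)
    (hu : ∀ l b c, (u b : ℂ) * T l b c * (starRingEnd ℂ) (u c : ℂ) = θ l * T l b c)
    (hinj : Function.Injective u) :
    ∃ e, IsQVEApprox (blockS T κ) w
      (fun b => ∫ a, blockResolvent T s w a b b ∂(gaussianFamily (tapCard L N))) e ∧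
      ∀ b, ‖e b‖ ≤ blockCovNorm T κ * (blockVariance T κ w / N ^ 2) := by
  set m : B → ℂ := fun b => ∫ a, blockResolvent T s w a b b ∂(gaussianFamily (tapCard L N)) with hm
  have hκ : 0 ≤ κ := by rw [← hs]; positivity
  have hV : 0 ≤ blockVariance T κ w / N ^ 2 := by
    unfold blockVariance
    positivity
  refine ⟨fun b => w * m b - (1 + m b * ∑ c, blockS T κ b c * m c), ⟨fun b => ?_, fun b => ?_,
    fun b => by ring⟩, fun b => ?_⟩
  · have h1 := integral_im (integrable_blockResolvent (T := T) (s := s) hN hw b b)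
    simp only [RCLike.im_to_complex] at h1
    simp only [hm]
    rw [← h1]
    have h2 : 0 < ∫ a, -(blockResolvent T s w a b b).im ∂(gaussianFamily (tapCard L N)) := by
      rw [integral_pos_iff_support_of_nonneg (fun a => by
        have := blockResolvent_im_neg (T := T) (s := s) hN hw a b
        simp only [Pi.zero_apply]
        linarith)]
      · have : (Function.support fun a : Fin (tapCard L N) → ℂ =>
            -(blockResolvent T s w a b b).im) = Set.univ := by
          ext a
          have := blockResolvent_im_neg (T := T) (s := s) hN hw a b
          simp [this.ne]
        rw [this]
        simp
      · exact (integrable_blockResolvent hN hw b b).im.neg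
    rw [integral_neg] at h2
    linarith
  · exact norm_integral_le_of_bounded fun a => norm_blockResolvent_le hN hw a b b
  · have h1 := blockResolvent_loop (T := T) hN hw hs b b
    rw [if_pos rfl] at h1
    have h2 := integral_fourfold_sub_le (μ := gaussianFamily (tapCard L N))
      (g := blockResolvent T s w) (fun b c => measurable_blockResolvent hw b c)
      (fun a b c => norm_blockResolvent_le hN hw a b c)
      (fun b c => dispersion_blockResolvent_le hN hw hs b c)
      (fun b k e f => (blockCov T κ b k e f : ℂ)) b
    have h0 : ∀ b c, b ≠ c →
        ∫ a, blockResolvent T s w a b c ∂(gaussianFamily (tapCard L N)) = 0 := fun b c hbc =>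
      integral_blockResolvent_eq_zero hw hu (hinj.ne hbc)
    -- Off-diagonal means vanish, so only `k = b` and `e = f` survive; the loop equation closes on
    -- the diagonal.
    have h3 : ∑ k, (∑ e, ∑ f, (blockCov T κ b k e f : ℂ) *
        ∫ a, blockResolvent T s w a e f ∂(gaussianFamily (tapCard L N))) *
        ∫ a, blockResolvent T s w a k b ∂(gaussianFamily (tapCard L N)) =
        m b * ∑ c, blockS T κ b c * m c := by
      rw [Finset.sum_eq_single b (fun k _ hk => by rw [h0 k b hk, mul_zero]) (by simp), mul_comm]
      congr 1
      refine Finset.sum_congr rfl fun e _ => ?_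
      rw [Finset.sum_eq_single e (fun f _ hf => by rw [h0 e f hf.symm, mul_zero]) (by simp)]
      rfl
    rw [h3] at h2
    have h4 : w * m b - (1 + m b * ∑ c, blockS T κ b c * m c) =
        ∫ a, (∑ k, (∑ e, ∑ f, (blockCov T κ b k e f : ℂ) *
        blockResolvent T s w a e f) * blockResolvent T s w a k b)
        ∂(gaussianFamily (tapCard L N)) - m b * ∑ c, blockS T κ b c * m c := by
      simp only [hm] at h1 ⊢
      rw [h1]
      ring
    simp only
    rw [h4]
    refine h2.trans (mul_le_mul_of_nonneg_right ?_ hV)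
    exact Finset.single_le_sum (f := fun b => ∑ k, ∑ e, ∑ f, ‖(blockCov T κ b k e f : ℂ)‖)
      (fun b _ => by positivity) (Finset.mem_univ b)

end BlockResolvent
end

noncomputable section

/-! ### Almost sure convergence of the block traces. -/

section AlmostSure

variable {Ω : Type*} [MeasurableSpace Ω] {P : Measure Ω}

/-- A sequence of random variables with summable second moments tends to zero almost surely. -/
theorem ae_tendsto_zero_of_lintegral_sq_le {X : ℕ → Ω → ℂ} (hX : ∀ n, AEMeasurable (X n) P)
    {C : ℝ} (h : ∀ n, ∫⁻ ω, ‖X n ω‖ₑ ^ 2 ∂P ≤ ENNReal.ofReal (C / ((n : ℝ) + 1) ^ 2)) :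
    ∀ᵐ ω ∂P, Tendsto (fun n => X n ω) atTop (𝓝 0) := by
  have hsum : Summable fun n : ℕ => C / ((n : ℝ) + 1) ^ 2 := by
    have := (summable_nat_add_iff (f := fun n : ℕ => 1 / (n : ℝ) ^ 2) 1).2
      (Real.summable_one_div_nat_pow.2 one_lt_two)
    simpa [div_eq_mul_inv] using this.mul_left C
  have h1 : ∫⁻ ω, ∑' n, ‖X n ω‖ₑ ^ 2 ∂P ≠ ∞ := by
    rw [lintegral_tsum fun n => ((hX n).enorm.pow_const 2)]
    exact ne_top_of_le_ne_top hsum.tsum_ofReal_ne_top (ENNReal.tsum_le_tsum h)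
  filter_upwards [ae_lt_top' (AEMeasurable.tsum fun n => ((hX n).enorm.pow_const 2)) h1]
    with ω hω
  have h2 := ENNReal.tendsto_atTop_zero_of_tsum_ne_top hω.ne
  rw [tendsto_zero_iff_norm_tendsto_zero]
  have h3 : Tendsto (fun n => (‖X n ω‖ₑ ^ 2).toReal) atTop (𝓝 0) := by
    simpa [Function.comp_def] using (ENNReal.tendsto_toReal ENNReal.zero_ne_top).comp h2
  have h4 := h3.sqrt
  simpa using h4

/-- The vector of all entries of the taps. -/
def tapVector {L N : ℕ} (A : Fin L → Matrix (Fin N) (Fin N) ℂ) (i : Fin (tapCard L N)) : ℂ :=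
  A (tapEquiv L N i).1 (tapEquiv L N i).2.1 (tapEquiv L N i).2.2

theorem IsGaussianTaps.hasLaw {L N : ℕ} {A : Ω → Fin L → Matrix (Fin N) (Fin N) ℂ}
    (hA : IsGaussianTaps P A) :
    HasLaw (fun ω => tapVector (A ω)) (gaussianFamily (tapCard L N)) P :=
  iIndepFun.hasLaw_pi (X := fun i ω => tapVector (A ω) i) (fun _ => hA.law _ _ _)
    (hA.indep.precomp (tapEquiv L N).injective)

variable {B : Type*} [Fintype B] [DecidableEq B] {L : ℕ} {T : Fin L → B → B → ℝ} {κ : ℝ} {w : ℂ}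

/-- The variances are `O(N⁻²)`, hence summable, so only the law at each separate `N` enters. The
shift to `n + 1` excludes empty matrices. -/
theorem ae_tendsto_blockResolvent_sub_integral [IsProbabilityMeasure P]
    {A : (N : ℕ) → Ω → Fin L → Matrix (Fin N) (Fin N) ℂ} (hA : ∀ N, IsGaussianTaps P (A N))
    {s : ℕ → ℝ} (hs : ∀ N : ℕ, 1 ≤ N → s N ^ 2 * N = κ) (hw : 0 < w.im) (b c : B) :
    ∀ᵐ ω ∂P, Tendsto (fun n => blockResolvent T (s (n + 1)) w (tapVector (A (n + 1) ω)) b c -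
      ∫ a, blockResolvent T (s (n + 1)) w a b c ∂(gaussianFamily (tapCard L (n + 1))))
      atTop (𝓝 0) := by
  have hN : ∀ n : ℕ, 1 ≤ n + 1 := fun n => by omega
  refine ae_tendsto_zero_of_lintegral_sq_le (C := blockVariance T κ w) (fun n => ?_) fun n => ?_
  · exact ((measurable_blockResolvent hw b c).comp_aemeasurable
      (hA (n + 1)).hasLaw.aemeasurable).sub_const _
  · have h1 := dispersion_blockResolvent_le (T := T) (hN n) hw (hs (n + 1) (hN n)) b c
    set g : (Fin (tapCard L (n + 1)) → ℂ) → ℂ := fun a =>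
      blockResolvent T (s (n + 1)) w a b c with hg
    set m := ∫ a, g a ∂(gaussianFamily (tapCard L (n + 1))) with hm
    have hgm : Measurable g := measurable_blockResolvent hw b c
    have h2 : ∫⁻ ω, ‖g (tapVector (A (n + 1) ω)) - m‖ₑ ^ 2 ∂P =
        ∫⁻ a, ‖g a - m‖ₑ ^ 2 ∂(gaussianFamily (tapCard L (n + 1))) := by
      rw [← (hA (n + 1)).hasLaw.map_eq, lintegral_map' (by fun_prop)
        (hA (n + 1)).hasLaw.aemeasurable]
    have h3 : ∫⁻ a, ‖g a - m‖ₑ ^ 2 ∂(gaussianFamily (tapCard L (n + 1))) =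
        ENNReal.ofReal (dispersion (gaussianFamily (tapCard L (n + 1))) g) := by
      unfold dispersion
      rw [ofReal_integral_eq_lintegral_ofReal]
      · refine lintegral_congr fun a => ?_
        rw [← ofReal_norm, ENNReal.ofReal_pow (norm_nonneg _)]
      · refine integrable_of_bounded (C := (2 * (1 / w.im)) ^ 2) (by fun_prop) fun a => ?_
        rw [norm_pow, norm_norm]
        have h4 : ‖g a‖ ≤ 1 / w.im := norm_blockResolvent_le (hN n) hw a b c
        have h5 : ‖m‖ ≤ 1 / w.im := norm_integral_le_of_bounded fun a =>
          norm_blockResolvent_le (hN n) hw a b c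
        have h6 := norm_sub_le (g a) m
        gcongr
        linarith
      · exact ae_of_all _ fun a => by positivity
    rw [h2, h3]
    refine ENNReal.ofReal_le_ofReal (h1.trans (le_of_eq ?_))
    push_cast
    rfl

theorem norm_blockResolvent_sub_le {N : ℕ} {s : ℝ} {w' : ℂ} (hN : 1 ≤ N) (hw : 0 < w.im)
    (hw' : 0 < w'.im) (a : Fin (tapCard L N) → ℂ) (b c : B) :
    ‖blockResolvent T s w a b c - blockResolvent T s w' a b c‖ ≤
      ‖w - w'‖ / (w.im * w'.im) := by
  open scoped Matrix.Norms.L2Operator in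
  have hX := blockMatrix_isHermitian T s a
  have h1 : blockResolvent T s w a b c - blockResolvent T s w' a b c =
      blockAvg (matrixResolvent w (blockMatrix T s a) -
        matrixResolvent w' (blockMatrix T s a)) b c := by
    simp only [blockResolvent, blockAvg, Matrix.of_apply, Matrix.sub_apply,
      Finset.sum_sub_distrib, mul_sub]
  rw [h1]
  refine norm_blockAvg_le hN ?_ b c
  rw [matrixResolvent_sub hX hX hw hw', sub_self, add_zero, Matrix.mul_smul, Matrix.mul_one,
    Matrix.smul_mul]
  refine (norm_smul_le _ _).trans ?_
  rw [norm_sub_rev w' w, div_eq_mul_inv, mul_inv, ← one_div, ← one_div]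
  gcongr
  exact (norm_mul_le _ _).trans (mul_le_mul (norm_matrixResolvent_le hX hw)
    (norm_matrixResolvent_le hX hw') (norm_nonneg _) (by positivity))

/-- Pointwise convergence of Lipschitz functions on a countable dense set of the upper half plane
implies convergence everywhere. -/
theorem tendsto_of_dense_of_lipschitz {D : Set ℂ} (hD : Dense D) {g : ℕ → ℂ → ℂ} {m : ℂ → ℂ}
    (hg : ∀ n w w', 0 < w.im → 0 < w'.im → ‖g n w - g n w'‖ ≤ ‖w - w'‖ / (w.im * w'.im))
    (hm : ∀ w w', 0 < w.im → 0 < w'.im → ‖m w - m w'‖ ≤ ‖w - w'‖ / (w.im * w'.im))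
    (h : ∀ w ∈ D, 0 < w.im → Tendsto (fun n => g n w) atTop (𝓝 (m w))) (hw : 0 < w.im) :
    Tendsto (fun n => g n w) atTop (𝓝 (m w)) := by
  rw [Metric.tendsto_atTop]
  intro ε hε
  -- The first bound keeps `w'` at height at least `Im w / 2`; the second then makes both Lipschitz
  -- errors at most `ε / 4`.
  set δ := min (w.im / 2) (ε / 4 * (w.im * (w.im / 2))) with hδ
  have hδ0 : 0 < δ := by positivity
  obtain ⟨w', hw'D, hw'⟩ := hD.exists_dist_lt w hδ0
  rw [dist_eq_norm] at hw'
  have h1 : w.im / 2 < w'.im := by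
    have h2 := (abs_le.1 ((Complex.abs_im_le_norm (w - w')))).2
    rw [Complex.sub_im] at h2
    have h3 := hw'.trans_le (min_le_left _ _)
    linarith
  have h0 : 0 < w'.im := by linarith
  have h2 : ‖w - w'‖ / (w.im * w'.im) ≤ ε / 4 := by
    rw [div_le_iff₀ (by positivity)]
    refine (hw'.le.trans (min_le_right _ _)).trans ?_
    gcongr
  obtain ⟨n₀, hn₀⟩ := Metric.tendsto_atTop.1 (h w' hw'D h0) (ε / 4) (by positivity)
  refine ⟨n₀, fun n hn => ?_⟩
  have h3 := hn₀ n hn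
  rw [dist_eq_norm] at h3 ⊢
  have h4 := (hg n w w' hw h0).trans h2
  have h5 := (hm w w' hw h0).trans h2
  rw [norm_sub_rev] at h5
  calc ‖g n w - m w‖ = ‖(g n w - g n w') + (g n w' - m w') + (m w' - m w)‖ := by
        congr 1
        ring
    _ ≤ ‖g n w - g n w'‖ + ‖g n w' - m w'‖ + ‖m w' - m w‖ := norm_add₃_le
    _ < ε := by linarith

/-- The diagonal block traces of the resolvents converge almost surely to the solution of the
quadratic vector equation. -/
theorem exists_ae_tendsto_blockResolvent [IsProbabilityMeasure P]
    {A : (N : ℕ) → Ω → Fin L → Matrix (Fin N) (Fin N) ℂ} (hA : ∀ N, IsGaussianTaps P (A N))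
    {s : ℕ → ℝ} (hs : ∀ N : ℕ, 1 ≤ N → s N ^ 2 * N = κ) {u : B → Circle} {θ : Fin L → Circle}
    (hu : ∀ l b c, (u b : ℂ) * T l b c * (starRingEnd ℂ) (u c : ℂ) = θ l * T l b c)
    (hinj : Function.Injective u) (hS : ∀ b c, 0 ≤ blockS T κ b c) :
    ∃ m : ℂ → B → ℂ, (∀ w, 0 < w.im → IsQVESolution (blockS T κ) w (m w)) ∧
      ∀ᵐ ω ∂P, ∀ w, 0 < w.im → ∀ b, Tendsto (fun n =>
        blockResolvent T (s (n + 1)) w (tapVector (A (n + 1) ω)) b b) atTop (𝓝 (m w b)) := by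
  have hN : ∀ n : ℕ, 1 ≤ n + 1 := fun n => by omega
  have h1 : ∀ w : ℂ, ∃ m₀ : B → ℂ, 0 < w.im → IsQVESolution (blockS T κ) w m₀ ∧
      ∀ b, Tendsto (fun n => ∫ a, blockResolvent T (s (n + 1)) w a b b
        ∂(gaussianFamily (tapCard L (n + 1)))) atTop (𝓝 (m₀ b)) := by
    intro w
    by_cases hw : 0 < w.im
    · choose e he he' using fun n : ℕ =>
        exists_isQVEApprox (T := T) (hN n) hw (hs (n + 1) (hN n)) hu hinj
      obtain ⟨m₀, hm₀⟩ := exists_tendsto_isQVESolution he hS hw fun b => by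
        refine squeeze_zero_norm (fun n => he' n b) ?_
        have h2 : Tendsto (fun n : ℕ => (((n + 1 : ℕ) : ℝ)) ^ 2) atTop atTop :=
          (tendsto_pow_atTop two_ne_zero).comp
            (tendsto_natCast_atTop_atTop.comp (tendsto_add_atTop_nat 1))
        simpa using ((tendsto_const_nhds (x := blockVariance T κ w)).div_atTop h2).const_mul
          (blockCovNorm T κ)
      exact ⟨m₀, fun _ => hm₀⟩
    · exact ⟨0, fun h => absurd h hw⟩
  choose m hm using h1
  refine ⟨m, fun w hw => (hm w hw).1, ?_⟩
  have h2 : ∀ w, 0 < w.im → ∀ b, ∀ᵐ ω ∂P, Tendsto (fun n =>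
      blockResolvent T (s (n + 1)) w (tapVector (A (n + 1) ω)) b b) atTop (𝓝 (m w b)) := by
    intro w hw b
    filter_upwards [ae_tendsto_blockResolvent_sub_integral (T := T) hA hs hw b b] with ω hω
    simpa using hω.add ((hm w hw).2 b)
  -- A countable set of `w` is needed to have one exceptional null set; the Lipschitz bound, uniform
  -- in `N`, recovers every `w`.
  obtain ⟨D, hDc, hD⟩ := TopologicalSpace.exists_countable_dense ℂ
  have h3 : ∀ᵐ ω ∂P, ∀ w ∈ D, ∀ b, 0 < w.im → Tendsto (fun n =>
      blockResolvent T (s (n + 1)) w (tapVector (A (n + 1) ω)) b b) atTop (𝓝 (m w b)) := by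
    refine (ae_ball_iff hDc).2 fun w _ => ae_all_iff.2 fun b => ?_
    by_cases hw : 0 < w.im
    · simpa [hw] using h2 w hw b
    · simp [hw]
  filter_upwards [h3] with ω hω w hw b
  refine tendsto_of_dense_of_lipschitz hD (m := fun w => m w b)
    (g := fun n w => blockResolvent T (s (n + 1)) w (tapVector (A (n + 1) ω)) b b)
    (fun n w w' hw hw' => norm_blockResolvent_sub_le (hN n) hw hw' _ b b)
    (fun w w' hw hw' => ?_) (fun w hwD hw => hω w hwD b hw) hw
  -- The deterministic limit inherits the Lipschitz bound from any one sample that converges at both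
  -- points.
  obtain ⟨ω', hω', hω''⟩ := ((h2 w hw b).and (h2 w' hw' b)).exists
  exact le_of_tendsto (hω'.sub hω'').norm (Eventually.of_forall fun n =>
    norm_blockResolvent_sub_le (hN n) hw hw' _ b b)

end AlmostSure

end

noncomputable section

/-! ### Cauchy transforms, tightness and weak convergence. -/

section CauchyTransform

open scoped BoundedContinuousFunction

variable {μ : Measure ℝ} {z : ℂ}

theorem sub_ofReal_ne_zero (hz : z.im ≠ 0) (t : ℝ) : z - (t : ℂ) ≠ 0 := fun h => hz (by
  have := congrArg Complex.im h
  simpa using this)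

theorem norm_one_div_sub_le (hz : z.im ≠ 0) (t : ℝ) : ‖1 / (z - (t : ℂ))‖ ≤ 1 / |z.im| := by
  rw [norm_div, norm_one]
  refine one_div_le_one_div_of_le (abs_pos.2 hz) ?_
  have := Complex.abs_im_le_norm (z - (t : ℂ))
  simpa using this

theorem continuous_one_div_sub (hz : z.im ≠ 0) : Continuous fun t : ℝ => 1 / (z - (t : ℂ)) :=
  continuous_const.div (by fun_prop) (sub_ofReal_ne_zero hz)

/-- The kernel `1 / (z - t)` of the Cauchy transform. -/
def cauchyKernel (z : {z : ℂ // z.im ≠ 0}) : ℝ →ᵇ ℂ :=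
  BoundedContinuousFunction.ofNormedAddCommGroup (fun t : ℝ => 1 / ((z : ℂ) - (t : ℂ)))
    (continuous_one_div_sub z.2) (1 / |(z : ℂ).im|) (norm_one_div_sub_le z.2)

theorem cauchyKernel_apply (z : {z : ℂ // z.im ≠ 0}) (t : ℝ) :
    cauchyKernel z t = 1 / ((z : ℂ) - t) := rfl

theorem integrable_one_div_sub [IsFiniteMeasure μ] (hz : z.im ≠ 0) :
    Integrable (fun t : ℝ => 1 / (z - (t : ℂ))) μ :=
  (cauchyKernel ⟨z, hz⟩).integrable μ

theorem norm_cauchyKernel_le (z : {z : ℂ // z.im ≠ 0}) : ‖cauchyKernel z‖ ≤ 1 / |(z : ℂ).im| :=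
  BoundedContinuousFunction.norm_ofNormedAddCommGroup_le _ (by positivity) _

theorem cauchyKernel_sub (z w : {z : ℂ // z.im ≠ 0}) :
    cauchyKernel z - cauchyKernel w =
      ((w : ℂ) - z) • (cauchyKernel z * cauchyKernel w) := by
  ext t
  have h1 := sub_ofReal_ne_zero z.2 t
  have h2 := sub_ofReal_ne_zero w.2 t
  simp only [BoundedContinuousFunction.coe_sub, Pi.sub_apply, BoundedContinuousFunction.coe_smul,
    BoundedContinuousFunction.coe_mul, Pi.mul_apply, cauchyKernel_apply, smul_eq_mul]
  field_simp
  ring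

theorem tendsto_cauchyKernel_add (z : {z : ℂ // z.im ≠ 0}) :
    Tendsto (fun n : ℕ => cauchyKernel ⟨z + 1 / ((n : ℂ) + 1), by
      have : (1 / ((n : ℂ) + 1)) = ((1 / ((n : ℝ) + 1) : ℝ) : ℂ) := by push_cast; rfl
      rw [this, Complex.add_im, Complex.ofReal_im, add_zero]
      exact z.2⟩) atTop (𝓝 (cauchyKernel z)) := by
  rw [tendsto_iff_norm_sub_tendsto_zero]
  have h1 : Tendsto (fun n : ℕ => 1 / ((n : ℝ) + 1) * (1 / |(z : ℂ).im| * (1 / |(z : ℂ).im|)))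
      atTop (𝓝 0) := by
    simpa using tendsto_one_div_add_atTop_nhds_zero_nat.mul_const
      (1 / |(z : ℂ).im| * (1 / |(z : ℂ).im|))
  refine squeeze_zero (fun _ => norm_nonneg _) (fun n => ?_) h1
  have h0 : (1 / ((n : ℂ) + 1)) = ((1 / ((n : ℝ) + 1) : ℝ) : ℂ) := by push_cast; rfl
  rw [cauchyKernel_sub]
  refine (norm_smul_le _ _).trans ?_
  refine mul_le_mul (le_of_eq ?_) ((norm_mul_le _ _).trans
    (mul_le_mul ((norm_cauchyKernel_le _).trans (le_of_eq ?_)) (norm_cauchyKernel_le _)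
      (norm_nonneg _) (by positivity))) (norm_nonneg _) (by positivity)
  · rw [sub_add_cancel_left, norm_neg, h0, Complex.norm_real, Real.norm_of_nonneg (by positivity)]
  · simp only [h0, Complex.add_im, Complex.ofReal_im, add_zero]

/-- The closed span of the constants and the Cauchy kernels. -/
def cauchySpan : Submodule ℂ (ℝ →ᵇ ℂ) :=
  (Submodule.span ℂ (insert 1 (Set.range cauchyKernel))).topologicalClosure

theorem one_mem_cauchySpan : (1 : ℝ →ᵇ ℂ) ∈ cauchySpan :=
  Submodule.le_topologicalClosure _ (Submodule.subset_span (Set.mem_insert _ _))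

theorem cauchyKernel_mem_cauchySpan (z : {z : ℂ // z.im ≠ 0}) : cauchyKernel z ∈ cauchySpan :=
  Submodule.le_topologicalClosure _ (Submodule.subset_span (Set.mem_insert_of_mem _ ⟨z, rfl⟩))

theorem isClosed_cauchySpan : IsClosed (cauchySpan : Set (ℝ →ᵇ ℂ)) :=
  Submodule.isClosed_topologicalClosure _

theorem cauchyKernel_mul_mem_of_ne {z w : {z : ℂ // z.im ≠ 0}} (h : (z : ℂ) ≠ w) :
    cauchyKernel z * cauchyKernel w ∈ cauchySpan := by
  have h1 : cauchyKernel z * cauchyKernel w =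
      ((w : ℂ) - z)⁻¹ • (cauchyKernel z - cauchyKernel w) := by
    rw [cauchyKernel_sub, inv_smul_smul₀ (sub_ne_zero.2 h.symm)]
  rw [h1]
  exact cauchySpan.smul_mem _ (cauchySpan.sub_mem (cauchyKernel_mem_cauchySpan z)
    (cauchyKernel_mem_cauchySpan w))

/-- For distinct points the product is a combination of two kernels by partial fractions; the square
of a kernel is the uniform limit of its products with the kernels at `z + 1/(n + 1)`. -/
theorem cauchyKernel_mul_mem (z w : {z : ℂ // z.im ≠ 0}) :
    cauchyKernel z * cauchyKernel w ∈ cauchySpan := by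
  by_cases h : (z : ℂ) = w
  · have h' := Subtype.ext h
    subst h'
    refine isClosed_cauchySpan.mem_of_tendsto
      ((tendsto_cauchyKernel_add z).mul_const (cauchyKernel z))
      (Eventually.of_forall fun n => cauchyKernel_mul_mem_of_ne ?_)
    simp only [ne_eq, add_eq_left, one_div, inv_eq_zero]
    exact_mod_cast Nat.succ_ne_zero n
  · exact cauchyKernel_mul_mem_of_ne h

theorem mul_mem_cauchySpan {f g : ℝ →ᵇ ℂ} (hf : f ∈ cauchySpan) (hg : g ∈ cauchySpan) :
    f * g ∈ cauchySpan := by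
  have h1 : ∀ f ∈ Submodule.span ℂ (insert 1 (Set.range cauchyKernel)),
      ∀ g ∈ Submodule.span ℂ (insert 1 (Set.range cauchyKernel)), f * g ∈ cauchySpan := by
    intro f hf g hg
    induction hf using Submodule.span_induction with
    | mem f hf =>
      induction hg using Submodule.span_induction with
      | mem g hg =>
        obtain rfl | ⟨z, rfl⟩ := hf
        · rw [one_mul]
          exact Submodule.le_topologicalClosure _ (Submodule.subset_span hg)
        · obtain rfl | ⟨w, rfl⟩ := hg
          · rw [mul_one]
            exact cauchyKernel_mem_cauchySpan z
          · exact cauchyKernel_mul_mem z w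
      | zero => simp
      | add g g' _ _ hg hg' => rw [mul_add]; exact cauchySpan.add_mem hg hg'
      | smul c g _ hg => rw [mul_smul_comm]; exact cauchySpan.smul_mem c hg
    | zero => simp
    | add f f' _ _ hf hf' => rw [add_mul]; exact cauchySpan.add_mem hf hf'
    | smul c f _ hf => rw [smul_mul_assoc]; exact cauchySpan.smul_mem c hf
  have h2 := map_mem_closure₂ (f := fun f g : ℝ →ᵇ ℂ => f * g) continuous_mul hf hg
    (u := (cauchySpan : Set (ℝ →ᵇ ℂ))) fun f hf g hg => h1 f hf g hg
  rwa [isClosed_cauchySpan.closure_eq] at h2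

theorem star_mem_cauchySpan {f : ℝ →ᵇ ℂ} (hf : f ∈ cauchySpan) : star f ∈ cauchySpan := by
  have h1 : ∀ f ∈ Submodule.span ℂ (insert 1 (Set.range cauchyKernel)), star f ∈ cauchySpan := by
    intro f hf
    induction hf using Submodule.span_induction with
    | mem f hf =>
      obtain rfl | ⟨z, rfl⟩ := hf
      · rw [star_one]
        exact one_mem_cauchySpan
      · have : star (cauchyKernel z) = cauchyKernel ⟨(starRingEnd ℂ) z, by simpa using z.2⟩ := by
          ext t
          simp [cauchyKernel_apply]
        rw [this]
        exact cauchyKernel_mem_cauchySpan _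
    | zero => simp
    | add f f' _ _ hf hf' => rw [star_add]; exact cauchySpan.add_mem hf hf'
    | smul c f _ hf => rw [star_smul]; exact cauchySpan.smul_mem _ hf
  have h2 := map_mem_closure (f := fun f : ℝ →ᵇ ℂ => star f) continuous_star hf
    (t := (cauchySpan : Set (ℝ →ᵇ ℂ))) fun f hf => h1 f hf
  rwa [isClosed_cauchySpan.closure_eq] at h2

/-- The closed span of the constants and the Cauchy kernels is a star algebra. -/
def cauchyAlgebra : StarSubalgebra ℂ (ℝ →ᵇ ℂ) where
  carrier := cauchySpan
  mul_mem' := mul_mem_cauchySpan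
  add_mem' := cauchySpan.add_mem
  algebraMap_mem' c := by
    rw [Algebra.algebraMap_eq_smul_one]
    exact cauchySpan.smul_mem c one_mem_cauchySpan
  star_mem' := star_mem_cauchySpan

theorem separatesPoints_cauchyAlgebra :
    (cauchyAlgebra.map (BoundedContinuousFunction.toContinuousMapStarₐ ℂ)).SeparatesPoints := by
  intro s t hst
  refine ⟨_, ⟨_, ⟨cauchyKernel ⟨Complex.I, by simp⟩, cauchyKernel_mem_cauchySpan _, rfl⟩, rfl⟩,
    fun h => hst ?_⟩
  have h1 : 1 / (Complex.I - (s : ℂ)) = 1 / (Complex.I - (t : ℂ)) := h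
  rw [div_eq_div_iff (sub_ofReal_ne_zero (by simp) s) (sub_ofReal_ne_zero (by simp) t), one_mul,
    one_mul, sub_right_inj] at h1
  exact_mod_cast h1.symm

theorem cauchyTransform_conj (μ : Measure ℝ) (z : ℂ) :
    cauchyTransform μ ((starRingEnd ℂ) z) = (starRingEnd ℂ) (cauchyTransform μ z) := by
  unfold cauchyTransform
  rw [← integral_conj]
  congr 1 with t
  simp

/-- Conjugation supplies the kernels at points of the lower half plane. Uniform approximation then
passes to the closure, with an error uniform in `n` because all measures have mass one. -/
theorem tendsto_integral_of_mem_cauchySpan {μ : ℕ → ProbabilityMeasure ℝ}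
    {μ₀ : ProbabilityMeasure ℝ} (h : ∀ z : ℂ, 0 < z.im →
      Tendsto (fun n => cauchyTransform (μ n : Measure ℝ) z) atTop (𝓝 (cauchyTransform μ₀ z)))
    {g : ℝ →ᵇ ℂ} (hg : g ∈ cauchySpan) :
    Tendsto (fun n => ∫ x, g x ∂(μ n : Measure ℝ)) atTop (𝓝 (∫ x, g x ∂(μ₀ : Measure ℝ))) := by
  have h1 : ∀ g ∈ Submodule.span ℂ (insert 1 (Set.range cauchyKernel)),
      Tendsto (fun n => ∫ x, g x ∂(μ n : Measure ℝ)) atTop (𝓝 (∫ x, g x ∂(μ₀ : Measure ℝ))) := by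
    intro g hg
    induction hg using Submodule.span_induction with
    | mem g hg =>
      obtain rfl | ⟨z, rfl⟩ := hg
      · simp
      · rcases lt_or_gt_of_ne z.2 with hz | hz
        · have h2 := (Complex.continuous_conj.tendsto _).comp
            (h ((starRingEnd ℂ) z) (by simpa using hz))
          simp only [Function.comp_def, ← cauchyTransform_conj, Complex.conj_conj] at h2
          exact h2
        · exact h z hz
    | zero => simp
    | add f f' _ _ hf hf' =>
      simp only [BoundedContinuousFunction.coe_add, Pi.add_apply]
      simp_rw [integral_add (f.integrable _) (f'.integrable _)]
      exact hf.add hf'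
    | smul c f _ hf =>
      simp only [BoundedContinuousFunction.coe_smul]
      simp_rw [integral_smul]
      exact hf.const_smul c
  have hsub : ∀ (ν : ProbabilityMeasure ℝ) (f : ℝ →ᵇ ℂ),
      ‖∫ x, g x ∂(ν : Measure ℝ) - ∫ x, f x ∂(ν : Measure ℝ)‖ ≤ ‖g - f‖ := fun ν f => by
    rw [← integral_sub (g.integrable _) (f.integrable _)]
    exact norm_integral_le_of_bounded fun x => (g - f).norm_coe_le_norm x
  rw [Metric.tendsto_atTop]
  intro ε hε
  obtain ⟨f, hf, hfg⟩ := Metric.mem_closure_iff.1 (show g ∈ closure _ from hg) (ε / 3)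
    (by positivity)
  rw [dist_eq_norm] at hfg
  obtain ⟨n₀, hn₀⟩ := Metric.tendsto_atTop.1 (h1 f hf) (ε / 3) (by positivity)
  refine ⟨n₀, fun n hn => ?_⟩
  have h3 := hn₀ n hn
  rw [dist_eq_norm] at h3 ⊢
  have h4 := hsub (μ n) f
  have h5 := hsub μ₀ f
  rw [norm_sub_rev] at h5
  calc ‖∫ x, g x ∂(μ n : Measure ℝ) - ∫ x, g x ∂(μ₀ : Measure ℝ)‖
      = ‖(∫ x, g x ∂(μ n : Measure ℝ) - ∫ x, f x ∂(μ n : Measure ℝ)) +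
        (∫ x, f x ∂(μ n : Measure ℝ) - ∫ x, f x ∂(μ₀ : Measure ℝ)) +
        (∫ x, f x ∂(μ₀ : Measure ℝ) - ∫ x, g x ∂(μ₀ : Measure ℝ))‖ := by
        congr 1
        ring
    _ ≤ _ := norm_add₃_le
    _ < ε := by linarith

/-- At `z = iy` the real part of `1 - z/(z - t)` is `t²/(y² + t²)`, which is at least `1/2` for `|t|
≥ y`; so the Cauchy transform on the imaginary axis controls tails. -/
theorem one_sub_re_cauchyTransform [IsProbabilityMeasure μ] {y : ℝ} (hy : 0 < y) :
    1 - ((y * Complex.I) * cauchyTransform μ (y * Complex.I)).re =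
      ∫ t : ℝ, t ^ 2 / (y ^ 2 + t ^ 2) ∂μ := by
  have hz : (y * Complex.I : ℂ).im ≠ 0 := by simp [hy.ne']
  have h1 : (∫ t : ℝ, (1 - (y * Complex.I) * (1 / (y * Complex.I - (t : ℂ)))) ∂μ) =
      1 - (y * Complex.I) * cauchyTransform μ (y * Complex.I) := by
    rw [integral_sub (integrable_const _) ((integrable_one_div_sub hz).const_mul _),
      integral_const_mul]
    simp [cauchyTransform]
  have h2 := integral_re ((integrable_const (1 : ℂ)).sub
    ((integrable_one_div_sub (μ := μ) hz).const_mul (y * Complex.I)))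
  have h3 := congrArg Complex.re h1
  simp only [Pi.sub_apply, RCLike.re_to_complex] at h2
  rw [← h2, Complex.sub_re, Complex.one_re] at h3
  rw [← h3]
  congr 1 with t
  have h4 : (y : ℂ) * Complex.I - t ≠ 0 := sub_ofReal_ne_zero hz t
  have h5 : (1 : ℂ) - y * Complex.I * (1 / (y * Complex.I - t)) =
      ((t ^ 2 / (y ^ 2 + t ^ 2) : ℝ) : ℂ) + ((y * t / (y ^ 2 + t ^ 2) : ℝ) : ℂ) * Complex.I := by
    have h6 : ((y : ℂ) ^ 2 + t ^ 2) ≠ 0 := by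
      have : 0 < y ^ 2 + t ^ 2 := by positivity
      exact_mod_cast this.ne'
    push_cast
    field_simp
    linear_combination (-(y : ℂ) * t) * Complex.I_sq * y
  rw [h5, Complex.add_re, Complex.re_ofReal_mul, Complex.ofReal_re, Complex.I_re, mul_zero,
    add_zero]

/-- The tail of a probability measure is controlled by its Cauchy transform. -/
theorem measure_norm_gt_le [IsProbabilityMeasure μ] {y : ℝ} (hy : 0 < y) :
    μ {t | y < ‖t‖} ≤ ENNReal.ofReal
      (2 * (1 - ((y * Complex.I) * cauchyTransform μ (y * Complex.I)).re)) := by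
  rw [one_sub_re_cauchyTransform hy]
  have hc : Continuous fun t : ℝ => t ^ 2 / (y ^ 2 + t ^ 2) :=
    (continuous_pow 2).div (by fun_prop) fun t => by positivity
  have hi : Integrable (fun t : ℝ => t ^ 2 / (y ^ 2 + t ^ 2)) μ := by
    refine integrable_of_bounded (C := 1) hc.measurable fun t => ?_
    rw [Real.norm_of_nonneg (by positivity), div_le_one (by positivity)]
    nlinarith
  have h1 := mul_meas_ge_le_integral_of_nonneg (μ := μ)
    (f := fun t : ℝ => t ^ 2 / (y ^ 2 + t ^ 2)) (ae_of_all _ fun t => by positivity) hi (1 / 2)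
  have h2 : {t : ℝ | y < ‖t‖} ⊆ {t : ℝ | 1 / 2 ≤ t ^ 2 / (y ^ 2 + t ^ 2)} := fun t ht => by
    have h3 : y ^ 2 ≤ t ^ 2 := by
      rw [← sq_abs t]
      exact pow_le_pow_left₀ hy.le (le_of_lt ht) 2
    simp only [Set.mem_ofPred_eq]
    rw [le_div_iff₀ (by positivity)]
    linarith
  refine (measure_mono h2).trans ?_
  rw [← ofReal_measureReal]
  refine ENNReal.ofReal_le_ofReal ?_
  linarith

theorem isTightMeasureSet_of_cauchyTransform {μ : ℕ → ProbabilityMeasure ℝ} {m : ℂ → ℂ}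
    (h : ∀ z : ℂ, 0 < z.im →
      Tendsto (fun n => cauchyTransform (μ n : Measure ℝ) z) atTop (𝓝 (m z)))
    (hm : Tendsto (fun y : ℝ => (y * Complex.I) * m (y * Complex.I)) atTop (𝓝 1)) :
    IsTightMeasureSet {(μ n : Measure ℝ) | n} := by
  refine isTightMeasureSet_range_of_tendsto_limsup_measure_norm_gt
    (μ := fun n => (μ n : Measure ℝ)) ?_
  have h1 : Tendsto (fun y : ℝ => ENNReal.ofReal
      (2 * (1 - ((y * Complex.I) * m (y * Complex.I)).re))) atTop (𝓝 0) := by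
    have h2 := ((Complex.continuous_re.tendsto _).comp hm).const_sub 1
    simpa using ENNReal.tendsto_ofReal (h2.const_mul 2)
  refine tendsto_of_tendsto_of_tendsto_of_le_of_le' tendsto_const_nhds h1
    (Eventually.of_forall fun _ => zero_le) ?_
  filter_upwards [eventually_gt_atTop 0] with y hy
  have h3 : Tendsto (fun n => ENNReal.ofReal (2 * (1 - ((y * Complex.I) *
      cauchyTransform (μ n : Measure ℝ) (y * Complex.I)).re))) atTop
      (𝓝 (ENNReal.ofReal (2 * (1 - ((y * Complex.I) * m (y * Complex.I)).re)))) := by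
    refine ENNReal.tendsto_ofReal (Tendsto.const_mul 2 (Tendsto.const_sub 1 ?_))
    exact (Complex.continuous_re.tendsto _).comp
      ((h (y * Complex.I) (by simpa using hy)).const_mul _)
  rw [← h3.limsup_eq]
  exact limsup_le_limsup (Eventually.of_forall fun n => measure_norm_gt_le hy)

/-- Convergence of Cauchy transforms to the Cauchy transform of a probability measure implies
weak convergence. -/
theorem tendsto_of_tendsto_cauchyTransform {μ : ℕ → ProbabilityMeasure ℝ}
    {μ₀ : ProbabilityMeasure ℝ} (h : ∀ z : ℂ, 0 < z.im →
      Tendsto (fun n => cauchyTransform (μ n : Measure ℝ) z) atTop (𝓝 (cauchyTransform μ₀ z)))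
    (hm : Tendsto (fun y : ℝ => (y * Complex.I) * cauchyTransform μ₀ (y * Complex.I))
      atTop (𝓝 1)) : Tendsto μ atTop (𝓝 μ₀) :=
  ProbabilityMeasure.tendsto_of_tight_of_separatesPoints ℂ
    (isTightMeasureSet_of_cauchyTransform h hm) separatesPoints_cauchyAlgebra
    fun _ hg => tendsto_integral_of_mem_cauchySpan h hg

/-- A limit of Cauchy transforms of probability measures is the Cauchy transform of a probability
measure, if it has the right behaviour at infinity. -/
theorem exists_cauchyTransform_eq {μ : ℕ → ProbabilityMeasure ℝ} {m : ℂ → ℂ}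
    (h : ∀ z : ℂ, 0 < z.im →
      Tendsto (fun n => cauchyTransform (μ n : Measure ℝ) z) atTop (𝓝 (m z)))
    (hm : Tendsto (fun y : ℝ => (y * Complex.I) * m (y * Complex.I)) atTop (𝓝 1)) :
    ∃ μ₀ : ProbabilityMeasure ℝ, ∀ z : ℂ, 0 < z.im → cauchyTransform μ₀ z = m z := by
  have h_compact : IsCompact (closure {μ n | n}) :=
    isCompact_closure_of_isTightMeasureSet
      (by simpa using isTightMeasureSet_of_cauchyTransform h hm)
  -- A limit along a nonprincipal ultrafilter replaces the extraction of a subsequence; integrating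
  -- Cauchy kernels identifies its transform with `m`.
  set U : Ultrafilter ℕ := Filter.hyperfilter ℕ
  have hU : (U : Filter ℕ) ≤ atTop := Nat.hyperfilter_le_atTop
  obtain ⟨μ₀, -, hμ₀ : Tendsto _ _ _⟩ := h_compact.ultrafilter_le_nhds (U.map μ)
    (.trans (by simp) (monotone_principal subset_closure))
  refine ⟨μ₀, fun z hz => ?_⟩
  have h1 : Tendsto μ U (𝓝 μ₀) := hμ₀
  rw [ProbabilityMeasure.tendsto_iff_forall_integral_rclike_tendsto ℂ] at h1
  exact tendsto_nhds_unique (h1 (cauchyKernel ⟨z, hz.ne'⟩)) ((h z hz).mono_left hU)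

end CauchyTransform

end

noncomputable section

/-! ### Spectral measures of Hermitian matrices. -/

section SpectralMeasure

variable {ι : Type*} [Fintype ι] [DecidableEq ι] {X : Matrix ι ι ℂ} {w : ℂ}

theorem matrixResolvent_diagonal (c : ι → ℝ) (hw : 0 < w.im) :
    matrixResolvent w (Matrix.diagonal fun i => (c i : ℂ)) =
      Matrix.diagonal fun i => 1 / (w - c i) := by
  refine Matrix.inv_eq_right_inv ?_
  rw [← Matrix.diagonal_one, ← Matrix.diagonal_smul, Matrix.diagonal_sub,
    Matrix.diagonal_mul_diagonal]
  congr 1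
  funext i
  have := sub_ofReal_ne_zero hw.ne' (c i)
  simp only [Pi.smul_apply, smul_eq_mul, mul_one]
  field_simp

theorem eigenvectorUnitary_mul_conjTranspose (hX : X.IsHermitian) :
    (hX.eigenvectorUnitary : Matrix ι ι ℂ) * (hX.eigenvectorUnitary : Matrix ι ι ℂ)ᴴ = 1 :=
  Unitary.coe_mul_star_self _

theorem matrixResolvent_eq_diagonal (hX : X.IsHermitian) (hw : 0 < w.im) :
    matrixResolvent w X = (hX.eigenvectorUnitary : Matrix ι ι ℂ) *
      Matrix.diagonal (fun i => 1 / (w - hX.eigenvalues i)) *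
        (hX.eigenvectorUnitary : Matrix ι ι ℂ)ᴴ := by
  have h1 : X = (hX.eigenvectorUnitary : Matrix ι ι ℂ) *
      Matrix.diagonal (fun i => (hX.eigenvalues i : ℂ)) *
        (hX.eigenvectorUnitary : Matrix ι ι ℂ)ᴴ := hX.spectral_theorem
  have hD : (Matrix.diagonal fun i => (hX.eigenvalues i : ℂ)).IsHermitian := by
    rw [Matrix.IsHermitian, Matrix.diagonal_conjTranspose]
    congr 1
    funext i
    simp
  have h2 := matrixResolvent_conj hD hw (eigenvectorUnitary_mul_conjTranspose hX)
  rwa [← h1, matrixResolvent_diagonal _ hw] at h2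

theorem matrixResolvent_apply_self (hX : X.IsHermitian) (hw : 0 < w.im) (x : ι) :
    matrixResolvent w X x x = ∑ i, (‖(hX.eigenvectorUnitary : Matrix ι ι ℂ) x i‖ ^ 2 : ℝ) *
      (1 / (w - hX.eigenvalues i)) := by
  rw [matrixResolvent_eq_diagonal hX hw, Matrix.mul_apply]
  refine Finset.sum_congr rfl fun i _ => ?_
  rw [Matrix.mul_diagonal, Matrix.conjTranspose_apply, RCLike.star_def, mul_right_comm,
    Complex.mul_conj, Complex.normSq_eq_norm_sq]

theorem sum_norm_sq_eigenvectorUnitary (hX : X.IsHermitian) (x : ι) :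
    ∑ i, ‖(hX.eigenvectorUnitary : Matrix ι ι ℂ) x i‖ ^ 2 = 1 := by
  have h1 := congrFun (congrFun (eigenvectorUnitary_mul_conjTranspose hX) x) x
  rw [Matrix.mul_apply, Matrix.one_apply_eq] at h1
  simp only [Matrix.conjTranspose_apply, RCLike.star_def, Complex.mul_conj,
    Complex.normSq_eq_norm_sq] at h1
  exact_mod_cast h1

theorem trace_matrixResolvent (hX : X.IsHermitian) (hw : 0 < w.im) :
    (matrixResolvent w X).trace = ∑ i, 1 / (w - hX.eigenvalues i) := by
  rw [matrixResolvent_eq_diagonal hX hw, Matrix.trace_mul_comm, ← Matrix.mul_assoc,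
    mul_eq_one_comm.1 (eigenvectorUnitary_mul_conjTranspose hX), Matrix.one_mul,
    Matrix.trace_diagonal]

omit [DecidableEq ι] in
/-- A finite convex combination of Dirac masses and its Cauchy transform. -/
theorem exists_probabilityMeasure_cauchyTransform_eq (p c : ι → ℝ) (hp : ∀ i, 0 ≤ p i)
    (hp1 : ∑ i, p i = 1) : ∃ μ : ProbabilityMeasure ℝ, ∀ w : ℂ, 0 < w.im →
      cauchyTransform μ w = ∑ i, p i * (1 / (w - c i)) := by
  set μ : Measure ℝ := ∑ i, ENNReal.ofReal (p i) • Measure.dirac (c i) with hμ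
  have hprob : IsProbabilityMeasure μ := ⟨by
    simp only [hμ, Measure.coe_finsetSum, Finset.sum_apply, Measure.smul_apply, measure_univ,
      smul_eq_mul, mul_one]
    rw [← ENNReal.ofReal_sum_of_nonneg fun i _ => hp i, hp1, ENNReal.ofReal_one]⟩
  refine ⟨⟨μ, hprob⟩, fun w hw => ?_⟩
  simp only [cauchyTransform, ProbabilityMeasure.coe_mk, hμ]
  rw [integral_finsetSum_measure fun i _ => (integrable_one_div_sub hw.ne').smul_measure
    ENNReal.ofReal_ne_top]
  refine Finset.sum_congr rfl fun i _ => ?_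
  rw [integral_smul_measure, integral_dirac, ENNReal.toReal_ofReal (hp i), Complex.real_smul]

/-- By the spectral theorem, the measure puts at each eigenvalue the mean over `r` of the squared
`(b, r)` coordinate of the eigenvector. The weights sum to one since the rows of the unitary are
unit vectors. -/
theorem exists_cauchyTransform_eq_blockAvg {B : Type*} [Fintype B] [DecidableEq B] {N : ℕ}
    (hN : 1 ≤ N) {X : Matrix (B × Fin N) (B × Fin N) ℂ} (hX : X.IsHermitian) (b : B) :
    ∃ μ : ProbabilityMeasure ℝ, ∀ w : ℂ, 0 < w.im →
      cauchyTransform μ w = blockAvg (matrixResolvent w X) b b := by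
  have hN' : (N : ℝ) ≠ 0 := by exact_mod_cast (by omega : N ≠ 0)
  obtain ⟨μ, hμ⟩ := exists_probabilityMeasure_cauchyTransform_eq
    (fun i => 1 / (N : ℝ) * ∑ r : Fin N,
      ‖(hX.eigenvectorUnitary : Matrix (B × Fin N) (B × Fin N) ℂ) (b, r) i‖ ^ 2)
    hX.eigenvalues (fun i => by positivity) (by
      rw [← Finset.mul_sum, Finset.sum_comm]
      simp only [sum_norm_sq_eigenvectorUnitary hX]
      simp [hN'])
  refine ⟨μ, fun w hw => (hμ w hw).trans ?_⟩
  simp only [blockAvg, Matrix.of_apply, matrixResolvent_apply_self hX hw]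
  rw [Finset.sum_comm, Finset.mul_sum]
  refine Finset.sum_congr rfl fun i _ => ?_
  rw [← Finset.sum_mul]
  push_cast
  ring

theorem spectralLaw_toMeasure (hX : X.IsHermitian) : (spectralLaw hX : Measure ℝ) =
    (Fintype.card ι : ℝ≥0)⁻¹ • ∑ i, Measure.dirac (hX.eigenvalues i) := by
  rw [spectralLaw, FiniteMeasure.toMeasure_smul, FiniteMeasure.toMeasure_sum]
  rfl

theorem isProbabilityMeasure_spectralLaw [Nonempty ι] (hX : X.IsHermitian) :
    IsProbabilityMeasure (spectralLaw hX : Measure ℝ) := ⟨by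
  rw [spectralLaw_toMeasure]
  simp only [Measure.smul_apply, Measure.coe_finsetSum, Finset.sum_apply, measure_univ,
    Finset.sum_const, Finset.card_univ, nsmul_eq_mul, mul_one]
  rw [ENNReal.smul_def, smul_eq_mul, ENNReal.coe_inv (by simp), ENNReal.coe_natCast]
  exact ENNReal.inv_mul_cancel (by simp) (by simp)⟩

theorem cauchyTransform_spectralLaw (hX : X.IsHermitian) (hw : 0 < w.im) :
    cauchyTransform (spectralLaw hX : Measure ℝ) w =
      1 / (Fintype.card ι : ℂ) * (matrixResolvent w X).trace := by
  rw [trace_matrixResolvent hX hw, spectralLaw_toMeasure, cauchyTransform,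
    integral_smul_nnreal_measure,
    integral_finsetSum_measure fun i _ => integrable_one_div_sub hw.ne']
  simp only [integral_dirac]
  rw [NNReal.smul_def, Complex.real_smul]
  simp

end SpectralMeasure

/-! ### The image of a law under squaring. -/

section SquareLaw

variable {μ : Measure ℝ} {w : ℂ}

/-- Partial fractions: `1/(w² - t²) = (1/(w - t) - 1/(-w - t))/(2w)`. The value at `-w` is rewritten
by conjugation as one at `-conj w`, back in the upper half plane. -/
theorem cauchyTransform_map_sq (hw : 0 < w.im) (hw2 : 0 < (w ^ 2).im) [IsFiniteMeasure μ] :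
    cauchyTransform (μ.map fun t => t ^ 2) (w ^ 2) =
      1 / (2 * w) * (cauchyTransform μ w -
        (starRingEnd ℂ) (cauchyTransform μ (-(starRingEnd ℂ) w))) := by
  have hw0 : w ≠ 0 := fun h => by simp [h] at hw
  have h1 : (-w).im ≠ 0 := by simpa using hw.ne'
  rw [← cauchyTransform_conj, map_neg, Complex.conj_conj]
  unfold cauchyTransform
  rw [integral_map (by fun_prop) (continuous_one_div_sub hw2.ne').aestronglyMeasurable,
    ← integral_sub (integrable_one_div_sub hw.ne') (integrable_one_div_sub h1),
    ← integral_const_mul]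
  congr 1 with t
  have h2 := sub_ofReal_ne_zero hw.ne' t
  have h3 := sub_ofReal_ne_zero h1 t
  have h4 : w ^ 2 - (t : ℂ) ^ 2 ≠ 0 := by
    have := mul_ne_zero h2 h3
    intro h
    apply this
    linear_combination -h
  push_cast
  field_simp
  ring

end SquareLaw

end

noncomputable section

/-! ### Absolute continuity from bounds on the Cauchy transform. -/

section AbsolutelyContinuous

variable {μ : Measure ℝ}

/-- The negated imaginary part of the kernel at `x + ir` is the Poisson kernel `r/((x - t)² + r²)`,
at least `1/(2r)` on the ball. -/
theorem measure_closedBall_le_cauchyTransform [IsProbabilityMeasure μ] (x : ℝ) {r : ℝ}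
    (hr : 0 < r) : μ (Metric.closedBall x r) ≤
      ENNReal.ofReal (2 * r * ‖cauchyTransform μ (x + r * Complex.I)‖) := by
  have hz : (x + r * Complex.I : ℂ).im ≠ 0 := by simp [hr.ne']
  have him : ∀ t : ℝ, -(1 / (x + r * Complex.I - (t : ℂ))).im = r / ((x - t) ^ 2 + r ^ 2) := by
    intro t
    rw [one_div, Complex.inv_im, Complex.normSq_apply]
    simp
    ring
  have hi := (integrable_one_div_sub (μ := μ) hz).im.neg
  have h1 := mul_meas_ge_le_integral_of_nonneg (μ := μ)
    (f := fun t : ℝ => -(1 / (x + r * Complex.I - (t : ℂ))).im)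
    (ae_of_all _ fun t => by
      simp only [Pi.zero_apply]
      rw [him]
      positivity) hi (1 / (2 * r))
  have h2 : Metric.closedBall x r ⊆
      {t : ℝ | 1 / (2 * r) ≤ -(1 / (x + r * Complex.I - (t : ℂ))).im} := fun t ht => by
    rw [Metric.mem_closedBall, Real.dist_eq, abs_sub_comm] at ht
    simp only [Set.mem_ofPred_eq]
    rw [him, div_le_div_iff₀ (by positivity) (by positivity)]
    have := pow_le_pow_left₀ (abs_nonneg _) ht 2
    rw [sq_abs] at this
    nlinarith
  refine (measure_mono h2).trans ?_
  rw [← ofReal_measureReal]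
  refine ENNReal.ofReal_le_ofReal ?_
  have h3 : ∫ t : ℝ, -(1 / (x + r * Complex.I - (t : ℂ))).im ∂μ ≤
      ‖cauchyTransform μ (x + r * Complex.I)‖ := by
    rw [integral_neg]
    have h4 := integral_im (integrable_one_div_sub (μ := μ) hz)
    simp only [RCLike.im_to_complex] at h4
    rw [h4]
    exact (neg_le_abs _).trans (Complex.abs_im_le_norm _)
  have h5 := h1.trans h3
  have h6 := mul_le_mul_of_nonneg_left h5 (by positivity : 0 ≤ 2 * r)
  rwa [← mul_assoc, mul_one_div_cancel (by positivity), one_mul] at h6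

/-- A probability measure without atom at zero whose Cauchy transform is `O(1 / |z|)` is
absolutely continuous. -/
theorem absolutelyContinuous_of_norm_cauchyTransform_le [IsProbabilityMeasure μ] {C : ℝ}
    (hC : ∀ z : ℂ, 0 < z.im → ‖cauchyTransform μ z‖ ≤ C / ‖z‖) (h0 : μ {0} = 0) :
    μ ≪ volume := by
  have hC0 : 0 ≤ C := by
    have := (norm_nonneg _).trans (hC Complex.I (by simp))
    simpa using this
  refine Measure.AbsolutelyContinuous.mk fun s _ hs => ?_
  have h1 : ∀ n : ℕ, μ (s ∩ {x | 1 / ((n : ℝ) + 1) ≤ |x|}) = 0 := by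
    intro n
    have h2 : μ (s ∩ {x | 1 / ((n : ℝ) + 1) ≤ |x|}) ≤
        ((C * (n + 1)).toNNReal • (volume : Measure ℝ)) (s ∩ {x | 1 / ((n : ℝ) + 1) ≤ |x|}) := by
      -- Around a point with `|x| ≥ 1/(n + 1)` every ball has `μ`-mass at most `C (n + 1)` times its
      -- length; Besicovitch differentiation turns this into a comparison of measures on the set.
      refine (Besicovitch.vitaliFamily μ).measure_le_of_frequently_le _
        Measure.AbsolutelyContinuous.rfl _ fun x hx => ?_
      refine (Besicovitch.tendsto_filterAt μ x).frequently (Eventually.frequently ?_)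
      filter_upwards [self_mem_nhdsWithin] with r hr
      have hr : 0 < r := hr
      refine (measure_closedBall_le_cauchyTransform x hr).trans ?_
      rw [Measure.smul_apply, Real.volume_closedBall, ENNReal.smul_def, smul_eq_mul]
      change _ ≤ ENNReal.ofReal (C * (n + 1)) * _
      rw [← ENNReal.ofReal_mul (by positivity)]
      refine ENNReal.ofReal_le_ofReal ?_
      rw [mul_comm]
      refine mul_le_mul_of_nonneg_right ((hC _ (by simpa using hr)).trans ?_) (by positivity)
      have h3 : 1 / ((n : ℝ) + 1) ≤ ‖(x + r * Complex.I : ℂ)‖ := by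
        refine hx.2.trans ?_
        have := Complex.abs_re_le_norm (x + r * Complex.I : ℂ)
        simpa using this
      have h4 : 0 < 1 / ((n : ℝ) + 1) := by positivity
      calc C / ‖(x + r * Complex.I : ℂ)‖ ≤ C / (1 / ((n : ℝ) + 1)) := by gcongr
        _ = C * (n + 1) := by field_simp
    refine le_antisymm (h2.trans ?_) zero_le
    rw [Measure.smul_apply, measure_mono_null Set.inter_subset_left hs, smul_zero]
  refine measure_mono_null (t := {0} ∪ ⋃ n : ℕ, s ∩ {x | 1 / ((n : ℝ) + 1) ≤ |x|}) ?_
    (measure_union_null h0 (measure_iUnion_null h1))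
  intro x hx
  by_cases hx0 : x = 0
  · exact Or.inl hx0
  · obtain ⟨n, hn⟩ := exists_nat_one_div_lt (abs_pos.2 hx0)
    exact Or.inr (Set.mem_iUnion.2 ⟨n, hx, hn.le⟩)

/-- The mass at zero is determined by the Cauchy transform near zero. -/
theorem tendsto_mul_cauchyTransform_zero [IsProbabilityMeasure μ] :
    Tendsto (fun s : ℝ => (s * Complex.I) * cauchyTransform μ (s * Complex.I)) (𝓝[>] 0)
      (𝓝 (μ.real {0} : ℂ)) := by
  have h1 : ((μ.real {0} : ℝ) : ℂ) = ∫ t, Set.indicator {(0 : ℝ)} (fun _ => (1 : ℂ)) t ∂μ := by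
    rw [integral_indicator (measurableSet_singleton 0)]
    simp [measureReal_def]
  rw [h1]
  simp only [cauchyTransform, ← integral_const_mul]
  refine tendsto_integral_filter_of_dominated_convergence (fun _ => (1 : ℝ)) ?_ ?_
    (integrable_const _) (ae_of_all _ fun t => ?_)
  · filter_upwards [self_mem_nhdsWithin] with s hs
    have hs : 0 < s := hs
    exact ((continuous_one_div_sub (by simp [hs.ne'])).const_mul _).aestronglyMeasurable
  · filter_upwards [self_mem_nhdsWithin] with s hs
    have hs : 0 < s := hs
    refine ae_of_all _ fun t => ?_
    rw [norm_mul]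
    have h2 := norm_one_div_sub_le (z := s * Complex.I) (by simp [hs.ne']) t
    have h3 : ‖(s * Complex.I : ℂ)‖ = s := by simp [hs.le]
    have h4 : |(s * Complex.I : ℂ).im| = s := by simp [hs.le]
    rw [h4] at h2
    rw [h3]
    calc s * _ ≤ s * (1 / s) := by gcongr
      _ = 1 := by field_simp
  · by_cases ht : t = 0
    · subst ht
      simp only [Set.mem_singleton_iff, Set.indicator_of_mem]
      refine tendsto_const_nhds.congr' ?_
      filter_upwards [self_mem_nhdsWithin] with s hs
      have hs : 0 < s := hs
      have : (s * Complex.I : ℂ) ≠ 0 := by simp [hs.ne']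
      simp only [Complex.ofReal_zero, sub_zero]
      rw [mul_one_div_cancel this]
    · have h2 : Set.indicator {(0 : ℝ)} (fun _ => (1 : ℂ)) t = 0 := by simp [ht]
      rw [h2]
      have h3 : ContinuousAt (fun s : ℝ => (s * Complex.I : ℂ) * (1 / (s * Complex.I - t))) 0 := by
        refine ContinuousAt.mul (by fun_prop) (ContinuousAt.div (by fun_prop) (by fun_prop) ?_)
        simpa using ht
      have h4 := h3.tendsto.mono_left (nhdsWithin_le_nhds (s := Set.Ioi 0))
      simpa using h4

end AbsolutelyContinuous

/-! ### Excluding atoms at zero by a matching. -/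

section Atoms

variable {B : Type*} [Fintype B] [DecidableEq B]

/-- A counting argument which excludes atoms at zero for those indices that have a matching. -/
theorem atom_eq_zero_of_matching {S : B → B → ℝ} (hS : ∀ b c, 0 ≤ S b c)
    (hsymm : ∀ b c, S b c = S c b) {h : ℝ → B → ℝ} {α : B → ℝ}
    (hpos : ∀ s, 0 < s → ∀ b, 0 < h s b)
    (heq : ∀ s, 0 < s → ∀ b, s * h s b + h s b * ∑ c, S b c * h s c = 1)
    (hlim : ∀ b, Tendsto (fun s => s * h s b) (𝓝[>] 0) (𝓝 (α b)))
    {R : Finset B} {π : B → B} (hinj : Set.InjOn π R) (hmatch : ∀ j ∈ R, 0 < S j (π j))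
    (hbip : ∀ j ∈ R, ∀ k ∉ R, S (π j) k = 0) {j : B} (hj : j ∈ R) : α j = 0 := by
  have hα : ∀ b, 0 ≤ α b := fun b => ge_of_tendsto (hlim b) (by
    filter_upwards [self_mem_nhdsWithin] with s hs
    exact mul_nonneg (le_of_lt hs) (hpos s hs b).le)
  -- `T` collects the indices with an atom; it will turn out that the masses over `T` sum to zero.
  set T := R.filter fun j => 0 < α j with hT
  have hTR : T ⊆ R := Finset.filter_subset _ _
  have hle : ∀ s, 0 < s → ∀ b c, h s b * S b c * h s c ≤ 1 := fun s hs b c => by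
    have h1 := heq s hs b
    have h2 : S b c * h s c ≤ ∑ c, S b c * h s c := Finset.single_le_sum
      (f := fun c => S b c * h s c) (fun c _ => mul_nonneg (hS b c) (hpos s hs c).le)
      (Finset.mem_univ c)
    have h3 := mul_le_mul_of_nonneg_left h2 (hpos s hs b).le
    have h4 := mul_pos hs (hpos s hs b)
    linarith
  -- Here `h s j` grows like `α j / s`, while `h s j * S j (π j) * h s (π j) ≤ 1`; hence `h s (π j)`
  -- is `O(s)`.
  have hcol : ∀ j ∈ T, Tendsto (fun s => s * h s (π j)) (𝓝[>] 0) (𝓝 0) := by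
    intro j hj
    have hjα := (Finset.mem_filter.1 hj).2
    have hjS := hmatch j (hTR hj)
    have h1 : Tendsto (fun s : ℝ => s ^ 2 / (S j (π j) * (s * h s j))) (𝓝[>] 0) (𝓝 0) := by
      have h2 : Tendsto (fun s : ℝ => s ^ 2) (𝓝[>] 0) (𝓝 0) := by
        have := ((continuous_pow 2).tendsto (0 : ℝ)).mono_left
          (nhdsWithin_le_nhds (s := Set.Ioi 0))
        simpa using this
      have := h2.div ((hlim j).const_mul (S j (π j))) (mul_pos hjS hjα).ne'
      rw [zero_div] at this
      exact this
    refine tendsto_of_tendsto_of_tendsto_of_le_of_le' tendsto_const_nhds h1 ?_ ?_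
    · filter_upwards [self_mem_nhdsWithin] with s hs
      exact mul_nonneg (le_of_lt hs) (hpos s hs _).le
    · filter_upwards [self_mem_nhdsWithin] with s hs
      have hs : 0 < s := hs
      have hjh := hpos s hs j
      rw [le_div_iff₀ (by positivity)]
      nlinarith [hle s hs j (π j), sq_nonneg s]
  -- As `h s (π j)` is `O(s)`, its product with `h s k` is controlled by `s * h s k`, which vanishes
  -- for `k` without atom.
  have hcross : ∀ j ∈ T, ∀ k ∈ R \ T,
      Tendsto (fun s => S (π j) k * (h s (π j) * h s k)) (𝓝[>] 0) (𝓝 0) := by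
    intro j hj k hk
    have hjα := (Finset.mem_filter.1 hj).2
    have hjS := hmatch j (hTR hj)
    have hkα : α k = 0 := by
      rw [Finset.mem_sdiff] at hk
      by_contra hne
      exact hk.2 (Finset.mem_filter.2 ⟨hk.1, lt_of_le_of_ne (hα k) (Ne.symm hne)⟩)
    have h1 : Tendsto (fun s : ℝ => (s * h s k) / (S j (π j) * (s * h s j))) (𝓝[>] 0) (𝓝 0) := by
      have := (hlim k).div ((hlim j).const_mul (S j (π j))) (mul_pos hjS hjα).ne'
      rw [hkα, zero_div] at this
      exact this
    have h2 : Tendsto (fun s => h s (π j) * h s k) (𝓝[>] 0) (𝓝 0) := by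
      refine tendsto_of_tendsto_of_tendsto_of_le_of_le' tendsto_const_nhds h1 ?_ ?_
      · filter_upwards [self_mem_nhdsWithin] with s hs
        exact mul_nonneg (hpos s hs _).le (hpos s hs _).le
      · filter_upwards [self_mem_nhdsWithin] with s hs
        have hs : 0 < s := hs
        have hjh := hpos s hs j
        rw [le_div_iff₀ (by positivity)]
        have h3 := mul_le_mul_of_nonneg_left (hle s hs j (π j))
          (mul_nonneg hs.le (hpos s hs k).le)
        linarith
    simpa using h2.const_mul (S (π j) k)
  -- Sum the equations at the partners `π j`, `j ∈ T`: the total `|T|` is a small part plus the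
  -- interaction of `π(T)` with `T`. As `π` is injective, the equations at `k ∈ T` bound that
  -- interaction by `|T| - ∑ s * h s k`.
  have hmain : ∀ s, 0 < s → ∑ j ∈ T, s * h s j ≤
      ∑ j ∈ T, s * h s (π j) + ∑ j ∈ T, ∑ k ∈ R \ T, S (π j) k * (h s (π j) * h s k) := by
    intro s hs
    have h1 : ∀ j ∈ T, 1 - s * h s (π j) = (∑ k ∈ T, S (π j) k * (h s (π j) * h s k)) +
        ∑ k ∈ R \ T, S (π j) k * (h s (π j) * h s k) := by
      intro j hj
      rw [add_comm, Finset.sum_sdiff hTR, ← heq s hs (π j), add_sub_cancel_left, Finset.mul_sum,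
        ← Finset.sum_subset (Finset.subset_univ R) fun k _ hk => by
          rw [hbip j (hTR hj) k hk]
          ring]
      exact Finset.sum_congr rfl fun k _ => by ring
    have h2 : ∀ k ∈ T, ∑ j ∈ T, S (π j) k * (h s (π j) * h s k) ≤ 1 - s * h s k := by
      intro k hk
      have h3 : ∑ j ∈ T, S (π j) k * (h s (π j) * h s k) =
          ∑ c ∈ T.image π, S c k * (h s c * h s k) := by
        rw [Finset.sum_image fun x hx y hy hxy => hinj (hTR hx) (hTR hy) hxy]
      rw [h3, ← heq s hs k, add_sub_cancel_left, Finset.mul_sum]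
      refine (Finset.sum_le_univ_sum_of_nonneg fun c => mul_nonneg (hS c k)
        (mul_nonneg (hpos s hs c).le (hpos s hs k).le)).trans (le_of_eq ?_)
      refine Finset.sum_congr rfl fun c _ => ?_
      rw [hsymm k c]
      ring
    have h4 := Finset.sum_congr rfl h1
    have h5 := Finset.sum_le_sum h2
    rw [Finset.sum_comm] at h5
    simp only [Finset.sum_sub_distrib, Finset.sum_add_distrib] at h4 h5
    linarith
  have hfin : ∑ j ∈ T, α j ≤ 0 := by
    have h1 := tendsto_finsetSum T fun j (_ : j ∈ T) => hlim j
    have h2 := (tendsto_finsetSum T hcol).add (tendsto_finsetSum T fun j hj =>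
      tendsto_finsetSum (R \ T) (hcross j hj))
    simp only [Finset.sum_const_zero, add_zero] at h2
    refine le_of_tendsto_of_tendsto h1 h2 ?_
    filter_upwards [self_mem_nhdsWithin] with s hs
    exact hmain s hs
  by_contra hne
  have hjT : j ∈ T := Finset.mem_filter.2 ⟨hj, lt_of_le_of_ne (hα j) (Ne.symm hne)⟩
  have h1 := Finset.single_le_sum (f := α) (fun b _ => hα b) hjT
  exact hne (le_antisymm (h1.trans hfin) (hα j))

end Atoms

end

noncomputable section

/-! ### The limit laws attached to the quadratic vector equation. -/

section LimitMeasures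

variable {B : Type*} [Fintype B] {S : B → B → ℝ} {m : ℂ → B → ℂ} {w z : ℂ}

theorem exists_sq_eq_of_im_pos (hz : 0 < z.im) : ∃ w : ℂ, w ^ 2 = z ∧ 0 < w.im := by
  obtain ⟨w, hw⟩ := IsAlgClosed.exists_pow_nat_eq z two_pos
  have hw0 : w.im ≠ 0 := fun h => by
    rw [← hw, sq, Complex.mul_im, h] at hz
    simp at hz
  rcases lt_or_gt_of_ne hw0 with h | h
  · exact ⟨-w, by rw [neg_sq, hw], by simpa using h⟩
  · exact ⟨w, hw, h⟩

/-- The equation gives `w m - 1 = m (S m)`, a product of two factors of order `1/y` at `w = iy`. -/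
theorem tendsto_mul_isQVESolution (hm : ∀ w, 0 < w.im → IsQVESolution S w (m w))
    (hS : ∀ b c, 0 ≤ S b c) (b : B) :
    Tendsto (fun y : ℝ => (y * Complex.I) * m (y * Complex.I) b) atTop (𝓝 1) := by
  rw [tendsto_iff_norm_sub_tendsto_zero]
  have h1 : Tendsto (fun y : ℝ => (∑ b, ∑ c, S b c) / y ^ 2) atTop (𝓝 0) :=
    tendsto_const_nhds.div_atTop (tendsto_pow_atTop two_ne_zero)
  refine squeeze_zero' (Eventually.of_forall fun _ => norm_nonneg _) ?_ h1
  filter_upwards [eventually_gt_atTop 0] with y hy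
  have hw : 0 < (y * Complex.I : ℂ).im := by simpa using hy
  have h2 : (y * Complex.I : ℂ).im = y := by simp
  have h3 := IsQVEApprox.norm_sum_le (hm _ hw) hS hw b
  have h4 := (hm _ hw).norm_le b
  rw [(hm _ hw).eq b, add_sub_cancel_left, norm_mul]
  rw [h2] at h3 h4
  refine (mul_le_mul h4 h3 (norm_nonneg _) (by positivity)).trans (le_of_eq ?_)
  field_simp

theorem isQVESolution_neg_conj (hm : ∀ w, 0 < w.im → IsQVESolution S w (m w))
    (hS : ∀ b c, 0 ≤ S b c) (hw : 0 < w.im) (b : B) :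
    m (-(starRingEnd ℂ) w) b = -(starRingEnd ℂ) (m w b) := by
  have hw' : 0 < (-(starRingEnd ℂ) w).im := by simpa using hw
  exact congrFun ((hm _ hw').unique (hm w hw).neg_conj hS hw') b

/-- Since `m(-conj w) = -conj (m w)`, the two terms of `cauchyTransform_map_sq` coincide. -/
theorem cauchyTransform_map_sq_eq (hm : ∀ w, 0 < w.im → IsQVESolution S w (m w))
    (hS : ∀ b c, 0 ≤ S b c) {κ : Measure ℝ} [IsFiniteMeasure κ] {b : B}
    (hκ : ∀ w, 0 < w.im → cauchyTransform κ w = m w b) (hw : 0 < w.im) (hw2 : 0 < (w ^ 2).im) :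
    cauchyTransform (κ.map fun t => t ^ 2) (w ^ 2) = m w b / w := by
  have hw0 : w ≠ 0 := fun h => by simp [h] at hw
  rw [cauchyTransform_map_sq hw hw2, hκ w hw, hκ _ (by simpa using hw),
    isQVESolution_neg_conj hm hS hw, map_neg, Complex.conj_conj]
  field_simp
  ring

theorem norm_cauchyTransform_map_sq_le (hm : ∀ w, 0 < w.im → IsQVESolution S w (m w))
    (hS : ∀ b c, 0 ≤ S b c) (hsymm : ∀ b c, S b c = S c b) {κ : Measure ℝ} [IsFiniteMeasure κ]
    {b : B} (hκ : ∀ w, 0 < w.im → cauchyTransform κ w = m w b) (hz : 0 < z.im) :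
    ‖cauchyTransform (κ.map fun t => t ^ 2) z‖ ≤ (1 + Fintype.card B) / ‖z‖ := by
  obtain ⟨w, rfl, hw⟩ := exists_sq_eq_of_im_pos hz
  have hw0 : w ≠ 0 := fun h => by simp [h] at hw
  have hw0' : 0 < ‖w‖ := norm_pos_iff.2 hw0
  rw [cauchyTransform_map_sq_eq hm hS hκ hw hz, norm_div, norm_pow, div_le_div_iff₀ hw0'
    (by positivity)]
  have := mul_le_mul_of_nonneg_right ((hm w hw).norm_mul_le hS hsymm hw b) hw0'.le
  linarith

theorem cauchyTransform_map_sq_mul (hm : ∀ w, 0 < w.im → IsQVESolution S w (m w))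
    (hS : ∀ b c, 0 ≤ S b c) {κ : B → ProbabilityMeasure ℝ}
    (hκ : ∀ b w, 0 < w.im → cauchyTransform (κ b) w = m w b) (hz : 0 < z.im) (b : B) :
    z * cauchyTransform ((κ b : Measure ℝ).map fun t => t ^ 2) z =
      1 + z * ((∑ c, S b c * cauchyTransform ((κ c : Measure ℝ).map fun t => t ^ 2) z) *
        cauchyTransform ((κ b : Measure ℝ).map fun t => t ^ 2) z) := by
  obtain ⟨w, rfl, hw⟩ := exists_sq_eq_of_im_pos hz
  have hw0 : w ≠ 0 := fun h => by simp [h] at hw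
  simp only [fun b => cauchyTransform_map_sq_eq hm hS (hκ b) hw hz]
  have h1 := (hm w hw).eq b
  have h2 : ∑ c, (S b c : ℂ) * (m w c / w) = (∑ c, S b c * m w c) / w := by
    rw [Finset.sum_div]
    exact Finset.sum_congr rfl fun c _ => by ring
  rw [h2]
  have h3 : w ^ 2 * (m w b / w) = w * m w b := by field_simp
  have h4 : w ^ 2 * ((∑ c, S b c * m w c) / w * (m w b / w)) =
      m w b * ∑ c, S b c * m w c := by field_simp
  rw [h3, h4, h1]

theorem cauchyTransform_map_sq_comp (hm : ∀ w, 0 < w.im → IsQVESolution S w (m w))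
    (hS : ∀ b c, 0 ≤ S b c) {κ : B → ProbabilityMeasure ℝ}
    (hκ : ∀ b w, 0 < w.im → cauchyTransform (κ b) w = m w b) (τ : B ≃ B)
    (hτ : ∀ b c, S (τ b) (τ c) = S b c) (hz : 0 < z.im) (b : B) :
    cauchyTransform ((κ (τ b) : Measure ℝ).map fun t => t ^ 2) z =
      cauchyTransform ((κ b : Measure ℝ).map fun t => t ^ 2) z := by
  obtain ⟨w, rfl, hw⟩ := exists_sq_eq_of_im_pos hz
  rw [cauchyTransform_map_sq_eq hm hS (hκ _) hw hz, cauchyTransform_map_sq_eq hm hS (hκ _) hw hz]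
  congr 1
  exact congrFun (((hm w hw).comp_equiv τ hτ).unique (hm w hw) hS hw) b

theorem measure_singleton_zero_of_matching [DecidableEq B]
    (hm : ∀ w, 0 < w.im → IsQVESolution S w (m w)) (hS : ∀ b c, 0 ≤ S b c)
    (hsymm : ∀ b c, S b c = S c b) {κ : B → ProbabilityMeasure ℝ}
    (hκ : ∀ b w, 0 < w.im → cauchyTransform (κ b) w = m w b) {R : Finset B} {π : B → B}
    (hinj : Set.InjOn π R) (hmatch : ∀ j ∈ R, 0 < S j (π j))
    (hbip : ∀ j ∈ R, ∀ k ∉ R, S (π j) k = 0) {j : B} (hj : j ∈ R) :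
    (κ j : Measure ℝ) {0} = 0 := by
  have hI : ∀ s : ℝ, 0 < s → 0 < (s * Complex.I : ℂ).im := fun s hs => by simpa using hs
  -- On the imaginary axis `-conj w = w`, so `m` is purely imaginary there and the equation becomes
  -- a real one for positive quantities.
  have hm' : ∀ s : ℝ, 0 < s → ∀ b, m (s * Complex.I) b =
      -Complex.I * ((-(m (s * Complex.I) b).im : ℝ) : ℂ) := by
    intro s hs b
    have h1 := isQVESolution_neg_conj hm hS (hI s hs) b
    have h2 : -(starRingEnd ℂ) (s * Complex.I : ℂ) = s * Complex.I := by simp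
    rw [h2] at h1
    have h3 := congrArg Complex.re h1
    rw [Complex.neg_re, Complex.conj_re] at h3
    apply Complex.ext
    · simp
      linarith
    · simp
  have h1 := atom_eq_zero_of_matching hS hsymm
    (h := fun s b => -(m (s * Complex.I) b).im) (α := fun b => (κ b : Measure ℝ).real {0})
    (fun s hs b => by linarith [(hm _ (hI s hs)).im_neg b]) (fun s hs b => ?_) (fun b => ?_)
    hinj hmatch hbip hj
  · simpa [measureReal_def, ENNReal.toReal_eq_zero_iff] using h1
  · have h1 := (hm _ (hI s hs)).eq b
    have h2 : ∑ c, (S b c : ℂ) * m (s * Complex.I) c =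
        -Complex.I * ((∑ c, S b c * -(m (s * Complex.I) c).im : ℝ) : ℂ) := by
      rw [Complex.ofReal_sum, Finset.mul_sum]
      refine Finset.sum_congr rfl fun c _ => ?_
      rw [hm' s hs c, Complex.ofReal_mul]
      simp only [neg_mul, Complex.neg_im, Complex.mul_im, Complex.I_re, Complex.I_im,
        Complex.ofReal_re, Complex.ofReal_im, zero_mul, one_mul, zero_add]
      push_cast
      ring
    rw [h2] at h1
    rw [hm' s hs b] at h1
    have h3 : (s : ℂ) * ((-(m (s * Complex.I) b).im : ℝ) : ℂ) +
        ((-(m (s * Complex.I) b).im : ℝ) : ℂ) *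
          ((∑ c, S b c * -(m (s * Complex.I) c).im : ℝ) : ℂ) = 1 := by
      linear_combination h1 + (s * ((-(m (s * Complex.I) b).im : ℝ) : ℂ) +
        ((-(m (s * Complex.I) b).im : ℝ) : ℂ) *
          ((∑ c, S b c * -(m (s * Complex.I) c).im : ℝ) : ℂ)) * Complex.I_sq
    exact_mod_cast h3
  · have h1 := tendsto_mul_cauchyTransform_zero (μ := (κ b : Measure ℝ))
    have h2 := (Complex.continuous_re.tendsto _).comp h1
    rw [Complex.ofReal_re] at h2
    refine h2.congr' ?_
    filter_upwards [self_mem_nhdsWithin] with s hs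
    have hs : 0 < s := hs
    simp only [Function.comp_apply]
    rw [hκ b _ (hI s hs)]
    simp

/-- The square of the limit law of a matched index has a density. -/
theorem absolutelyContinuous_map_sq_of_matching [DecidableEq B]
    (hm : ∀ w, 0 < w.im → IsQVESolution S w (m w)) (hS : ∀ b c, 0 ≤ S b c)
    (hsymm : ∀ b c, S b c = S c b) {κ : B → ProbabilityMeasure ℝ}
    (hκ : ∀ b w, 0 < w.im → cauchyTransform (κ b) w = m w b) {R : Finset B} {π : B → B}
    (hinj : Set.InjOn π R) (hmatch : ∀ j ∈ R, 0 < S j (π j))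
    (hbip : ∀ j ∈ R, ∀ k ∉ R, S (π j) k = 0) {j : B} (hj : j ∈ R) :
    (κ j : Measure ℝ).map (fun t => t ^ 2) ≪ volume := by
  have hprob : IsProbabilityMeasure ((κ j : Measure ℝ).map fun t => t ^ 2) :=
    Measure.isProbabilityMeasure_map (by fun_prop)
  refine absolutelyContinuous_of_norm_cauchyTransform_le
    (fun z hz => norm_cauchyTransform_map_sq_le hm hS hsymm (hκ j) hz) ?_
  rw [Measure.map_apply (by fun_prop) (measurableSet_singleton 0)]
  have : (fun t : ℝ => t ^ 2) ⁻¹' {0} = {0} := by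
    ext t
    simp
  rw [this]
  exact measure_singleton_zero_of_matching hm hS hsymm hκ hinj hmatch hbip hj

end LimitMeasures

/-! ### Resolvents of Hermitian dilations. -/

section HermitianDilation

variable {p q : Type*} [Fintype p] [DecidableEq p] [Fintype q] [DecidableEq q] {w : ℂ}

/-- The resolvent of the Hermitian dilation of `Y` contains the resolvent of `Y Yᴴ`. -/
theorem toBlocks₁₁_matrixResolvent_fromBlocks (Y : Matrix p q ℂ) (hw : 0 < w.im)
    (hw2 : 0 < (w ^ 2).im) : (matrixResolvent w (Matrix.fromBlocks 0 Y Yᴴ 0)).toBlocks₁₁ =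
      w • matrixResolvent (w ^ 2) (Y * Yᴴ) := by
  have hw0 : w ≠ 0 := fun h => by simp [h] at hw
  have hX : (Matrix.fromBlocks 0 Y Yᴴ 0 : Matrix (p ⊕ q) (p ⊕ q) ℂ).IsHermitian := by
    simp [Matrix.IsHermitian, Matrix.fromBlocks_conjTranspose]
  have h1 := mul_matrixResolvent hX hw
  set G := matrixResolvent w (Matrix.fromBlocks 0 Y Yᴴ 0) with hG
  rw [← Matrix.fromBlocks_toBlocks G, ← Matrix.fromBlocks_one, Matrix.fromBlocks_smul,
    sub_eq_add_neg, Matrix.fromBlocks_neg, Matrix.fromBlocks_add, Matrix.fromBlocks_multiply,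
    Matrix.fromBlocks_inj] at h1
  obtain ⟨h2, -, h3, -⟩ := h1
  simp only [smul_zero, neg_zero, add_zero, zero_add, Matrix.smul_mul, Matrix.one_mul,
    Matrix.neg_mul] at h2 h3
  have h4 : Yᴴ * G.toBlocks₁₁ = w • G.toBlocks₂₁ := by
    rw [neg_add_eq_zero] at h3
    exact h3
  have hW : (Y * Yᴴ).IsHermitian := Matrix.isHermitian_mul_conjTranspose_self Y
  -- Multiply `w G₁₁ - Y G₂₁ = 1` by `w` and eliminate `G₂₁` with `w G₂₁ = Yᴴ G₁₁`.
  have h5 : ((w ^ 2) • (1 : Matrix p p ℂ) - Y * Yᴴ) * G.toBlocks₁₁ = w • 1 := by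
    rw [Matrix.sub_mul, Matrix.mul_assoc, h4, Matrix.smul_mul, Matrix.one_mul, Matrix.mul_smul,
      ← h2, smul_add, smul_smul, sq, smul_neg, sub_eq_add_neg]
  have h6 := congrArg (matrixResolvent (w ^ 2) (Y * Yᴴ) * ·) h5
  simp only [← Matrix.mul_assoc, matrixResolvent_mul hW hw2, Matrix.one_mul, Matrix.mul_smul,
    Matrix.mul_one] at h6
  exact h6

theorem matrixResolvent_submatrix_equiv (X : Matrix q q ℂ) (e : p ≃ q) :
    matrixResolvent w (X.submatrix e e) = (matrixResolvent w X).submatrix e e := by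
  unfold matrixResolvent
  rw [← Matrix.inv_submatrix_equiv]
  congr 1
  ext x y
  simp [Matrix.one_apply]

end HermitianDilation

end

noncomputable section

/-! ### The channel matrix as a block model. -/

section ChannelModel

variable {K L : ℕ}

/-- Two block indices are adjacent if one of the blocks joining them is a tap. -/
def BlockAdj (K L : ℕ) (b c : ℕ) : Prop :=
  (b < K ∧ K + b ≤ c ∧ c < K + b + L) ∨ (c < K ∧ K + c ≤ b ∧ b < K + c + L)

open Classical in
/-- The matrix of the quadratic vector equation of the channel. -/
def channelS (K L : ℕ) (b c : Fin (2 * K + L - 1)) : ℝ :=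
  if BlockAdj K L b c then 1 / ((2 * K + L - 1 : ℕ) : ℝ) else 0

open Classical in
/-- The indicator functions of the taps in the upper right part of the block matrix. -/
def channelTap (K L : ℕ) (l : Fin L) (b c : Fin (2 * K + L - 1)) : ℝ :=
  if IsTapBlock K L b c l then 1 else 0

theorem channelS_nonneg (b c : Fin (2 * K + L - 1)) : 0 ≤ channelS K L b c := by
  unfold channelS
  split_ifs <;> positivity

theorem channelS_symm (b c : Fin (2 * K + L - 1)) : channelS K L b c = channelS K L c b := by
  classical
  unfold channelS
  exact if_congr or_comm rfl rfl

open Classical in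
theorem sum_channelTap_sq (b c : Fin (2 * K + L - 1)) :
    ∑ l, channelTap K L l b c * channelTap K L l b c =
      if (b : ℕ) < K ∧ K + (b : ℕ) ≤ c ∧ (c : ℕ) < K + b + L then 1 else 0 := by
  split_ifs with h
  · rw [Finset.sum_eq_single (⟨c - K - b, by omega⟩ : Fin L)]
    · rw [channelTap, if_pos ⟨h.1, by simp only; omega, by simp only; omega⟩, one_mul]
    · intro l _ hl
      rw [channelTap, if_neg fun h' => hl (Fin.ext (by have := h'.2.2; simp only; omega)), zero_mul]
    · simp
  · refine Finset.sum_eq_zero fun l _ => ?_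
    rw [channelTap, if_neg fun h' => h ⟨h'.1, by have := h'.2; omega, by have := h'.2; omega⟩,
      zero_mul]

theorem blockS_channelTap :
    blockS (channelTap K L) (1 / ((2 * K + L - 1 : ℕ) : ℝ)) = channelS K L := by
  classical
  funext b c
  simp only [blockS, blockCov, Finset.sum_add_distrib, sum_channelTap_sq, channelS, BlockAdj]
  by_cases h1 : (b : ℕ) < K ∧ K + (b : ℕ) ≤ c ∧ (c : ℕ) < K + b + L
  · have h2 : ¬((c : ℕ) < K ∧ K + (c : ℕ) ≤ b ∧ (b : ℕ) < K + c + L) := by omega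
    simp [h1, h2]
  · by_cases h2 : (c : ℕ) < K ∧ K + (c : ℕ) ≤ b ∧ (b : ℕ) < K + c + L
    · simp [h1, h2]
    · simp [h1, h2]

/-- The phases of the rotation which separates the block indices. -/
def blockPhase (d : ℕ) : Circle := Circle.exp (2 * Real.pi / d)

/-- The phase is a primitive `d`-th root of unity, so its powers separate all `d` block indices. -/
theorem blockPhase_pow_injective {d : ℕ} (hd : d ≠ 0) :
    Function.Injective fun b : Fin d => blockPhase d ^ (b : ℕ) := by
  intro b c h
  have h1 : IsPrimitiveRoot (blockPhase d : ℂ) d := by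
    have h2 : (blockPhase d : ℂ) = Complex.exp (2 * Real.pi * Complex.I / d) := by
      rw [blockPhase, Circle.coe_exp]
      congr 1
      push_cast
      ring
    rw [h2]
    exact Complex.isPrimitiveRoot_exp d hd
  have h3 := congrArg (fun u : Circle => (u : ℂ)) h
  simp only [Circle.coe_pow] at h3
  exact Fin.ext (h1.pow_inj b.2 c.2 h3)

/-- Tap `l` occurs only where `c = K + b + l`, so the phase `ζ^(b - c)` depends on `l` alone: the
block Toeplitz structure is what permits the rotation argument. -/
theorem channelTap_rotate (ζ : Circle) (l : Fin L) (b c : Fin (2 * K + L - 1)) :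
    ((ζ ^ (b : ℕ) : Circle) : ℂ) * channelTap K L l b c *
      (starRingEnd ℂ) ((ζ ^ (c : ℕ) : Circle) : ℂ) =
      ((ζ ^ (K + (l : ℕ)))⁻¹ : Circle) * channelTap K L l b c := by
  unfold channelTap
  split_ifs with h
  · have h1 : ζ ^ (b : ℕ) * (ζ ^ (c : ℕ))⁻¹ = (ζ ^ (K + (l : ℕ)))⁻¹ := by
      rw [mul_inv_eq_iff_eq_mul, eq_inv_mul_iff_mul_eq, ← pow_add, h.2.2]
      congr 1
      ring
    rw [← Circle.coe_inv_eq_conj, Complex.ofReal_one, mul_one, mul_one, ← Circle.coe_mul, h1]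
  · simp

/-- The splitting of the block indices into row and column indices. -/
def blockSplit (hK : 1 ≤ K) : Fin K ⊕ Fin (K + L - 1) ≃ Fin (2 * K + L - 1) :=
  finSumFinEquiv.trans (finCongr (by omega))

theorem blockSplit_inl (hK : 1 ≤ K) (i : Fin K) :
    (blockSplit (L := L) hK (Sum.inl i) : ℕ) = i := by
  simp [blockSplit]

theorem blockSplit_inr (hK : 1 ≤ K) (j : Fin (K + L - 1)) :
    (blockSplit (L := L) hK (Sum.inr j) : ℕ) = K + j := by
  simp [blockSplit]

/-- The splitting of the indices of the block matrix. -/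
def indexSplit (hK : 1 ≤ K) (N : ℕ) :
    (Fin K × Fin N) ⊕ (Fin (K + L - 1) × Fin N) ≃ Fin (2 * K + L - 1) × Fin N :=
  (Equiv.sumProdDistrib _ _ _).symm.trans ((blockSplit hK).prodCongr (Equiv.refl _))

theorem blockMatrix_tapVector_apply {N : ℕ} (s : ℝ) (A : Fin L → Matrix (Fin N) (Fin N) ℂ)
    (x y : Fin (2 * K + L - 1) × Fin N) :
    blockMatrix (channelTap K L) s (tapVector A) x y =
      (s : ℂ) * ∑ l, (channelTap K L l x.1 y.1 * A l x.2 y.2 +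
        channelTap K L l y.1 x.1 * (starRingEnd ℂ) (A l y.2 x.2)) := by
  simp only [blockMatrix, hermitianSum, Matrix.sum_apply, Matrix.add_apply, Matrix.smul_apply,
    smul_eq_mul, Matrix.conjTranspose_apply, tapVector]
  rw [Equiv.sum_comp (tapEquiv L N) fun i => A i.1 i.2.1 i.2.2 *
    blockTap (channelTap K L) s i x y + (starRingEnd ℂ) (A i.1 i.2.1 i.2.2) *
      star (blockTap (channelTap K L) s i y x), Fintype.sum_prod_type, Finset.mul_sum]
  refine Finset.sum_congr rfl fun l _ => ?_
  rw [Finset.sum_add_distrib, mul_add]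
  congr 1
  · rw [Finset.sum_eq_single (x.2, y.2)]
    · simp [blockTap]
      ring
    · intro r _ hr
      have : ¬(x.2 = r.1 ∧ y.2 = r.2) := fun h => hr (Prod.ext h.1.symm h.2.symm)
      simp [blockTap, this]
    · simp
  · rw [Finset.sum_eq_single (y.2, x.2)]
    · simp [blockTap]
      ring
    · intro r _ hr
      have : ¬(y.2 = r.1 ∧ x.2 = r.2) := fun h => hr (Prod.ext h.1.symm h.2.symm)
      simp [blockTap, this]
    · simp

theorem sum_channelTap_mul {N : ℕ} (A : Fin L → Matrix (Fin N) (Fin N) ℂ)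
    (b c : Fin (2 * K + L - 1)) (r p : Fin N) :
    ∑ l, (channelTap K L l b c : ℂ) * A l r p =
      if h : (b : ℕ) < K ∧ K + (b : ℕ) ≤ c ∧ (c : ℕ) < K + b + L then
        A ⟨c - K - b, by omega⟩ r p else 0 := by
  split_ifs with h
  · rw [Finset.sum_eq_single (⟨c - K - b, by omega⟩ : Fin L)]
    · rw [channelTap, if_pos ⟨h.1, by simp only; omega, by simp only; omega⟩, Complex.ofReal_one,
        one_mul]
    · intro l _ hl
      rw [channelTap, if_neg fun h' => hl (Fin.ext (by have := h'.2.2; simp only; omega)),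
        Complex.ofReal_zero, zero_mul]
    · simp
  · refine Finset.sum_eq_zero fun l _ => ?_
    rw [channelTap, if_neg fun h' => h ⟨h'.1, by have := h'.2; omega, by have := h'.2; omega⟩,
      Complex.ofReal_zero, zero_mul]

/-- Taps join a row index below `K` to a column index at least `K`, so both diagonal corners vanish;
the lower left corner follows by Hermitian symmetry. -/
theorem blockMatrix_submatrix (hK : 1 ≤ K) {N : ℕ} (s : ℝ)
    (A : Fin L → Matrix (Fin N) (Fin N) ℂ) :
    (blockMatrix (channelTap K L) s (tapVector A)).submatrix (indexSplit hK N)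
      (indexSplit hK N) = Matrix.fromBlocks 0 ((s : ℂ) • channelMatrix K A)
        ((s : ℂ) • channelMatrix K A)ᴴ 0 := by
  have h12 : ∀ (x : Fin K × Fin N) (y : Fin (K + L - 1) × Fin N),
      blockMatrix (channelTap K L) s (tapVector A) (indexSplit hK N (Sum.inl x))
        (indexSplit hK N (Sum.inr y)) = ((s : ℂ) • channelMatrix K A) x y := by
    intro x y
    have e1 : indexSplit (L := L) hK N (Sum.inl x) = (blockSplit hK (Sum.inl x.1), x.2) := rfl
    have e2 : indexSplit (L := L) hK N (Sum.inr y) = (blockSplit hK (Sum.inr y.1), y.2) := rfl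
    rw [e1, e2, blockMatrix_tapVector_apply, Finset.sum_add_distrib, sum_channelTap_mul,
      Matrix.smul_apply, smul_eq_mul]
    have h0 : ∑ l, (channelTap K L l (blockSplit hK (Sum.inr y.1)) (blockSplit hK (Sum.inl x.1)) :
        ℂ) * (starRingEnd ℂ) (A l y.2 x.2) = 0 := by
      refine Finset.sum_eq_zero fun l _ => ?_
      rw [channelTap, if_neg fun h' => by
        have := h'.1
        rw [blockSplit_inr] at this
        omega, Complex.ofReal_zero, zero_mul]
    simp only [h0, add_zero, blockSplit_inl, blockSplit_inr, channelMatrix, Matrix.of_apply]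
    congr 1
    have hx := x.1.2
    by_cases h : (x.1 : ℕ) ≤ (y.1 : ℕ) ∧ (y.1 : ℕ) - (x.1 : ℕ) < L
    · rw [dif_pos h, dif_pos (by omega)]
      have hl : K + (y.1 : ℕ) - K - x.1 = (y.1 : ℕ) - x.1 := by omega
      simp only [hl]
    · rw [dif_neg h, dif_neg (by omega)]
  have hH := blockMatrix_isHermitian (channelTap K L) s (tapVector A)
  ext x y
  rcases x with x | x <;> rcases y with y | y
  · simp only [Matrix.submatrix_apply, Matrix.fromBlocks_apply₁₁, Matrix.zero_apply]
    have e1 : indexSplit (L := L) hK N (Sum.inl x) = (blockSplit hK (Sum.inl x.1), x.2) := rfl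
    have e2 : indexSplit (L := L) hK N (Sum.inl y) = (blockSplit hK (Sum.inl y.1), y.2) := rfl
    rw [e1, e2, blockMatrix_tapVector_apply, Finset.sum_eq_zero, mul_zero]
    intro l _
    have hx := x.1.2
    have hy := y.1.2
    rw [channelTap, channelTap, if_neg fun h' => by
        have := h'.2.2
        rw [blockSplit_inl, blockSplit_inl] at this
        omega, if_neg fun h' => by
        have := h'.2.2
        rw [blockSplit_inl, blockSplit_inl] at this
        omega]
    simp
  · simp only [Matrix.submatrix_apply, Matrix.fromBlocks_apply₁₂]
    exact h12 x y
  · simp only [Matrix.submatrix_apply, Matrix.fromBlocks_apply₂₁, Matrix.conjTranspose_apply]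
    rw [← h12 y x, hH.apply]
  · simp only [Matrix.submatrix_apply, Matrix.fromBlocks_apply₂₂, Matrix.zero_apply]
    have e1 : indexSplit (L := L) hK N (Sum.inr x) = (blockSplit hK (Sum.inr x.1), x.2) := rfl
    have e2 : indexSplit (L := L) hK N (Sum.inr y) = (blockSplit hK (Sum.inr y.1), y.2) := rfl
    rw [e1, e2, blockMatrix_tapVector_apply, Finset.sum_eq_zero, mul_zero]
    intro l _
    rw [channelTap, channelTap, if_neg fun h' => by
        have := h'.1
        rw [blockSplit_inr] at this
        omega, if_neg fun h' => by
        have := h'.1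
        rw [blockSplit_inr] at this
        omega]
    simp

/-- The normalization of the block matrix. -/
def channelScale (K L N : ℕ) : ℝ := √(((N * (2 * K + L - 1) : ℕ) : ℝ)⁻¹)

theorem channelScale_sq (N : ℕ) :
    channelScale K L N ^ 2 = ((N * (2 * K + L - 1) : ℕ) : ℝ)⁻¹ :=
  Real.sq_sqrt (by positivity)

theorem channelScale_sq_mul {N : ℕ} (hN : 1 ≤ N) :
    channelScale K L N ^ 2 * N = 1 / ((2 * K + L - 1 : ℕ) : ℝ) := by
  have : (N : ℝ) ≠ 0 := by exact_mod_cast (by omega : N ≠ 0)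
  rw [channelScale_sq, Nat.cast_mul, mul_inv]
  field_simp

theorem scaled_channelMatrix_mul {N : ℕ} (A : Fin L → Matrix (Fin N) (Fin N) ℂ) :
    ((channelScale K L N : ℂ) • channelMatrix K A) *
      ((channelScale K L N : ℂ) • channelMatrix K A)ᴴ = channelWishart K A := by
  rw [Matrix.conjTranspose_smul, Matrix.smul_mul, Matrix.mul_smul, smul_smul, channelWishart,
    ← channelScale_sq]
  ext x y
  simp only [Matrix.smul_apply, Complex.real_smul, smul_eq_mul, RCLike.star_def,
    Complex.conj_ofReal]
  push_cast
  ring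

/-- The Cauchy transform of the spectral law in terms of block resolvents. -/
theorem cauchyTransform_spectralLaw_channelWishart (hK : 1 ≤ K) {N : ℕ} (hN : 1 ≤ N)
    (A : Fin L → Matrix (Fin N) (Fin N) ℂ) {w : ℂ} (hw : 0 < w.im) (hw2 : 0 < (w ^ 2).im) :
    cauchyTransform (spectralLaw (channelWishart_isHermitian K A) : Measure ℝ) (w ^ 2) =
      1 / (K : ℂ) * ∑ i : Fin K, blockResolvent (channelTap K L) (channelScale K L N) w
        (tapVector A) (blockSplit hK (Sum.inl i)) (blockSplit hK (Sum.inl i)) / w := by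
  have hw0 : w ≠ 0 := fun h => by simp [h] at hw
  have hN' : (N : ℂ) ≠ 0 := by exact_mod_cast (by omega : N ≠ 0)
  have hK' : (K : ℂ) ≠ 0 := by exact_mod_cast (by omega : K ≠ 0)
  have h1 := toBlocks₁₁_matrixResolvent_fromBlocks
    ((channelScale K L N : ℂ) • channelMatrix K A) hw hw2
  rw [← blockMatrix_submatrix hK, matrixResolvent_submatrix_equiv,
    scaled_channelMatrix_mul] at h1
  rw [cauchyTransform_spectralLaw _ hw2]
  have h2 : ∀ x : Fin K × Fin N, matrixResolvent (w ^ 2) (channelWishart K A) x x =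
      matrixResolvent w (blockMatrix (channelTap K L) (channelScale K L N) (tapVector A))
        (blockSplit hK (Sum.inl x.1), x.2) (blockSplit hK (Sum.inl x.1), x.2) / w := by
    intro x
    rw [eq_div_iff hw0, mul_comm]
    exact (congrFun (congrFun h1 x) x).symm
  simp only [Matrix.trace, Matrix.diag_apply, h2, blockResolvent, blockAvg, Matrix.of_apply,
    Fintype.sum_prod_type, Fintype.card_prod, Fintype.card_fin, Nat.cast_mul, ← Finset.sum_div,
    ← Finset.mul_sum]
  field_simp

end ChannelModel

end

noncomputable section

/-! ### The covariance mapping of the channel in explicit form. -/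

section ChannelCovariance

variable {K L : ℕ}

/-- The covariance mapping of the channel on diagonal matrices. -/
theorem covarianceMap_channelCov_diagonal (D : Fin (2 * K + L - 1) → ℂ) :
    covarianceMap (channelCov K L) (Matrix.diagonal D) =
      Matrix.diagonal fun i => ∑ k, (channelS K L i k : ℂ) * D k := by
  classical
  ext i j
  have h1 : ∀ k, channelCov K L i k k j =
      if i = j ∧ BlockAdj K L i k then 1 else 0 := by
    intro k
    unfold channelCov
    refine if_congr ⟨?_, ?_⟩ rfl rfl
    · rintro ⟨t, ⟨h, h'⟩ | ⟨h, h'⟩⟩ <;> unfold IsTapBlock at h h' <;> unfold BlockAdj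
      · exact ⟨Fin.ext (by omega), by omega⟩
      · exact ⟨Fin.ext (by omega), by omega⟩
    · rintro ⟨rfl, h | h⟩
      · exact ⟨k - K - i, Or.inl ⟨⟨h.1, by omega, by omega⟩, ⟨h.1, by omega, by omega⟩⟩⟩
      · exact ⟨i - K - k, Or.inr ⟨⟨h.1, by omega, by omega⟩, ⟨h.1, by omega, by omega⟩⟩⟩
  have h2 : ∀ k, ∑ l, channelCov K L i k l j * Matrix.diagonal D k l =
      channelCov K L i k k j * D k := by
    intro k
    rw [Finset.sum_eq_single k (fun l _ hl => by
      rw [Matrix.diagonal_apply_ne _ hl.symm, mul_zero]) (by simp), Matrix.diagonal_apply_eq]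
  simp only [covarianceMap, Matrix.of_apply, h2, h1]
  by_cases hij : i = j
  · subst hij
    rw [Matrix.diagonal_apply_eq, Finset.mul_sum]
    refine Finset.sum_congr rfl fun k _ => ?_
    by_cases h : BlockAdj K L i k <;> simp [channelS, h]
  · rw [Matrix.diagonal_apply_ne _ hij]
    simp [hij]

/-- The block index with a given value. -/
def blockIndex (K L : ℕ) (hd : 0 < 2 * K + L - 1) (n : ℕ) : Fin (2 * K + L - 1) :=
  if h : n < 2 * K + L - 1 then ⟨n, h⟩ else ⟨0, hd⟩

variable {hd : 0 < 2 * K + L - 1}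

theorem blockIndex_val {n : ℕ} (h : n < 2 * K + L - 1) : (blockIndex K L hd n : ℕ) = n := by
  rw [blockIndex, dif_pos h]

theorem blockIndex_coe (i : Fin (2 * K + L - 1)) : blockIndex K L hd (i : ℕ) = i :=
  Fin.ext (blockIndex_val i.2)

/-- The shifts `j - 1` and `K + j - 1` undo the one-based numbering; the default value of
`blockIndex` never enters. -/
theorem diagMatrix_blockIndex (F : Fin (2 * K + L - 1) → ℂ) :
    diagMatrix K L (fun j => F (blockIndex K L hd (j - 1)))
      (fun j => F (blockIndex K L hd (K + j - 1))) = Matrix.diagonal F := by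
  unfold diagMatrix
  congr 1
  funext i
  split_ifs with h
  · simp only [Nat.add_sub_cancel, blockIndex_coe]
  · have : K + ((i : ℕ) + 1 - K) - 1 = i := by omega
    simp only [this, blockIndex_coe]

open Classical in
theorem sum_channelS_mul (F : Fin (2 * K + L - 1) → ℂ) (i : Fin (2 * K + L - 1)) :
    ∑ k, (channelS K L i k : ℂ) * F k = 1 / ((2 * K + L - 1 : ℕ) : ℂ) *
      ∑ n ∈ (Finset.range (2 * K + L - 1)).filter (fun n => BlockAdj K L i n),
        F (blockIndex K L hd n) := by
  rw [Finset.sum_filter, Finset.mul_sum,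
    Finset.sum_range fun n => 1 / ((2 * K + L - 1 : ℕ) : ℂ) *
      if BlockAdj K L i n then F (blockIndex K L hd n) else 0]
  refine Finset.sum_congr rfl fun k _ => ?_
  rw [blockIndex_coe]
  by_cases h : BlockAdj K L i k <;> simp [channelS, h]

/-- The neighbours of column block `j` are the row blocks `k` with `j - K - L + 1 ≤ k ≤ j - K`, cut
down to `1 ≤ k ≤ K`; the branches record which cuts are active. -/
theorem sum_channelS_mul_eq_etaEntry (F : Fin (2 * K + L - 1) → ℂ) (i : Fin (2 * K + L - 1)) :
    ∑ k, (channelS K L i k : ℂ) * F k =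
      etaEntry K L (fun j => F (blockIndex K L hd (j - 1)))
        (fun j => F (blockIndex K L hd (K + j - 1))) ((i : ℕ) + 1) := by
  classical
  have hi := i.2
  rw [sum_channelS_mul (hd := hd), etaEntry]
  congr 1
  -- The passage from zero-based to one-based indices; `1 ≤ a` keeps `k - 1` from being truncated.
  have hIcc : ∀ a b : ℕ, 1 ≤ a → (∀ n, (n < 2 * K + L - 1 ∧ BlockAdj K L i n) ↔
      a ≤ n + 1 ∧ n + 1 ≤ b) →
      ∑ n ∈ (Finset.range (2 * K + L - 1)).filter (fun n => BlockAdj K L i n),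
        F (blockIndex K L hd n) = ∑ k ∈ Finset.Icc a b, F (blockIndex K L hd (k - 1)) := by
    intro a b ha h
    refine Finset.sum_nbij' (fun n => n + 1) (fun k => k - 1) ?_ ?_ ?_ ?_ ?_
    · intro n hn
      rw [Finset.mem_filter, Finset.mem_range, h] at hn
      exact Finset.mem_Icc.2 hn
    · intro k hk
      rw [Finset.mem_Icc] at hk
      rw [Finset.mem_filter, Finset.mem_range, h]
      omega
    · intro n _
      simp
    · intro k hk
      rw [Finset.mem_Icc] at hk
      omega
    · intro n _
      simp
  split_ifs with h1 h2 h3 h4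
  · refine Finset.sum_nbij' (fun n => n - K - i) (fun k => K + i + k) ?_ ?_ ?_ ?_ ?_
    · intro n hn
      rw [Finset.mem_filter, Finset.mem_range, BlockAdj] at hn
      rw [Finset.mem_range]
      omega
    · intro k hk
      rw [Finset.mem_range] at hk
      rw [Finset.mem_filter, Finset.mem_range, BlockAdj]
      omega
    · intro n hn
      rw [Finset.mem_filter, Finset.mem_range, BlockAdj] at hn
      omega
    · intro k _
      omega
    · intro n hn
      rw [Finset.mem_filter, Finset.mem_range, BlockAdj] at hn
      congr 2
      omega
  all_goals
    refine hIcc _ _ (by omega) fun n => ?_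
    unfold BlockAdj
    omega

end ChannelCovariance

/-! ### The reflection symmetry of the channel. -/

section BlockReflection

variable {K L : ℕ}

/-- The reflection of rows and columns. -/
def blockReflection (K L : ℕ) : Equiv.Perm (Fin (2 * K + L - 1)) :=
  Function.Involutive.toPerm
    (fun i => if h : (i : ℕ) < K then ⟨K - 1 - i, by omega⟩ else ⟨3 * K + L - 2 - i, by omega⟩)
    (fun i => by
      have hi := i.2
      apply Fin.ext
      by_cases h : (i : ℕ) < K
      · have h' : K - 1 - (i : ℕ) < K := by omega
        simp only [h, dif_pos, h']
        omega
      · have h' : ¬(3 * K + L - 2 - (i : ℕ) < K) := by omega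
        simp only [h, dif_neg, h', not_false_eq_true]
        omega)

theorem blockReflection_val (i : Fin (2 * K + L - 1)) :
    (blockReflection K L i : ℕ) = if (i : ℕ) < K then K - 1 - i else 3 * K + L - 2 - i := by
  have h1 : blockReflection K L i =
      if h : (i : ℕ) < K then ⟨K - 1 - i, by omega⟩ else ⟨3 * K + L - 2 - i, by omega⟩ := rfl
  rw [h1]
  split_ifs <;> rfl

/-- Reversing both rows and columns sends tap `l` to tap `L - 1 - l`, and `channelS` records only
whether a tap is present. -/
theorem channelS_blockReflection (b c : Fin (2 * K + L - 1)) :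
    channelS K L (blockReflection K L b) (blockReflection K L c) = channelS K L b c := by
  classical
  have hb := b.2
  have hc := c.2
  unfold channelS
  refine if_congr ?_ rfl rfl
  rw [blockReflection_val, blockReflection_val]
  unfold BlockAdj
  split_ifs <;> omega

end BlockReflection

end

noncomputable section

/-! ### Existence and absolute continuity of the channel limit laws. -/

section LimitLaw

variable {K L : ℕ}

/-- The limit laws of the normalized block traces for the channel. -/
theorem exists_channel_limit {Ω : Type*} [MeasurableSpace Ω] (P : Measure Ω)
    [IsProbabilityMeasure P] (hK : 1 ≤ K) (hL : 1 ≤ L)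
    (A : (N : ℕ) → Ω → Fin L → Matrix (Fin N) (Fin N) ℂ)
    (hA : ∀ N : ℕ, IsGaussianTaps P (A N)) :
    ∃ (m : ℂ → Fin (2 * K + L - 1) → ℂ) (κ : Fin (2 * K + L - 1) → ProbabilityMeasure ℝ),
      (∀ w, 0 < w.im → IsQVESolution (channelS K L) w (m w)) ∧
      (∀ b w, 0 < w.im → cauchyTransform (κ b) w = m w b) ∧
      ∀ᵐ ω ∂P, ∀ w, 0 < w.im → ∀ b, Tendsto (fun n => blockResolvent (channelTap K L)
        (channelScale K L (n + 1)) w (tapVector (A (n + 1) ω)) b b) atTop (𝓝 (m w b)) := by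
  obtain ⟨m, hm, hω⟩ := exists_ae_tendsto_blockResolvent (T := channelTap K L) hA
    (s := channelScale K L) (fun N hN => channelScale_sq_mul hN)
    (fun l b c => channelTap_rotate (blockPhase (2 * K + L - 1)) l b c)
    (blockPhase_pow_injective (by omega))
    (by rw [blockS_channelTap]; exact channelS_nonneg)
  rw [blockS_channelTap] at hm
  -- The limit is deterministic, so one good sample suffices: along it the block traces are Cauchy
  -- transforms of probability measures.
  obtain ⟨ω, hω'⟩ := hω.exists
  have h1 : ∀ b, ∃ μ : ProbabilityMeasure ℝ, ∀ w : ℂ, 0 < w.im →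
      cauchyTransform μ w = m w b := by
    intro b
    choose μ hμ using fun n : ℕ => exists_cauchyTransform_eq_blockAvg (N := n + 1) (by omega)
      (blockMatrix_isHermitian (channelTap K L) (channelScale K L (n + 1))
        (tapVector (A (n + 1) ω))) b
    refine exists_cauchyTransform_eq (μ := μ) (fun w hw => ?_)
      (tendsto_mul_isQVESolution hm channelS_nonneg b)
    simp only [fun n => hμ n w hw]
    exact hω' w hw b
  choose κ hκ using h1
  exact ⟨m, κ, hm, hκ, hω⟩

/-- The matching pairs row block `b` with column block `K + b` through tap `0`, which exists as `L ≥
1`; column blocks are adjacent to row blocks only. -/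
theorem absolutelyContinuous_channel_limit (hL : 1 ≤ L)
    {m : ℂ → Fin (2 * K + L - 1) → ℂ} {κ : Fin (2 * K + L - 1) → ProbabilityMeasure ℝ}
    (hm : ∀ w, 0 < w.im → IsQVESolution (channelS K L) w (m w))
    (hκ : ∀ b w, 0 < w.im → cauchyTransform (κ b) w = m w b) {j : Fin (2 * K + L - 1)}
    (hj : (j : ℕ) < K) : (κ j : Measure ℝ).map (fun t => t ^ 2) ≪ volume := by
  classical
  have hd : 0 < 2 * K + L - 1 := by omega
  have hR : ∀ j : Fin (2 * K + L - 1), j ∈ Finset.univ.filter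
      (fun b : Fin (2 * K + L - 1) => (b : ℕ) < K) ↔ (j : ℕ) < K := by simp
  have hval : ∀ j : Fin (2 * K + L - 1), (j : ℕ) < K →
      (blockIndex K L hd (K + j) : ℕ) = K + j := fun j hj => blockIndex_val (by omega)
  refine absolutelyContinuous_map_sq_of_matching hm channelS_nonneg channelS_symm hκ
    (R := Finset.univ.filter fun b => (b : ℕ) < K) (π := fun b => blockIndex K L hd (K + b))
    ?_ ?_ ?_ ((hR j).2 hj)
  · intro b hb c hc hbc
    have hb' := (hR b).1 hb
    have hc' := (hR c).1 hc
    have h1 := congrArg Fin.val hbc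
    simp only [hval b hb', hval c hc'] at h1
    exact Fin.ext (by omega)
  · intro b hb
    have hb' := (hR b).1 hb
    rw [channelS, if_pos (by rw [hval b hb']; unfold BlockAdj; omega)]
    have : (0 : ℝ) < ((2 * K + L - 1 : ℕ) : ℝ) := by exact_mod_cast hd
    positivity
  · intro b hb k hk
    have hb' := (hR b).1 hb
    rw [hR] at hk
    rw [channelS, if_neg (by rw [hval b hb']; unfold BlockAdj; omega)]

end LimitLaw

theorem cauchyTransform_smul_sum {ι : Type*} (s : Finset ι) (c : ℝ≥0∞) (ν : ι → Measure ℝ)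
    [∀ j, IsFiniteMeasure (ν j)] {z : ℂ} (hz : 0 < z.im) :
    cauchyTransform (c • ∑ j ∈ s, ν j) z = c.toReal * ∑ j ∈ s, cauchyTransform (ν j) z := by
  unfold cauchyTransform
  rw [integral_smul_measure, integral_finsetSum_measure fun j _ => integrable_one_div_sub hz.ne',
    Complex.real_smul]

/-- The Cauchy transform of a probability measure near infinity. -/
theorem tendsto_mul_cauchyTransform_atTop {μ : Measure ℝ} [hμ : IsProbabilityMeasure μ] :
    Tendsto (fun y : ℝ => (y * Complex.I) * cauchyTransform μ (y * Complex.I)) atTop (𝓝 1) := by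
  have h1 : (1 : ℂ) = ∫ _, (1 : ℂ) ∂μ := by simp
  rw [h1]
  simp only [cauchyTransform, ← integral_const_mul]
  refine tendsto_integral_filter_of_dominated_convergence (fun _ => (1 : ℝ)) ?_ ?_
    (integrable_const _) (ae_of_all _ fun t => ?_)
  · filter_upwards [eventually_gt_atTop 0] with y hy
    exact ((continuous_one_div_sub (by simp [hy.ne'])).const_mul _).aestronglyMeasurable
  · filter_upwards [eventually_gt_atTop 0] with y hy
    refine ae_of_all _ fun t => ?_
    rw [norm_mul]
    have h2 := norm_one_div_sub_le (z := y * Complex.I) (by simp [hy.ne']) t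
    have h3 : ‖(y * Complex.I : ℂ)‖ = y := by simp [hy.le]
    have h4 : |(y * Complex.I : ℂ).im| = y := by simp [hy.le]
    rw [h4] at h2
    rw [h3]
    calc y * _ ≤ y * (1 / y) := by gcongr
      _ = 1 := by field_simp
  · rw [tendsto_iff_norm_sub_tendsto_zero]
    refine squeeze_zero' (Eventually.of_forall fun _ => norm_nonneg _) ?_
      (tendsto_const_nhds.div_atTop tendsto_id : Tendsto (fun y : ℝ => |t| / y) atTop (𝓝 0))
    filter_upwards [eventually_gt_atTop 0] with y hy
    have hz : (y * Complex.I : ℂ).im ≠ 0 := by simp [hy.ne']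
    have h2 := norm_one_div_sub_le hz t
    have h4 : |(y * Complex.I : ℂ).im| = y := by simp [hy.le]
    rw [h4] at h2
    have h5 : (y * Complex.I : ℂ) * (1 / (y * Complex.I - t)) - 1 =
        t * (1 / (y * Complex.I - t)) := by
      have := sub_ofReal_ne_zero hz t
      field_simp
      ring
    rw [h5, norm_mul, Complex.norm_real, Real.norm_eq_abs]
    exact (mul_le_mul_of_nonneg_left h2 (abs_nonneg t)).trans_eq (mul_one_div _ _)

end

/-! ### The main theorem. -/

theorem mainTheorem3 {Ω : Type*} [MeasurableSpace Ω] (P : Measure Ω) [IsProbabilityMeasure P]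
    (K L : ℕ) (hK : 1 ≤ K) (hL : 1 ≤ L)
    (A : (N : ℕ) → Ω → Fin L → Matrix (Fin N) (Fin N) ℂ)
    (hA : ∀ N : ℕ, IsGaussianTaps P (A N)) :
    ∃ (μ : ProbabilityMeasure ℝ) (ν ρ : ℕ → ProbabilityMeasure ℝ) (f g : ℕ → ℂ → ℂ),
      -- `f j` and `g j` are Cauchy transforms of probability measures
      (∀ j ∈ Finset.Icc 1 K, ∀ z : ℂ, 0 < z.im → f j z = cauchyTransform (ν j : Measure ℝ) z) ∧
      (∀ j ∈ Finset.Icc 1 (K + L - 1), ∀ z : ℂ, 0 < z.im →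
        g j z = cauchyTransform (ρ j : Measure ℝ) z) ∧
      -- the limit law is a mixture of `K` laws with densities
      (∀ j ∈ Finset.Icc 1 K, (ν j : Measure ℝ) ≪ volume) ∧
      (μ : Measure ℝ) = (K : ℝ≥0∞)⁻¹ • ∑ j ∈ Finset.Icc 1 K, (ν j : Measure ℝ) ∧
      (∀ z : ℂ, 0 < z.im →
        cauchyTransform (μ : Measure ℝ) z = (1 / (K : ℂ)) * ∑ j ∈ Finset.Icc 1 K, f j z) ∧
      -- almost sure weak convergence of the spectral laws, and of their Cauchy transforms
      (∀ᵐ ω ∂P,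
        Tendsto (fun N : ℕ => spectralLaw (channelWishart_isHermitian K (A N ω))) atTop
          (𝓝 μ.toFiniteMeasure) ∧
        ∀ z : ℂ, 0 < z.im →
          Tendsto (fun N : ℕ => cauchyTransform
              (spectralLaw (channelWishart_isHermitian K (A N ω)) : Measure ℝ) z) atTop
            (𝓝 ((1 / (K : ℂ)) * ∑ j ∈ Finset.Icc 1 K, f j z))) ∧
      -- the symmetries
      (∀ j ∈ Finset.Icc 1 K, ∀ z : ℂ, 0 < z.im → f j z = f (K + 1 - j) z) ∧
      (∀ j ∈ Finset.Icc 1 (K + L - 1), ∀ z : ℂ, 0 < z.im → g j z = g (K + L - j) z) ∧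
      -- the matrix equation, with the explicit values of the covariance mapping
      (∀ z : ℂ, 0 < z.im →
        z • diagMatrix K L (fun j => f j z) (fun j => g j z) =
          1 + z • (covarianceMap (channelCov K L)
              (diagMatrix K L (fun j => f j z) (fun j => g j z)) *
            diagMatrix K L (fun j => f j z) (fun j => g j z))) ∧
      (∀ z : ℂ, 0 < z.im →
        covarianceMap (channelCov K L) (diagMatrix K L (fun j => f j z) (fun j => g j z)) =
          Matrix.diagonal fun i : Fin (2 * K + L - 1) =>
            etaEntry K L (fun j => f j z) (fun j => g j z) ((i : ℕ) + 1)) := by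
  have hd : 0 < 2 * K + L - 1 := by omega
  obtain ⟨m, κ, hm, hκ, hω⟩ := exists_channel_limit P hK hL A hA
  have hS := channelS_nonneg (K := K) (L := L)
  have hprob : ∀ b, IsProbabilityMeasure ((κ b : Measure ℝ).map fun t => t ^ 2) := fun b =>
    Measure.isProbabilityMeasure_map (by fun_prop)
  set F : Fin (2 * K + L - 1) → ℂ → ℂ := fun b z =>
    cauchyTransform ((κ b : Measure ℝ).map fun t => t ^ 2) z with hF
  set σ : Fin (2 * K + L - 1) → ProbabilityMeasure ℝ := fun b =>
    ⟨(κ b : Measure ℝ).map fun t => t ^ 2, hprob b⟩ with hσ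
  set ν : ℕ → ProbabilityMeasure ℝ := fun j => σ (blockIndex K L hd (j - 1)) with hν
  have hK0 : (K : ℝ≥0∞) ≠ 0 := by exact_mod_cast (by omega : K ≠ 0)
  have hμprob : IsProbabilityMeasure
      ((K : ℝ≥0∞)⁻¹ • ∑ j ∈ Finset.Icc 1 K, (ν j : Measure ℝ)) := ⟨by
    simp only [Measure.smul_apply, Measure.coe_finsetSum, Finset.sum_apply, measure_univ,
      Finset.sum_const, Nat.card_Icc, Nat.add_sub_cancel, nsmul_eq_mul, mul_one, smul_eq_mul]
    exact ENNReal.inv_mul_cancel hK0 (by simp)⟩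
  have hμ : ∀ z : ℂ, 0 < z.im →
      cauchyTransform ((K : ℝ≥0∞)⁻¹ • ∑ j ∈ Finset.Icc 1 K, (ν j : Measure ℝ)) z =
        (1 / (K : ℂ)) * ∑ j ∈ Finset.Icc 1 K, F (blockIndex K L hd (j - 1)) z := by
    intro z hz
    rw [cauchyTransform_smul_sum _ _ _ hz]
    simp [hν, hσ, hF]
  have hlim : ∀ᵐ ω ∂P, ∀ z : ℂ, 0 < z.im → Tendsto (fun n : ℕ => cauchyTransform
      (spectralLaw (channelWishart_isHermitian K (A (n + 1) ω)) : Measure ℝ) z) atTop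
      (𝓝 ((1 / (K : ℂ)) * ∑ j ∈ Finset.Icc 1 K, F (blockIndex K L hd (j - 1)) z)) := by
    filter_upwards [hω] with ω hω z hz
    -- Choosing the square root `w` of `z` in the upper half plane brings the Wishart spectrum back
    -- to block traces of the dilation at `w`.
    obtain ⟨w, rfl, hw⟩ := exists_sq_eq_of_im_pos hz
    simp only [fun n : ℕ => cauchyTransform_spectralLaw_channelWishart hK (N := n + 1) (by omega)
      (A (n + 1) ω) hw hz]
    have h1 : ∑ j ∈ Finset.Icc 1 K, F (blockIndex K L hd (j - 1)) (w ^ 2) =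
        ∑ i : Fin K, m w (blockSplit hK (Sum.inl i)) / w := by
      rw [← Finset.Ico_add_one_right_eq_Icc, Finset.sum_Ico_eq_sum_range, Finset.sum_range]
      refine Finset.sum_congr rfl fun i _ => ?_
      have h2 : blockIndex K L hd (1 + (i : ℕ) - 1) = blockSplit hK (Sum.inl i) :=
        Fin.ext (by rw [blockIndex_val (by omega), blockSplit_inl]; omega)
      rw [h2]
      exact cauchyTransform_map_sq_eq hm hS (hκ _) hw hz
    rw [h1]
    exact (tendsto_finsetSum _ fun i _ => (hω w hw _).div_const w).const_mul _
  refine ⟨⟨_, hμprob⟩, ν, fun j => σ (blockIndex K L hd (K + j - 1)),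
    fun j => F (blockIndex K L hd (j - 1)), fun j => F (blockIndex K L hd (K + j - 1)),
    fun _ _ _ _ => rfl, fun _ _ _ _ => rfl, fun j hj => ?_, rfl, hμ, ?_, fun j hj z hz => ?_,
    fun j hj z hz => ?_, fun z hz => ?_, fun z hz => ?_⟩
  · rw [Finset.mem_Icc] at hj
    exact absolutelyContinuous_channel_limit hL hm hκ (by rw [blockIndex_val] <;> omega)
  · filter_upwards [hlim] with ω hω
    refine ⟨?_, fun z hz => (tendsto_add_atTop_iff_nat 1).1 (hω z hz)⟩
    -- At `N = 0` the matrix is empty and its spectral law is the zero measure, so weak convergence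
    -- of probability measures is used from `N = 1` on.
    rw [← tendsto_add_atTop_iff_nat 1]
    have : Nonempty (Fin K) := ⟨⟨0, hK⟩⟩
    refine (ProbabilityMeasure.tendsto_nhds_iff_toFiniteMeasure_tendsto_nhds atTop
      (μs := fun n : ℕ => ⟨(spectralLaw (channelWishart_isHermitian K (A (n + 1) ω)) :
        Measure ℝ), isProbabilityMeasure_spectralLaw _⟩)).1 ?_
    refine tendsto_of_tendsto_cauchyTransform (fun z hz => ?_)
      (tendsto_mul_cauchyTransform_atTop (hμ := hμprob))
    simp only [ProbabilityMeasure.coe_mk]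
    rw [hμ z hz]
    exact hω z hz
  · rw [Finset.mem_Icc] at hj
    have h1 : blockIndex K L hd (K + 1 - j - 1) =
        blockReflection K L (blockIndex K L hd (j - 1)) := Fin.ext (by
      rw [blockReflection_val, blockIndex_val (by omega), blockIndex_val (by omega),
        if_pos (by omega)]
      omega)
    simp only [h1]
    exact (cauchyTransform_map_sq_comp hm hS hκ _ channelS_blockReflection hz _).symm
  · rw [Finset.mem_Icc] at hj
    have h1 : blockIndex K L hd (K + (K + L - j) - 1) =
        blockReflection K L (blockIndex K L hd (K + j - 1)) := Fin.ext (by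
      rw [blockReflection_val, blockIndex_val (by omega), blockIndex_val (by omega),
        if_neg (by omega)]
      omega)
    simp only [h1]
    exact (cauchyTransform_map_sq_comp hm hS hκ _ channelS_blockReflection hz _).symm
  · rw [diagMatrix_blockIndex fun b => F b z, covarianceMap_channelCov_diagonal,
      Matrix.diagonal_mul_diagonal, ← Matrix.diagonal_smul, ← Matrix.diagonal_smul,
      ← Matrix.diagonal_one, Matrix.diagonal_add]
    congr 1
    funext b
    exact cauchyTransform_map_sq_mul hm hS hκ hz b
  · rw [diagMatrix_blockIndex fun b => F b z, covarianceMap_channelCov_diagonal]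
    congr 1
    funext i
    exact sum_channelS_mul_eq_etaEntry (fun b => F b z) i
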